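/- **Theorem.** Consider simple bipartite graphs $G$ with $n\ge 3$ vertices and $m\ge 1$ edges. For costs $c\in\mathbb Z_{\ge0}^m$ and demands $b\in\mathbb Z_{\ge0}^n$, a *perfect $b$-matching* is a vector $M\in\mathbb Z_{\ge0}^m$ with $\sum_{e\ni v}M_e=b_v$ for every vertex $v$; its weight is $\sum_e c_eM_e$. An *optimal dual vector* for $(c,b)$ is a maximizer of $\sum_v b_vy_v$ over the $y\in\mathbb R^n$ with $y_u+y_v\le c_e$ for every edge $e=uv$. For every instance $(c,b)$ that has a perfect $b$-matching let $x^*(c,b)\in\mathbb Z^n$ be an (arbitrarily chosen) integral optimal dual vector. Write $\|x\|_{b,1}=\sum_v b_v|x_v|$. Algorithms are programs for an integer random-access machine with logarithmic costs; graphs are part of the input, and one program and one set of constants serve all graphs. 1. There are an algorithm and constants $K,k$ such that for all $G$, $c$, $b$ with a perfect $b$-matching, and every $x\in\mathbb R^n$, the algorithm, given $G,c,b$ and the vector of entries of $x$ rounded to nearest integers, returns a minimum-weight perfect $b$-matching, in time at most $$K\,mn\,\bigl(1+\|x-x^*(c,b)\|_{b,1}\bigr)\,(\log N)^k,\qquad\text{i.e.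 } \tilde{\mathcal O}\bigl(mn(1+\|x-x^*(c,b)\|_{b,1})\bigr),$$ for every choice of the integral optimal dual vector $x^*(c,b)$ and every integer $N\ge\max\{n,\|c\|_\infty,\|b\|_\infty,\|x\|_\infty\}$. 2. There are a polynomial-time learning algorithm and a constant $K$ such that for all $G$, all $C,B\in\mathbb Z_{\ge 0}$, all $\varepsilon,\delta>0$, every number $T\ge K\left(\frac{CBn}{\varepsilon}\right)^2\log\frac2\delta$ of samples, and every distribution $\mathcal D$ over pairs $(c,b)$ that have a perfect $b$-matching and satisfy $\|c\|_\infty\le C$, $\|b\|_\infty\le B$, the algorithm, given $G,C,B$ and $T$ independent samples from $\mathcal D$, returns $\hat x\in\mathbb Q^n$ such that with probability at least $1-\delta$ $$\mathbb E_{(c,b)\sim\mathcal D}\|\hat x-x^*(c,b)\|_{b,1}\le\min_{\|x\|_\infty\le C}\mathbb E_{(c,b)\sim\mathcal D}\|x-x^*(c,b)\|_{b,1}+\varepsilon .$$ This holds (a) for some choice of $x^*$, with an algorithm that sees only the sampled pairs $(c_t,b_t)$ and runs in time polynomial in $n,m,T$ and the bit lengths of $C,B$; and (b) for every choice of $x^*$,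 with an algorithm that also receives the feedback $x^*(c_t,b_t)$ for each sample and runs in time polynomial in these quantities and the bit length of the feedback entries. 3. For all reals $C,B\ge0$ and every $T$ there is a step size $\alpha>0$, depending only on $C,B,T$, such that for every $G$, every choice of $x^*$, and every sequence $(c_1,b_1),\dots,(c_T,b_T)$ of pairs that have perfect $b_t$-matchings with $\|c_t\|_\infty\le C$, $\|b_t\|_\infty\le B$, the actions $x_1=0$, $x_{t+1}=\Pi_{[-C,C]^n}(x_t-\alpha g_t)$ of projected online subgradient descent, with $g_t$ any subgradient at $x_t$ of $x\mapsto\|x-x^*(c_t,b_t)\|_{b_t,1}$, satisfy $$\max_{\|x\|_\infty\le C}\sum_{t=1}^T\Bigl(\|x_t-x^*(c_t,b_t)\|_{b_t,1}-\|x-x^*(c_t,b_t)\|_{b_t,1}\Bigr)\le CBn\sqrt{2T}.$$ -/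

import Mathlib

open MeasureTheory

/-! ### Bipartite graphs, perfect b-matchings and their linear-programming duals -/

/-- A simple bipartite graph with vertex set `Fin n` and edge set `Fin m`. Edge `e` joins its left
endpoint `left e` to its right endpoint `right e`; no vertex is a left endpoint of one edge and a
right endpoint of another one, and there are no parallel edges. -/
structure BipartiteGraph (n m : ℕ) where
  left : Fin m → Fin n
  right : Fin m → Fin n
  left_ne_right : ∀ e e', left e ≠ right e'
  simple : Function.Injective fun e => (left e, right e)

/-- A (cost vector, demand vector) pair for a graph with `n` vertices and `m` edges. -/
abbrev BInstance (n m : ℕ) : Type := (Fin m → ℕ) × (Fin n → ℕ)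

/-- The `b`-seminorm `∑ i, b i * |x i|`. -/
def bSeminorm {n : ℕ} (b : Fin n → ℕ) (x : Fin n → ℝ) : ℝ := ∑ i, (b i : ℝ) * |x i|

namespace BipartiteGraph

variable {n m : ℕ}

/-- `M` (a multiplicity for every edge) is a perfect `b`-matching: the multiplicities of the edges
at each vertex `v` add up to `b v`. -/
def IsPerfectBMatching (G : BipartiteGraph n m) (b : Fin n → ℕ) (M : Fin m → ℕ) : Prop :=
  ∀ v, ∑ e with G.left e = v ∨ G.right e = v, M e = b v

/-- `M` is a perfect `b`-matching of minimum weight with respect to the edge costs `c`. -/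
def IsMinWeightPerfectBMatching (G : BipartiteGraph n m) (c : Fin m → ℕ) (b : Fin n → ℕ)
    (M : Fin m → ℕ) : Prop :=
  G.IsPerfectBMatching b M ∧
    ∀ M', G.IsPerfectBMatching b M' → ∑ e, c e * M e ≤ ∑ e, c e * M' e

/-- Feasibility for the dual of the linear program `min ∑ e, c e * M e` over `M ≥ 0` with
`∑_{e ∋ v} M e = b v` for all `v`. -/
def IsDualFeasible (G : BipartiteGraph n m) (c : Fin m → ℕ) (y : Fin n → ℝ) : Prop :=
  ∀ e, y (G.left e) + y (G.right e) ≤ c e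

/-- `y` is an optimal dual vector for the costs `c` and the demands `b`: it maximizes
`∑ v, b v * y v` among the feasible dual vectors. -/
def IsOptimalDual (G : BipartiteGraph n m) (c : Fin m → ℕ) (b : Fin n → ℕ)
    (y : Fin n → ℝ) : Prop :=
  G.IsDualFeasible c y ∧
    ∀ z, G.IsDualFeasible c z → ∑ v, (b v : ℝ) * z v ≤ ∑ v, (b v : ℝ) * y v

/-- `xstar` assigns to every instance that has a perfect `b`-matching (equivalently, an optimal
dual vector) one of its integral optimal dual vectors. -/
def IsDualSelection (G : BipartiteGraph n m) (xstar : BInstance n m → Fin n → ℤ) : Prop :=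
  ∀ I : BInstance n m, (∃ M, G.IsPerfectBMatching I.2 M) →
    G.IsOptimalDual I.1 I.2 fun v => (xstar I v : ℝ)

/-- Costs are at most `C`, demands are at most `B`, and a perfect `b`-matching exists. -/
def IsAdmissible (G : BipartiteGraph n m) (C B : ℝ) (I : BInstance n m) : Prop :=
  (∀ e, (I.1 e : ℝ) ≤ C) ∧ (∀ v, (I.2 v : ℝ) ≤ B) ∧ ∃ M, G.IsPerfectBMatching I.2 M

end BipartiteGraph

/-- The loss `‖x - x*(c,b)‖_{b,1}` of the prediction `x` on the instance `I = (c,b)`. -/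
def dualLoss {n m : ℕ} (xstar : BInstance n m → Fin n → ℤ) (I : BInstance n m)
    (x : Fin n → ℝ) : ℝ :=
  bSeminorm I.2 fun v => x v - xstar I v

/-! ### A machine model: programs over integer registers and arrays, with logarithmic costs -/

namespace Machine

/-- The memory: integer registers and integer arrays, both named by natural numbers. -/
structure State where
  reg : ℕ → ℤ
  arr : ℕ → ℤ → ℤ

inductive BinOp where
  | add | sub | mul | div | lt | eq

def BinOp.eval : BinOp → ℤ → ℤ → ℤ
  | .add, a, b => a + b
  | .sub, a, b => a - b
  | .mul, a, b => a * b
  | .div, a, b => a / b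
  | .lt, a, b => if a < b then 1 else 0
  | .eq, a, b => if a = b then 1 else 0

inductive Expr where
  | const (z : ℤ)
  | reg (r : ℕ)
  | get (a : ℕ) (i : Expr)
  | op (o : BinOp) (e₁ e₂ : Expr)

/-- Bit length of an integer. -/
def bits (z : ℤ) : ℕ := z.natAbs.size

def Expr.eval (σ : State) : Expr → ℤ
  | .const z => z
  | .reg r => σ.reg r
  | .get a i => σ.arr a (i.eval σ)
  | .op o e₁ e₂ => o.eval (e₁.eval σ) (e₂.eval σ)

/-- Logarithmic cost: each access or operation costs one plus the bit lengths of the integers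
(addresses included) that it handles. -/
def Expr.cost (σ : State) : Expr → ℕ
  | .const z => 1 + bits z
  | .reg r => 1 + bits (σ.reg r)
  | .get a i => i.cost σ + (1 + bits (i.eval σ) + bits (σ.arr a (i.eval σ)))
  | .op _ e₁ e₂ => e₁.cost σ + e₂.cost σ + (1 + bits (e₁.eval σ) + bits (e₂.eval σ))

/-- Programs. `branch` and `loop` test whether an expression is nonzero. -/
inductive Program where
  | skip
  | assign (r : ℕ) (e : Expr)
  | store (a : ℕ) (i e : Expr)
  | seq (p q : Program)
  | branch (e : Expr) (p q : Program)
  | loop (e : Expr) (p : Program)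

def State.setReg (σ : State) (r : ℕ) (z : ℤ) : State :=
  { σ with reg := Function.update σ.reg r z }

def State.setArr (σ : State) (a : ℕ) (i z : ℤ) : State :=
  { σ with arr := Function.update σ.arr a (Function.update (σ.arr a) i z) }

/-- `Runs p σ t σ'`: started in `σ`, the program `p` halts in `σ'` after time exactly `t`. -/
inductive Runs : Program → State → ℕ → State → Prop where
  | skip (σ : State) : Runs .skip σ 1 σ
  | assign (σ : State) (r : ℕ) (e : Expr) :
      Runs (.assign r e) σ (1 + e.cost σ + bits (e.eval σ)) (σ.setReg r (e.eval σ))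
  | store (σ : State) (a : ℕ) (i e : Expr) :
      Runs (.store a i e) σ (1 + i.cost σ + e.cost σ + bits (i.eval σ) + bits (e.eval σ))
        (σ.setArr a (i.eval σ) (e.eval σ))
  | seq {p q : Program} {σ σ₁ σ₂ : State} {t₁ t₂ : ℕ} :
      Runs p σ t₁ σ₁ → Runs q σ₁ t₂ σ₂ → Runs (.seq p q) σ (t₁ + t₂) σ₂
  | branch_true {e : Expr} {p q : Program} {σ σ' : State} {t : ℕ} :
      e.eval σ ≠ 0 → Runs p σ t σ' → Runs (.branch e p q) σ (1 + e.cost σ + t) σ'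
  | branch_false {e : Expr} {p q : Program} {σ σ' : State} {t : ℕ} :
      e.eval σ = 0 → Runs q σ t σ' → Runs (.branch e p q) σ (1 + e.cost σ + t) σ'
  | loop_done {e : Expr} {p : Program} {σ : State} :
      e.eval σ = 0 → Runs (.loop e p) σ (1 + e.cost σ) σ
  | loop_step {e : Expr} {p : Program} {σ σ₁ σ₂ : State} {t₁ t₂ : ℕ} :
      e.eval σ ≠ 0 → Runs p σ t₁ σ₁ → Runs (.loop e p) σ₁ t₂ σ₂ →
        Runs (.loop e p) σ (1 + e.cost σ + t₁ + t₂) σ₂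

/-- A vector as the contents of an array: entry `i` sits at address `i`, all other cells are 0. -/
def vec {k : ℕ} (f : Fin k → ℤ) : ℤ → ℤ := fun i =>
  if h : 0 ≤ i ∧ i.toNat < k then f ⟨i.toNat, h.2⟩ else 0

/-- A matrix as the contents of an array, row by row: entry `(t, i)` sits at address `t * k + i`. -/
def table {T k : ℕ} (f : Fin T → Fin k → ℤ) : ℤ → ℤ :=
  vec fun j : Fin (T * k) => f j.divNat j.modNat

end Machine

open Machine

/-- Input of the matching algorithm: registers 0, 1 hold `n`, `m`; arrays 0 and 1 hold the
endpoints of the edges, arrays 2, 3 and 4 hold the costs, the demands, and the entries of the real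
prediction `x` rounded to the nearest integers. Everything else is 0. -/
noncomputable def matchingInput {n m : ℕ} (G : BipartiteGraph n m) (c : Fin m → ℕ)
    (b : Fin n → ℕ) (x : Fin n → ℝ) : State where
  reg
    | 0 => n
    | 1 => m
    | _ => 0
  arr
    | 0 => vec fun e => (G.left e : ℤ)
    | 1 => vec fun e => (G.right e : ℤ)
    | 2 => vec fun e => (c e : ℤ)
    | 3 => vec fun v => (b v : ℤ)
    | 4 => vec fun v => round (x v)
    | _ => fun _ => 0

/-- The edge multiplicities `M` are in array 5 of the memory `σ`. -/
def OutputsMatching {m : ℕ} (σ : State) (M : Fin m → ℕ) : Prop :=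
  ∀ e : Fin m, σ.arr 5 (e : ℤ) = M e

/-- Input of a learning algorithm: registers 0, ..., 4 hold `n`, `m`, `T`, `C`, `B`; arrays 0 and 1
hold the endpoints of the edges, arrays 2 and 3 the costs and the demands of the `T` sampled
instances, and array 4 a vector `y t` of feedback for each of them (take `y = 0` for an algorithm
that sees nothing but the instances). Everything else is 0. -/
def learningInput {n m T : ℕ} (G : BipartiteGraph n m) (C B : ℕ) (S : Fin T → BInstance n m)
    (y : Fin T → Fin n → ℤ) : State where
  reg
    | 0 => n
    | 1 => m
    | 2 => T
    | 3 => C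
    | 4 => B
    | _ => 0
  arr
    | 0 => vec fun e => (G.left e : ℤ)
    | 1 => vec fun e => (G.right e : ℤ)
    | 2 => table fun t e => ((S t).1 e : ℤ)
    | 3 => table fun t v => ((S t).2 v : ℤ)
    | 4 => table y
    | _ => fun _ => 0

/-- The memory `σ` holds the rational vector `x`: numerators in array 5, a common positive
denominator in register 5. -/
def OutputsVector {n : ℕ} (σ : State) (x : Fin n → ℝ) : Prop :=
  0 < σ.reg 5 ∧ ∀ v : Fin n, x v = (σ.arr 5 (v : ℤ) : ℝ) / (σ.reg 5 : ℝ)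

/-! ### Learning -/

/-- The rule `xhat`, which maps `T` samples to a prediction, has the following guarantee. For
every distribution `D` on admissible instances and all `ε, δ > 0` with
`T ≥ K * (C * B * n / ε) ^ 2 * log (2 / δ)`, with probability at least `1 - δ` over `T` independent
samples from `D`, the expected loss of the prediction is at most `ε` above that of any
`x ∈ [-C, C]^n`. -/
def LearnsDuals {n m : ℕ} (G : BipartiteGraph n m) (xstar : BInstance n m → Fin n → ℤ) (C B : ℕ)
    (K : ℝ) (T : ℕ) (xhat : (Fin T → BInstance n m) → Fin n → ℝ) : Prop :=
  ∀ (D : Measure (BInstance n m)) [IsProbabilityMeasure D], (∀ᵐ I ∂D, G.IsAdmissible C B I) →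
    ∀ ε δ : ℝ, 0 < ε → 0 < δ → K * ((C : ℝ) * B * n / ε) ^ 2 * Real.log (2 / δ) ≤ T →
      1 - δ ≤ (Measure.pi fun _ : Fin T => D).real
        {S | ∀ x : Fin n → ℝ, (∀ v, |x v| ≤ C) →
          ∫ I, dualLoss xstar I (xhat S) ∂D ≤ ∫ I, dualLoss xstar I x ∂D + ε}

/-- `g` is a subgradient of `f` at `x`. -/
def IsSubgradient {n : ℕ} (f : EuclideanSpace ℝ (Fin n) → ℝ) (x g : EuclideanSpace ℝ (Fin n)) :
    Prop :=
  ∀ y, f x + inner ℝ g (y - x) ≤ f y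

/-- `p` is a Euclidean projection of `z` to `X`. -/
def IsProjection {n : ℕ} (X : Set (EuclideanSpace ℝ (Fin n))) (z p : EuclideanSpace ℝ (Fin n)) :
    Prop :=
  p ∈ X ∧ ∀ q ∈ X, ‖z - p‖ ≤ ‖z - q‖

/-- `x 0, ..., x (T - 1)` are the actions of projected online subgradient descent over `X`, started
at the origin, with step size `α`, on the losses `f 0, ..., f (T - 1)`; any subgradients may be
used. -/
def IsOGDRun {n : ℕ} (X : Set (EuclideanSpace ℝ (Fin n))) (α : ℝ) (T : ℕ)
    (f : ℕ → EuclideanSpace ℝ (Fin n) → ℝ) (x : ℕ → EuclideanSpace ℝ (Fin n)) : Prop :=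
  x 0 = 0 ∧ ∀ t, t + 1 < T → ∃ g, IsSubgradient (f t) (x t) g ∧
    IsProjection X (x t - α • g) (x (t + 1))

/-!
The matching algorithm is primal-dual. It first repairs the rounded prediction `p`: for every
infeasible edge, the endpoint of smaller demand is lowered until the edge is feasible. Each vertex
thus loses at most its own error plus the error of a neighbour of at least the same demand, so the
value of the repaired dual vector `y` is below the optimum by at most
`(n + 2) * ∑ v, b v * |p v - x* v|` (`Machine.Repaired.sum_le`). A maximum `b`-matching of tight
edges for `y` is found by demand scaling: for `b / 2 ^ k` with `k` descending to 0, the doubled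
matching of the previous phase has deficiency at most `n` by König's theorem, so each phase needs
at most `n` augmentations (`Machine.scaleLoop_tight`). From then on, augmentations and dual steps
alternate until the matching is perfect. A dual step raises the dual value by the step size times
the deficiency of the matching, so that the deficiency is at most the remaining gap
(`Machine.deficiency_le`), and the gap plus the deficiency is a potential that drops in every
iteration. An iteration is a graph search and takes `O(m)` operations (`Machine.step_spec`). Running
times are first counted in unit steps on integers of bounded size; `Machine.HT.runs` converts them
to logarithmic costs.

For projected online subgradient descent, the usual telescoping argument applies (`regret_ogd_le`):
the box `[-C, C]^n` has radius `C * √n`, and the subgradients of the losses have norm at most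
`B * √n`. The learning algorithm runs subgradient descent in integer arithmetic over the samples,
with a common denominator, and returns the average action. Online-to-batch conversion turns the
regret bound into one for the expected loss, with Hoeffding's lemma and a Chernoff bound for the
adapted sequence of deviations (`learnsDuals_ogdAverage`). This works for every choice of the
optimal dual vectors `x*` if they are given as feedback.

Without feedback, the algorithm computes `x*` itself, by demand scaling with dual steps started at
`y = 0`. The matchings in this computation are not canonical, but the dual vectors are: a dual
step depends only on the set of vertices reachable from unsaturated left vertices, and this set is
the same for all complementary matchings without augmenting paths, being the least minimum cut
(`BipartiteGraph.Compl.reachSet_eq`). Hence the result is a function of the instance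
(`Machine.HFinal.unique`), which serves as the choice of `x*`. In each phase there are at most `n`
augmentations, with at most `n` dual steps between two of them, and every dual step at most triples
the numbers involved, so all bit lengths are polynomial (`Machine.scaleLoop_hungarian`).
-/

namespace Machine

/-! ### Unit-cost executions with bounded values -/

theorem bits_le_iff {z : ℤ} {k : ℕ} : bits z ≤ k ↔ z.natAbs < 2 ^ k := Nat.size_le

theorem bits_mono {a b : ℤ} (h : a.natAbs ≤ b.natAbs) : bits a ≤ bits b :=
  Nat.size_le_size h

theorem bits_add_le (a b : ℤ) : bits (a + b) ≤ bits a + bits b + 1 := by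
  rw [bits_le_iff]
  have h1 := bits_le_iff.1 (le_refl (bits a))
  have h2 := bits_le_iff.1 (le_refl (bits b))
  have h3 := Int.natAbs_add_le a b
  have h4 : 2 ^ bits a ≤ 2 ^ (bits a + bits b) := Nat.pow_le_pow_right (by norm_num) (by omega)
  have h5 : 2 ^ bits b ≤ 2 ^ (bits a + bits b) := Nat.pow_le_pow_right (by norm_num) (by omega)
  rw [pow_succ]; omega

theorem bits_sub_le (a b : ℤ) : bits (a - b) ≤ bits a + bits b + 1 := by
  have h := bits_add_le a (-b)
  have h2 : bits (-b) = bits b := by simp [bits]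
  rwa [← sub_eq_add_neg, h2] at h

theorem bits_mul_le (a b : ℤ) : bits (a * b) ≤ bits a + bits b := by
  rw [bits_le_iff, Int.natAbs_mul, pow_add]
  exact Nat.mul_lt_mul'' (bits_le_iff.1 le_rfl) (bits_le_iff.1 le_rfl)

theorem bits_div_le (a b : ℤ) : bits (a / b) ≤ bits a :=
  bits_mono (by simpa using Int.natAbs_ediv_le_natAbs a b)

theorem bits_op_le (o : BinOp) (a b : ℤ) : bits (o.eval a b) ≤ bits a + bits b + 1 := by
  have h1 : bits 1 = 1 := by simp [bits]
  have h0 : bits 0 = 0 := by simp [bits]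
  cases o <;> simp only [BinOp.eval]
  · exact bits_add_le a b
  · exact bits_sub_le a b
  · exact (bits_mul_le a b).trans (by omega)
  · exact (bits_div_le a b).trans (by omega)
  · split_ifs <;> omega
  · split_ifs <;> omega

/-- A syntactic weight of expressions, which controls the length of their values. -/
def Expr.len : Expr → ℕ
  | .const z => 1 + bits z
  | .reg _ => 1
  | .get _ i => i.len + 1
  | .op _ e₁ e₂ => e₁.len + e₂.len + 1

/-- All registers and all array cells hold integers of absolute value at most `U`. -/
def Bounded (U : ℕ) (σ : State) : Prop :=
  (∀ r, (σ.reg r).natAbs ≤ U) ∧ ∀ a i, (σ.arr a i).natAbs ≤ U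

/-- The integer `z` is at most `U` in absolute value. -/
def Small (U : ℕ) (z : ℤ) : Prop := -(U : ℤ) ≤ z ∧ z ≤ U

theorem small_iff {U : ℕ} {z : ℤ} : Small U z ↔ z.natAbs ≤ U := by
  unfold Small; omega

theorem Small.of_nonneg {U : ℕ} {z : ℤ} (h0 : 0 ≤ z) (h : z ≤ U) : Small U z :=
  ⟨by omega, h⟩

/-- An expression of weight `len` has a value of at most `len` times the bit length of the memory:
each operation adds at most one bit to the total length of its operands. -/
theorem Expr.bits_eval_le {U : ℕ} {σ : State} (h : Bounded U σ) :
    ∀ e : Expr, bits (e.eval σ) ≤ e.len * (U.size + 1)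
  | .const z => by simp only [eval, len]; nlinarith [Nat.zero_le U.size, Nat.zero_le (bits z)]
  | .reg r => by
      have : bits (σ.reg r) ≤ U.size := Nat.size_le_size (h.1 r)
      simp only [eval, len]; omega
  | .get a i => by
      have : bits (σ.arr a (i.eval σ)) ≤ U.size := Nat.size_le_size (h.2 a _)
      simp only [eval, len]; nlinarith [Nat.zero_le (i.len * (U.size + 1))]
  | .op o e₁ e₂ => by
      have h1 := bits_eval_le h e₁
      have h2 := bits_eval_le h e₂
      have := bits_op_le o (e₁.eval σ) (e₂.eval σ)
      simp only [eval, len]; nlinarith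

theorem Expr.len_pos : ∀ e : Expr, 1 ≤ e.len
  | .const _ => by simp [len]
  | .reg _ => by simp [len]
  | .get _ _ => by simp [len]
  | .op _ _ _ => by simp [len]

theorem Expr.cost_le {U : ℕ} {σ : State} (h : Bounded U σ) :
    ∀ e : Expr, e.cost σ ≤ 3 * e.len ^ 2 * (U.size + 1)
  | .const z => by
      simp only [cost, len]
      nlinarith [Nat.zero_le (U.size), Nat.zero_le (bits z),
        Nat.zero_le ((1 + bits z) ^ 2 * U.size)]
  | .reg r => by
      have : bits (σ.reg r) ≤ U.size := Nat.size_le_size (h.1 r)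
      simp only [cost, len]; omega
  | .get a i => by
      have h1 : bits (σ.arr a (i.eval σ)) ≤ U.size := Nat.size_le_size (h.2 a _)
      have h2 := i.bits_eval_le h
      have h3 := cost_le h i
      simp only [cost, len]
      nlinarith [Nat.zero_le (i.len * (U.size + 1))]
  | .op o e₁ e₂ => by
      have h1 := cost_le h e₁
      have h2 := cost_le h e₂
      have h3 := e₁.bits_eval_le h
      have h4 := e₂.bits_eval_le h
      simp only [cost, len]
      have : 3 * (e₁.len + e₂.len + 1) ^ 2 * (U.size + 1) = 3 * e₁.len ^ 2 * (U.size + 1)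
        + 3 * e₂.len ^ 2 * (U.size + 1) + 3 * (U.size + 1) + 6 * (e₁.len * (U.size + 1))
        + 6 * (e₂.len * (U.size + 1)) + 6 * (e₁.len * e₂.len * (U.size + 1)) := by ring
      rw [this]; omega

/-- A syntactic weight of programs, which controls the cost of a unit step. -/
def Program.weight : Program → ℕ
  | .skip => 1
  | .assign _ e => 5 * e.len ^ 2
  | .store _ i e => 5 * i.len ^ 2 + 5 * e.len ^ 2
  | .seq p q => p.weight + q.weight
  | .branch e p q => 5 * e.len ^ 2 + p.weight + q.weight
  | .loop e p => 5 * e.len ^ 2 + p.weight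

/-- `Exec U p σ s σ'`: started in `σ`, the program `p` halts in `σ'` after `s` unit steps
(assignments, stores, tests), and every integer it writes is at most `U` in absolute value. -/
inductive Exec (U : ℕ) : Program → State → ℕ → State → Prop where
  | skip (σ : State) : Exec U .skip σ 1 σ
  | assign (σ : State) (r : ℕ) (e : Expr) (h : Small U (e.eval σ)) :
      Exec U (.assign r e) σ 1 (σ.setReg r (e.eval σ))
  | store (σ : State) (a : ℕ) (i e : Expr) (h : Small U (e.eval σ)) :
      Exec U (.store a i e) σ 1 (σ.setArr a (i.eval σ) (e.eval σ))
  | seq {p q : Program} {σ σ₁ σ₂ : State} {t₁ t₂ : ℕ} :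
      Exec U p σ t₁ σ₁ → Exec U q σ₁ t₂ σ₂ → Exec U (.seq p q) σ (t₁ + t₂) σ₂
  | branch_true {e : Expr} {p q : Program} {σ σ' : State} {t : ℕ} :
      e.eval σ ≠ 0 → Exec U p σ t σ' → Exec U (.branch e p q) σ (1 + t) σ'
  | branch_false {e : Expr} {p q : Program} {σ σ' : State} {t : ℕ} :
      e.eval σ = 0 → Exec U q σ t σ' → Exec U (.branch e p q) σ (1 + t) σ'
  | loop_done {e : Expr} {p : Program} {σ : State} :
      e.eval σ = 0 → Exec U (.loop e p) σ 1 σ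
  | loop_step {e : Expr} {p : Program} {σ σ₁ σ₂ : State} {t₁ t₂ : ℕ} :
      e.eval σ ≠ 0 → Exec U p σ t₁ σ₁ → Exec U (.loop e p) σ₁ t₂ σ₂ →
        Exec U (.loop e p) σ (1 + t₁ + t₂) σ₂

theorem Bounded.setReg {U : ℕ} {σ : State} (h : Bounded U σ) {r : ℕ} {z : ℤ} (hz : Small U z) :
    Bounded U (σ.setReg r z) := by
  refine ⟨fun r' => ?_, h.2⟩
  simp only [State.setReg, Function.update_apply]
  split_ifs
  exacts [small_iff.1 hz, h.1 r']

theorem Bounded.setArr {U : ℕ} {σ : State} (h : Bounded U σ) {a : ℕ} {i z : ℤ} (hz : Small U z) :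
    Bounded U (σ.setArr a i z) := by
  refine ⟨h.1, fun a' i' => ?_⟩
  simp only [State.setArr, Function.update_apply]
  split_ifs with h1
  · simp only [Function.update_apply]
    split_ifs
    exacts [small_iff.1 hz, h.2 a i']
  · exact h.2 a' i'

/-- An execution of `s` unit steps on bounded values takes logarithmic-cost time
`O(s * log U)`. -/
theorem Exec.runs {U : ℕ} {p : Program} {σ σ' : State} {s : ℕ} (h : Exec U p σ s σ')
    (hb : Bounded U σ) :
    Bounded U σ' ∧ ∃ t, Runs p σ t σ' ∧ t ≤ s * (p.weight * (U.size + 1)) := by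
  have key : ∀ (e : Expr) (σ : State), Bounded U σ →
      1 + e.cost σ + bits (e.eval σ) ≤ 5 * e.len ^ 2 * (U.size + 1) := by
    intro e σ hb
    have h1 := e.cost_le hb
    have h2 := e.bits_eval_le hb
    have h3 := e.len_pos
    have h4 : e.len * (U.size + 1) ≤ e.len ^ 2 * (U.size + 1) :=
      Nat.mul_le_mul_right _ (by nlinarith)
    have h5 : 1 ≤ e.len ^ 2 * (U.size + 1) := Nat.mul_pos (by positivity) (by omega)
    have h6 : 5 * e.len ^ 2 * (U.size + 1) = 3 * e.len ^ 2 * (U.size + 1)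
      + 2 * (e.len ^ 2 * (U.size + 1)) := by ring
    omega
  induction h with
  | skip σ => exact ⟨hb, 1, .skip σ, by simp [Program.weight]⟩
  | assign σ r e h =>
      exact ⟨hb.setReg h, _, .assign σ r e, by simpa [Program.weight] using key e σ hb⟩
  | store σ a i e h =>
      refine ⟨hb.setArr h, _, .store σ a i e, ?_⟩
      have h1 := key e σ hb
      have h2 := key i σ hb
      simp only [Program.weight, one_mul, add_mul]; omega
  | @seq p q σ σ₁ σ₂ t₁ t₂ h1 h2 ih1 ih2 =>
      obtain ⟨hb1, t1, r1, l1⟩ := ih1 hb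
      obtain ⟨hb2, t2, r2, l2⟩ := ih2 hb1
      refine ⟨hb2, _, .seq r1 r2, ?_⟩
      simp only [Program.weight]
      nlinarith [Nat.zero_le (t₁ * (q.weight * (U.size + 1))),
        Nat.zero_le (t₂ * (p.weight * (U.size + 1)))]
  | @branch_true e p q σ σ' t he h1 ih =>
      obtain ⟨hb1, t1, r1, l1⟩ := ih hb
      refine ⟨hb1, _, .branch_true he r1, ?_⟩
      have := key e σ hb
      simp only [Program.weight]
      nlinarith [Nat.zero_le (t * (q.weight * (U.size + 1))), Nat.zero_le (q.weight * (U.size + 1)),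
        Nat.zero_le (t * (5 * e.len ^ 2 * (U.size + 1))), Nat.zero_le (p.weight * (U.size + 1))]
  | @branch_false e p q σ σ' t he h1 ih =>
      obtain ⟨hb1, t1, r1, l1⟩ := ih hb
      refine ⟨hb1, _, .branch_false he r1, ?_⟩
      have := key e σ hb
      simp only [Program.weight]
      nlinarith [Nat.zero_le (t * (p.weight * (U.size + 1))), Nat.zero_le (q.weight * (U.size + 1)),
        Nat.zero_le (t * (5 * e.len ^ 2 * (U.size + 1))), Nat.zero_le (p.weight * (U.size + 1))]
  | @loop_done e p σ he =>
      refine ⟨hb, _, .loop_done he, ?_⟩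
      have := key e σ hb
      simp only [Program.weight]
      nlinarith [Nat.zero_le (p.weight * (U.size + 1))]
  | @loop_step e p σ σ₁ σ₂ t₁ t₂ he h1 h2 ih1 ih2 =>
      obtain ⟨hb1, t1, r1, l1⟩ := ih1 hb
      obtain ⟨hb2, t2, r2, l2⟩ := ih2 hb1
      refine ⟨hb2, _, .loop_step he r1 r2, ?_⟩
      have := key e σ hb
      simp only [Program.weight] at l2 ⊢
      nlinarith [Nat.zero_le (t₁ * (5 * e.len ^ 2 * (U.size + 1))),
        Nat.zero_le (p.weight * (U.size + 1))]

/-- The program `p` may write to register `r`. -/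
def Program.modReg (r : ℕ) : Program → Prop
  | .skip => False
  | .assign r' _ => r = r'
  | .store _ _ _ => False
  | .seq p q => p.modReg r ∨ q.modReg r
  | .branch _ p q => p.modReg r ∨ q.modReg r
  | .loop _ p => p.modReg r

/-- The program `p` may write to array `a`. -/
def Program.modArr (a : ℕ) : Program → Prop
  | .skip => False
  | .assign _ _ => False
  | .store a' _ _ => a = a'
  | .seq p q => p.modArr a ∨ q.modArr a
  | .branch _ p q => p.modArr a ∨ q.modArr a
  | .loop _ p => p.modArr a

/-- The states `σ` and `σ'` agree on all registers and arrays that `p` does not write to. -/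
def Same (p : Program) (σ σ' : State) : Prop :=
  (∀ r, ¬ p.modReg r → σ'.reg r = σ.reg r) ∧ ∀ a, ¬ p.modArr a → σ'.arr a = σ.arr a

theorem Same.refl (p : Program) (σ : State) : Same p σ σ := ⟨fun _ _ => rfl, fun _ _ => rfl⟩

theorem Same.trans {p : Program} {σ σ₁ σ₂ : State} (h : Same p σ σ₁) (h' : Same p σ₁ σ₂) :
    Same p σ σ₂ :=
  ⟨fun r hr => (h'.1 r hr).trans (h.1 r hr), fun a ha => (h'.2 a ha).trans (h.2 a ha)⟩

theorem Same.mono {p q : Program} {σ σ' : State} (h : Same p σ σ')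
    (hr : ∀ r, p.modReg r → q.modReg r) (ha : ∀ a, p.modArr a → q.modArr a) : Same q σ σ' :=
  ⟨fun r h' => h.1 r fun h => h' (hr r h), fun a h' => h.2 a fun h => h' (ha a h)⟩

/-- A program changes only what it writes to syntactically. -/
theorem Exec.same {U : ℕ} {p : Program} {σ σ' : State} {s : ℕ} (h : Exec U p σ s σ') :
    Same p σ σ' := by
  induction h with
  | skip σ => exact .refl _ _
  | assign σ r e h =>
      exact ⟨fun r' h' => Function.update_of_ne h' _ _, fun _ _ => rfl⟩
  | store σ a i e h =>
      exact ⟨fun _ _ => rfl, fun a' h' => Function.update_of_ne h' _ _⟩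
  | seq h1 h2 ih1 ih2 =>
      exact (ih1.mono (fun _ => Or.inl) fun _ => Or.inl).trans
        (ih2.mono (fun _ => Or.inr) fun _ => Or.inr)
  | branch_true he h ih => exact ih.mono (fun _ => Or.inl) fun _ => Or.inl
  | branch_false he h ih => exact ih.mono (fun _ => Or.inr) fun _ => Or.inr
  | loop_done he => exact .refl _ _
  | loop_step he h1 h2 ih1 ih2 => exact Same.trans (ih1.mono (fun _ h => h) fun _ h => h) ih2

/-- Total correctness with a bound on the number of unit steps: from `σ`, the program `p` halts
within `s` unit steps, writes only integers of absolute value at most `U`, and ends in a state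
with property `Q`. -/
def HT (U : ℕ) (p : Program) (σ : State) (s : ℕ) (Q : State → Prop) : Prop :=
  ∃ s' σ', s' ≤ s ∧ Exec U p σ s' σ' ∧ Q σ'

theorem HT.mono {U : ℕ} {p : Program} {σ : State} {s s' : ℕ} {Q Q' : State → Prop}
    (h : HT U p σ s Q) (hs : s ≤ s') (hQ : ∀ τ, Same p σ τ → Q τ → Q' τ) : HT U p σ s' Q' := by
  obtain ⟨k, τ, hk, he, hq⟩ := h
  exact ⟨k, τ, hk.trans hs, he, hQ τ he.same hq⟩

theorem HT.seq {U : ℕ} {p q : Program} {σ : State} {s₁ s₂ : ℕ} {R Q : State → Prop}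
    (h : HT U p σ s₁ R) (h' : ∀ τ, Same p σ τ → R τ → HT U q τ s₂ Q) :
    HT U (.seq p q) σ (s₁ + s₂) Q := by
  obtain ⟨k, τ, hk, he, hq⟩ := h
  obtain ⟨k', τ', hk', he', hq'⟩ := h' τ he.same hq
  exact ⟨_, τ', add_le_add hk hk', he.seq he', hq'⟩

theorem HT.branch {U : ℕ} {e : Expr} {p q : Program} {σ : State} {s : ℕ} {Q : State → Prop}
    (h : e.eval σ ≠ 0 → HT U p σ s Q) (h' : e.eval σ = 0 → HT U q σ s Q) :
    HT U (.branch e p q) σ (1 + s) Q := by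
  by_cases he : e.eval σ = 0
  · obtain ⟨k, τ, hk, hx, hq⟩ := h' he
    exact ⟨_, τ, by omega, .branch_false he hx, hq⟩
  · obtain ⟨k, τ, hk, hx, hq⟩ := h he
    exact ⟨_, τ, by omega, .branch_true he hx, hq⟩

/-- The loop rule: `I k` is an invariant in which `k` bounds the number of remaining rounds. -/
theorem HT.loop {U : ℕ} {e : Expr} {p : Program} {s : ℕ} (I : ℕ → State → Prop)
    (step : ∀ k σ, I k σ → e.eval σ ≠ 0 → HT U p σ s fun τ => ∃ k' < k, I k' τ) :
    ∀ k σ, I k σ → HT U (.loop e p) σ (k * (s + 1) + 1) fun τ =>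
      (∃ k' ≤ k, I k' τ) ∧ e.eval τ = 0 := by
  intro k
  induction k using Nat.strong_induction_on with
  | _ k ih =>
    intro σ hI
    by_cases he : e.eval σ = 0
    · exact ⟨1, σ, by omega, .loop_done he, ⟨k, le_rfl, hI⟩, he⟩
    · obtain ⟨a, τ, ha, hx, k', hk', hI'⟩ := step k σ hI he
      obtain ⟨a', τ', ha', hx', ⟨k'', hk'', hq⟩, hq'⟩ := ih k' hk' τ hI'
      refine ⟨_, τ', ?_, .loop_step he hx hx', ⟨k'', by omega, hq⟩, hq'⟩
      have : (k' + 1) * (s + 1) ≤ k * (s + 1) := Nat.mul_le_mul_right _ hk'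
      rw [add_mul] at this
      omega

/-- The number of steps of a loop-free program is at most its size. -/
def Program.size : Program → ℕ
  | .skip => 1
  | .assign _ _ => 1
  | .store _ _ _ => 1
  | .seq p q => p.size + q.size
  | .branch _ p q => 1 + max p.size q.size
  | .loop _ _ => 0

/-- Weakest preconditions of loop-free programs. -/
def Program.wp (U : ℕ) : Program → (State → Prop) → State → Prop
  | .skip, Q, σ => Q σ
  | .assign r e, Q, σ => Small U (e.eval σ) ∧ Q (σ.setReg r (e.eval σ))
  | .store a i e, Q, σ => Small U (e.eval σ) ∧ Q (σ.setArr a (i.eval σ) (e.eval σ))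
  | .seq p q, Q, σ => p.wp U (q.wp U Q) σ
  | .branch e p q, Q, σ => (e.eval σ ≠ 0 → p.wp U Q σ) ∧ (e.eval σ = 0 → q.wp U Q σ)
  | .loop _ _, _, _ => False

/-- For loop-free programs, total correctness reduces to the weakest precondition. -/
theorem HT.of_wp {U : ℕ} : ∀ (p : Program) {Q : State → Prop} {σ : State}, p.wp U Q σ →
    HT U p σ p.size Q
  | .skip, _, σ, h => ⟨1, σ, le_rfl, .skip σ, h⟩
  | .assign r e, _, σ, h => ⟨1, _, le_rfl, .assign σ r e h.1, h.2⟩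
  | .store a i e, _, σ, h => ⟨1, _, le_rfl, .store σ a i e h.1, h.2⟩
  | .seq p q, _, _, h => (HT.of_wp p h).seq fun _ _ h => HT.of_wp q h
  | .branch _ p q, _, _, h =>
      HT.branch (fun he => (HT.of_wp p (h.1 he)).mono (le_max_left _ _) fun _ _ h => h)
        fun he => (HT.of_wp q (h.2 he)).mono (le_max_right _ _) fun _ _ h => h
  | .loop _ _, _, _, h => h.elim

/-- A bound on the number of unit steps yields one on the logarithmic cost, by a factor that depends
only on the program and on the bit length of the bound `U`. -/
theorem HT.runs {U : ℕ} {p : Program} {σ : State} {s : ℕ} {Q : State → Prop}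
    (h : HT U p σ s Q) (hb : Bounded U σ) :
    ∃ t σ', Runs p σ t σ' ∧ t ≤ s * (p.weight * (U.size + 1)) ∧ Q σ' := by
  obtain ⟨k, τ, hk, he, hq⟩ := h
  obtain ⟨-, t, hr, ht⟩ := he.runs hb
  exact ⟨t, τ, hr, ht.trans (Nat.mul_le_mul_right _ hk), hq⟩

/-! ### Notation and the sweep over all edges -/

instance : Add Expr := ⟨.op .add⟩
instance : Sub Expr := ⟨.op .sub⟩
instance : Mul Expr := ⟨.op .mul⟩
instance : Div Expr := ⟨.op .div⟩

/-- The expression with value 1 or 0 according to whether `e₁ < e₂`. -/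
def Expr.lt (e₁ e₂ : Expr) : Expr := .op .lt e₁ e₂

/-- The expression with value 1 or 0 according to whether `e₁ = e₂`. -/
def Expr.eq (e₁ e₂ : Expr) : Expr := .op .eq e₁ e₂

section eval
variable (σ : State) (e e' : Expr)
@[simp] theorem Expr.eval_add : (e + e').eval σ = e.eval σ + e'.eval σ := rfl
@[simp] theorem Expr.eval_sub : (e - e').eval σ = e.eval σ - e'.eval σ := rfl
@[simp] theorem Expr.eval_mul : (e * e').eval σ = e.eval σ * e'.eval σ := rfl
@[simp] theorem Expr.eval_div : (e / e').eval σ = e.eval σ / e'.eval σ := rfl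
@[simp] theorem Expr.eval_lt : (e.lt e').eval σ = if e.eval σ < e'.eval σ then 1 else 0 := rfl
@[simp] theorem Expr.eval_eq : (e.eq e').eval σ = if e.eval σ = e'.eval σ then 1 else 0 := rfl
@[simp] theorem Expr.eval_const (z : ℤ) : (Expr.const z).eval σ = z := rfl
@[simp] theorem Expr.eval_reg (r : ℕ) : (Expr.reg r).eval σ = σ.reg r := rfl
@[simp] theorem Expr.eval_get (a : ℕ) : (Expr.get a e).eval σ = σ.arr a (e.eval σ) := rfl
@[simp] theorem State.reg_setReg (r r' : ℕ) (z : ℤ) :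
    (σ.setReg r z).reg r' = if r' = r then z else σ.reg r' := Function.update_apply _ _ _ _
@[simp] theorem State.arr_setReg (r a : ℕ) (z : ℤ) : (σ.setReg r z).arr a = σ.arr a := rfl
@[simp] theorem State.reg_setArr (a r : ℕ) (i z : ℤ) : (σ.setArr a i z).reg r = σ.reg r := rfl
@[simp] theorem State.arr_setArr (a a' : ℕ) (i j z : ℤ) :
    (σ.setArr a i z).arr a' j = if a' = a ∧ j = i then z else σ.arr a' j := by
  simp only [State.setArr, Function.update_apply]
  by_cases h : a' = a
  · subst h; simp [Function.update_apply]
  · simp [h]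
end eval

attribute [simp] Program.wp Program.modReg Program.modArr Program.size

/-- `forEdges body` runs `body` for every edge; register 10 holds the number of the edge, and
register 1 the number `m` of edges. -/
def forEdges (body : Program) : Program :=
  .seq (.assign 10 (.const 0))
    (.loop ((Expr.reg 10).lt (.reg 1)) (.seq body (.assign 10 (.reg 10 + .const 1))))

/-- The rule for sweeps: `I i` is the invariant after the first `i` edges. -/
theorem HT.forEdges {U m : ℕ} {body : Program} {σ : State} {s : ℕ} (I : ℕ → State → Prop)
    (hm : σ.reg 1 = m) (hU : m ≤ U) (h10 : ¬ body.modReg 10) (h1 : ¬ body.modReg 1)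
    (hI : ∀ i τ z, I i τ → I i (τ.setReg 10 z)) (h0 : I 0 σ)
    (step : ∀ (e : Fin m) (τ : State), τ.reg 10 = (e : ℕ) → τ.reg 1 = m →
      Same (forEdges body) σ τ → I e τ → HT U body τ s (I (e + 1))) :
    HT U (forEdges body) σ (m * (s + 2) + 2) (I m) := by
  have hmod1 : ¬ (Machine.forEdges body).modReg 1 := by
    simp [Machine.forEdges, Program.modReg, h1]
  have hbodyR : ∀ r, body.modReg r → (Machine.forEdges body).modReg r := fun r h =>
    Or.inr (Or.inl h)
  have hbodyA : ∀ r, body.modArr r → (Machine.forEdges body).modArr r := fun r h =>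
    Or.inr (Or.inl h)
  have h10' : (Machine.forEdges body).modReg 10 := Or.inl rfl
  have hset : ∀ τ z, Same (Machine.forEdges body) τ (τ.setReg 10 z) := fun τ z =>
    ⟨fun r hr => Function.update_of_ne (fun h => hr (by rw [h]; exact h10')) _ _, fun _ _ => rfl⟩
  have key := HT.loop (U := U) (e := (Expr.reg 10).lt (.reg 1))
    (p := .seq body (.assign 10 (.reg 10 + .const 1))) (s := s + 1)
    (fun k τ => ∃ i : ℕ, i + k = m ∧ τ.reg 10 = i ∧ Same (Machine.forEdges body) σ τ ∧ I i τ)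
    (by
      rintro k τ ⟨i, hik, hi, hS, hIi⟩ he
      have hτ1 : τ.reg 1 = m := (hS.1 1 hmod1).trans hm
      simp only [Expr.eval_lt, Expr.eval_reg, hi, hτ1] at he
      have him : i < m := by
        by_contra hc
        exact he (if_neg (by omega))
      refine (step ⟨i, him⟩ τ hi hτ1 hS hIi).seq (s₂ := 1) fun τ' hS' hI' => ?_
      have h' : τ'.reg 10 = i := (hS'.1 10 h10).trans hi
      refine HT.of_wp _ ?_
      simp only [Program.wp, Expr.eval_add, Expr.eval_reg, Expr.eval_const, h']
      refine ⟨⟨by omega, by omega⟩, k - 1, by omega, i + 1, by omega, ?_, ?_, hI _ _ _ hI'⟩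
      · simp [State.reg_setReg]
      · exact (hS.trans (hS'.mono hbodyR hbodyA)).trans (hset _ _))
    m (σ.setReg 10 0) ⟨0, by omega, by simp [State.reg_setReg], hset _ _, hI _ _ _ h0⟩
  have first : HT U (.assign 10 (.const 0)) σ 1 (fun τ => τ = σ.setReg 10 0) :=
    HT.of_wp _ ⟨⟨by simp [Expr.eval_const], by simp [Expr.eval_const]⟩, rfl⟩
  refine HT.mono (first.seq fun τ _ hτ => hτ ▸ key) (by ring_nf; omega) ?_
  rintro τ - ⟨⟨k, -, i, hik, hi, hS, hIi⟩, he⟩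
  have hτ1 : τ.reg 1 = m := (hS.1 1 hmod1).trans hm
  simp only [Expr.eval_lt, Expr.eval_reg, hi, hτ1] at he
  have : i = m := by
    by_contra hc
    rw [if_pos (by omega)] at he
    exact one_ne_zero he
  exact this ▸ hIi

end Machine

namespace BipartiteGraph

variable {n m : ℕ} (G : BipartiteGraph n m)

/-! ### Partial b-matchings, reachability and dual steps -/

/-- The degree of `v` in the edge multiset `M`. -/
def deg (M : Fin m → ℕ) (v : Fin n) : ℕ := ∑ e with G.left e = v ∨ G.right e = v, M e

/-- `M` is a partial `β`-matching which is complementary to the integral feasible dual `y`. -/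
structure Compl (c : Fin m → ℕ) (β : Fin n → ℕ) (y : Fin n → ℤ) (M : Fin m → ℕ) : Prop where
  sub : ∀ v, G.deg M v ≤ β v
  feas : ∀ e, y (G.left e) + y (G.right e) ≤ c e
  tight : ∀ e, 0 < M e → y (G.left e) + y (G.right e) = c e

/-- The arcs of the residual graph: tight edges from left to right, and edges used by `M` from
right to left. -/
def Arc (c : Fin m → ℕ) (y : Fin n → ℤ) (M : Fin m → ℕ) (u v : Fin n) : Prop :=
  (∃ e, G.left e = u ∧ G.right e = v ∧ y (G.left e) + y (G.right e) = c e) ∨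
    ∃ e, G.right e = u ∧ G.left e = v ∧ 0 < M e

/-- Unsaturated left vertices. -/
def Root (β : Fin n → ℕ) (M : Fin m → ℕ) (v : Fin n) : Prop :=
  (∃ e, G.left e = v) ∧ G.deg M v < β v

/-- The vertices that can be reached from an unsaturated left vertex in the residual graph. -/
def Reach (c : Fin m → ℕ) (β : Fin n → ℕ) (y : Fin n → ℤ) (M : Fin m → ℕ) (v : Fin n) : Prop :=
  ∃ u, G.Root β M u ∧ Relation.ReflTransGen (G.Arc c y M) u v

open Classical in
/-- The set of reachable vertices. -/
noncomputable def reachSet (c : Fin m → ℕ) (β : Fin n → ℕ) (y : Fin n → ℤ) (M : Fin m → ℕ) :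
    Finset (Fin n) := {v | G.Reach c β y M v}

/-- There is no augmenting path: all reachable right vertices are saturated. -/
def Stuck (c : Fin m → ℕ) (β : Fin n → ℕ) (y : Fin n → ℤ) (M : Fin m → ℕ) : Prop :=
  ∀ e, G.right e ∈ G.reachSet c β y M → G.deg M (G.right e) = β (G.right e)

/-- No edge, tight or not, leaves the set `X` from left to right. -/
def Closed (X : Finset (Fin n)) : Prop := ∀ e, G.left e ∈ X → G.right e ∈ X

/-- The left endpoints of edges. -/
def lefts : Finset (Fin n) := Finset.univ.image G.left

/-- The right endpoints of edges. -/
def rights : Finset (Fin n) := Finset.univ.image G.right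

/-- The dual vector `y` raised by `δ` on the left vertices in `X` and lowered by `δ` on the right
vertices in `X`. -/
def shift (X : Finset (Fin n)) (δ : ℤ) (y : Fin n → ℤ) (v : Fin n) : ℤ :=
  if v ∈ X then if v ∈ G.lefts then y v + δ else if v ∈ G.rights then y v - δ else y v else y v

/-- `δ` is the least slack of an edge that leaves `X` from left to right. -/
def IsMinSlack (c : Fin m → ℕ) (y : Fin n → ℤ) (X : Finset (Fin n)) (δ : ℤ) : Prop :=
  (∃ e, G.left e ∈ X ∧ G.right e ∉ X ∧ δ = c e - y (G.left e) - y (G.right e)) ∧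
    ∀ e, G.left e ∈ X → G.right e ∉ X → δ ≤ c e - y (G.left e) - y (G.right e)

variable {G} {c : Fin m → ℕ} {β : Fin n → ℕ} {y : Fin n → ℤ} {M : Fin m → ℕ}

theorem mem_lefts {v : Fin n} : v ∈ G.lefts ↔ ∃ e, G.left e = v := by simp [lefts]
theorem mem_rights {v : Fin n} : v ∈ G.rights ↔ ∃ e, G.right e = v := by simp [rights]
theorem left_mem_lefts (e : Fin m) : G.left e ∈ G.lefts := mem_lefts.2 ⟨e, rfl⟩
theorem right_mem_rights (e : Fin m) : G.right e ∈ G.rights := mem_rights.2 ⟨e, rfl⟩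

theorem right_notMem_lefts (e : Fin m) : G.right e ∉ G.lefts := by
  rw [mem_lefts]; rintro ⟨e', h⟩; exact G.left_ne_right _ _ h

theorem left_notMem_rights (e : Fin m) : G.left e ∉ G.rights := by
  rw [mem_rights]; rintro ⟨e', h⟩; exact G.left_ne_right _ _ h.symm

theorem mem_reachSet {v : Fin n} : v ∈ G.reachSet c β y M ↔ G.Reach c β y M v := by
  classical simp [reachSet]

theorem sum_deg_of_lefts (A : Finset (Fin n)) (hA : A ⊆ G.lefts) (M : Fin m → ℕ) :
    ∑ v ∈ A, G.deg M v = ∑ e, if G.left e ∈ A then M e else 0 := by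
  have : ∀ v ∈ A, G.deg M v = ∑ e, if G.left e = v then M e else 0 := by
    intro v hv
    obtain ⟨e', rfl⟩ := mem_lefts.1 (hA hv)
    rw [deg, Finset.sum_filter]
    refine Finset.sum_congr rfl fun e _ => ?_
    have := G.left_ne_right e' e
    simp [Ne.symm this]
  rw [Finset.sum_congr rfl this, Finset.sum_comm]
  simp

theorem sum_deg_of_rights (A : Finset (Fin n)) (hA : A ⊆ G.rights) (M : Fin m → ℕ) :
    ∑ v ∈ A, G.deg M v = ∑ e, if G.right e ∈ A then M e else 0 := by
  have : ∀ v ∈ A, G.deg M v = ∑ e, if G.right e = v then M e else 0 := by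
    intro v hv
    obtain ⟨e', rfl⟩ := mem_rights.1 (hA hv)
    rw [deg, Finset.sum_filter]
    refine Finset.sum_congr rfl fun e _ => ?_
    have := G.left_ne_right e e'
    simp [this]
  rw [Finset.sum_congr rfl this, Finset.sum_comm]
  simp

theorem sum_deg_lefts (M : Fin m → ℕ) : ∑ v ∈ G.lefts, G.deg M v = ∑ e, M e := by
  rw [sum_deg_of_lefts _ subset_rfl]; simp [left_mem_lefts]

theorem sum_deg_rights (M : Fin m → ℕ) : ∑ v ∈ G.rights, G.deg M v = ∑ e, M e := by
  rw [sum_deg_of_rights _ subset_rfl]; simp [right_mem_rights]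

theorem deg_eq_sum (M : Fin m → ℕ) (v : Fin n) :
    G.deg M v = ∑ e, if G.left e = v ∨ G.right e = v then M e else 0 := by
  rw [deg, Finset.sum_filter]

/-- Weak duality for vertex covers: a matching inside a set of edges is at most the demand of a
vertex cover of these edges. -/
theorem sum_le_of_cover {S : Finset (Fin n)} (hS : ∀ e, 0 < M e → G.left e ∈ S ∨ G.right e ∈ S)
    (hM : ∀ v ∈ S, G.deg M v ≤ β v) : ∑ e, M e ≤ ∑ v ∈ S, β v := by
  calc ∑ e, M e ≤ ∑ e, ∑ v ∈ S, if G.left e = v ∨ G.right e = v then M e else 0 := by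
        refine Finset.sum_le_sum fun e _ => ?_
        rcases Nat.eq_zero_or_pos (M e) with h | h
        · omega
        · rcases hS e h with h' | h'
          · exact le_trans (by simp) (Finset.single_le_sum
              (f := fun v => if G.left e = v ∨ G.right e = v then M e else 0)
              (fun _ _ => Nat.zero_le _) h')
          · exact le_trans (by simp) (Finset.single_le_sum
              (f := fun v => if G.left e = v ∨ G.right e = v then M e else 0)
              (fun _ _ => Nat.zero_le _) h')
    _ = ∑ v ∈ S, G.deg M v := by
        rw [Finset.sum_comm]; exact Finset.sum_congr rfl fun v _ => (deg_eq_sum M v).symm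
    _ ≤ ∑ v ∈ S, β v := Finset.sum_le_sum hM

theorem reach_right_of_tight {e : Fin m} (h : G.left e ∈ G.reachSet c β y M)
    (ht : y (G.left e) + y (G.right e) = c e) : G.right e ∈ G.reachSet c β y M := by
  rw [mem_reachSet] at *
  obtain ⟨u, hu, hr⟩ := h
  exact ⟨u, hu, hr.tail (Or.inl ⟨e, rfl, rfl, ht⟩)⟩

theorem reach_left_of_pos {e : Fin m} (h : G.right e ∈ G.reachSet c β y M)
    (ht : 0 < M e) : G.left e ∈ G.reachSet c β y M := by
  rw [mem_reachSet] at *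
  obtain ⟨u, hu, hr⟩ := h
  exact ⟨u, hu, hr.tail (Or.inr ⟨e, rfl, rfl, ht⟩)⟩

theorem reach_root {v : Fin n} (hl : v ∈ G.lefts) (h : G.deg M v < β v) :
    v ∈ G.reachSet c β y M :=
  mem_reachSet.2 ⟨v, ⟨mem_lefts.1 hl, h⟩, .refl⟩

/-- Left vertices outside the reachable set, and right vertices inside it. When there is no
augmenting path, this is a minimum vertex cover of the tight edges. -/
noncomputable def cover (G : BipartiteGraph n m) (X : Finset (Fin n)) : Finset (Fin n) :=
  (G.lefts \ X) ∪ (G.rights ∩ X)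

theorem lefts_disjoint_rights : Disjoint G.lefts G.rights := by
  rw [Finset.disjoint_left]
  intro v h h'
  obtain ⟨e, rfl⟩ := mem_rights.1 h'
  exact right_notMem_lefts e h

theorem sum_cover (X : Finset (Fin n)) (f : Fin n → ℕ) :
    ∑ v ∈ cover G X, f v = ∑ v ∈ G.lefts \ X, f v + ∑ v ∈ G.rights ∩ X, f v :=
  Finset.sum_union (lefts_disjoint_rights.mono Finset.sdiff_subset Finset.inter_subset_left)

theorem mem_cover_of_imp {X : Finset (Fin n)} {e : Fin m}
    (h : G.left e ∈ X → G.right e ∈ X) : G.left e ∈ cover G X ∨ G.right e ∈ cover G X := by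
  by_cases hl : G.left e ∈ X
  · exact Or.inr (Finset.mem_union_right _ (Finset.mem_inter.2 ⟨right_mem_rights e, h hl⟩))
  · exact Or.inl (Finset.mem_union_left _ (Finset.mem_sdiff.2 ⟨left_mem_lefts e, hl⟩))

theorem Compl.sum_lefts_sdiff (h : G.Compl c β y M) :
    ∑ v ∈ G.lefts \ G.reachSet c β y M, β v =
      ∑ e, if G.left e ∈ G.reachSet c β y M then 0 else M e := by
  have : ∀ v ∈ G.lefts \ G.reachSet c β y M, β v = G.deg M v := by
    intro v hv
    rw [Finset.mem_sdiff] at hv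
    refine le_antisymm ?_ (h.sub v)
    by_contra hc
    exact hv.2 (reach_root hv.1 (by omega))
  rw [Finset.sum_congr rfl this, sum_deg_of_lefts _ Finset.sdiff_subset]
  refine Finset.sum_congr rfl fun e _ => ?_
  by_cases h' : G.left e ∈ G.reachSet c β y M <;> simp [h', left_mem_lefts]

theorem Compl.left_reach_iff (h : G.Compl c β y M) {e : Fin m} (he : 0 < M e) :
    G.left e ∈ G.reachSet c β y M ↔ G.right e ∈ G.reachSet c β y M :=
  ⟨fun h' => reach_right_of_tight h' (h.tight e he), fun h' => reach_left_of_pos h' he⟩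

theorem Compl.sum_rights_inter (h : G.Compl c β y M) (hs : G.Stuck c β y M) :
    ∑ v ∈ G.rights ∩ G.reachSet c β y M, β v =
      ∑ e, if G.left e ∈ G.reachSet c β y M then M e else 0 := by
  have : ∀ v ∈ G.rights ∩ G.reachSet c β y M, β v = G.deg M v := by
    intro v hv
    rw [Finset.mem_inter] at hv
    obtain ⟨e, rfl⟩ := mem_rights.1 hv.1
    exact (hs e hv.2).symm
  rw [Finset.sum_congr rfl this, sum_deg_of_rights _ Finset.inter_subset_left]
  refine Finset.sum_congr rfl fun e _ => ?_
  rcases Nat.eq_zero_or_pos (M e) with h0 | h0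
  · simp [h0]
  · simp [h.left_reach_iff h0, right_mem_rights]

/-- König's theorem: without augmenting paths, the matching is as large as a vertex cover of the
tight edges. -/
theorem Compl.sum_cover_eq (h : G.Compl c β y M) (hs : G.Stuck c β y M) :
    ∑ v ∈ cover G (G.reachSet c β y M), β v = ∑ e, M e := by
  rw [sum_cover, h.sum_lefts_sdiff, h.sum_rights_inter hs, ← Finset.sum_add_distrib]
  refine Finset.sum_congr rfl fun e _ => ?_
  split_ifs <;> simp

/-- A feasible dual step preserves complementarity. -/
theorem Compl.shift (h : G.Compl c β y M) {δ : ℤ}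
    (hδ : G.IsMinSlack c y (G.reachSet c β y M) δ) :
    0 < δ ∧ G.Compl c β (G.shift (G.reachSet c β y M) δ y) M := by
  obtain ⟨⟨e₀, h1, h2, h3⟩, hmin⟩ := hδ
  have hpos : 0 < δ := by
    have := h.feas e₀
    by_contra hc
    exact h2 (reach_right_of_tight h1 (by omega))
  refine ⟨hpos, h.sub, fun e => ?_, fun e he => ?_⟩
  · have := h.feas e
    by_cases hl : G.left e ∈ G.reachSet c β y M <;> by_cases hr : G.right e ∈ G.reachSet c β y M <;>
      simp only [BipartiteGraph.shift, hl, hr, left_mem_lefts, right_mem_rights,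
        right_notMem_lefts, if_true, if_false]
    · omega
    · have := hmin e hl hr; omega
    · omega
    · omega
  · have := h.tight e he
    have hiff := h.left_reach_iff he
    by_cases hr : G.right e ∈ G.reachSet c β y M
    · simp only [BipartiteGraph.shift, hiff.2 hr, hr, left_mem_lefts, right_mem_rights,
        right_notMem_lefts, if_true, if_false]; omega
    · simp only [BipartiteGraph.shift, mt hiff.1 hr, hr, if_false]; omega

/-- A dual step changes the dual objective by the step size times the difference of the demands of
the left and the right vertices in the shifted set. -/
theorem sum_shift (X : Finset (Fin n)) (δ : ℤ) (y : Fin n → ℤ) :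
    ∑ v, (β v : ℤ) * G.shift X δ y v = ∑ v, (β v : ℤ) * y v +
      δ * (∑ v ∈ G.lefts ∩ X, (β v : ℤ) - ∑ v ∈ G.rights ∩ X, (β v : ℤ)) := by
  have h1 : ∀ A : Finset (Fin n), ∑ v ∈ A ∩ X, (β v : ℤ) =
      ∑ v, if v ∈ A ∧ v ∈ X then (β v : ℤ) else 0 := fun A => by
    rw [← Finset.sum_filter]; congr 1; ext v; simp
  rw [h1, h1, ← Finset.sum_sub_distrib, Finset.mul_sum, ← Finset.sum_add_distrib]
  refine Finset.sum_congr rfl fun v _ => ?_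
  by_cases hl : v ∈ G.lefts
  · have hr : v ∉ G.rights := Finset.disjoint_left.1 lefts_disjoint_rights hl
    by_cases hX : v ∈ X <;> simp [BipartiteGraph.shift, hl, hr, hX]; ring
  · by_cases hr : v ∈ G.rights <;> by_cases hX : v ∈ X <;>
      simp [BipartiteGraph.shift, hl, hr, hX]; ring

/-- A dual step increases the dual objective by the step size times the deficiency. -/
theorem Compl.sum_shift (h : G.Compl c β y M) (hs : G.Stuck c β y M) (δ : ℤ) :
    ∑ v, (β v : ℤ) * G.shift (G.reachSet c β y M) δ y v = ∑ v, (β v : ℤ) * y v +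
      δ * ((∑ v ∈ G.lefts, β v : ℕ) - (∑ e, M e : ℕ)) := by
  rw [BipartiteGraph.sum_shift]
  have h1 := h.sum_cover_eq hs
  rw [sum_cover] at h1
  have h2 : ∑ v ∈ G.lefts ∩ G.reachSet c β y M, β v + ∑ v ∈ G.lefts \ G.reachSet c β y M, β v =
      ∑ v ∈ G.lefts, β v := Finset.sum_inter_add_sum_sdiff _ _ _
  congr 2
  rw [← Nat.cast_sum, ← Nat.cast_sum]
  omega

/-- Reachability only grows in a dual step, by at least one vertex. -/
theorem reachSet_ssubset_shift {δ : ℤ}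
    (hδ : G.IsMinSlack c y (G.reachSet c β y M) δ) :
    G.reachSet c β y M ⊂ G.reachSet c β (G.shift (G.reachSet c β y M) δ y) M := by
  have hsub : G.reachSet c β y M ⊆ G.reachSet c β (G.shift (G.reachSet c β y M) δ y) M := by
    intro v hv
    obtain ⟨u, hu, hr⟩ := mem_reachSet.1 hv
    induction hr with
    | refl => exact mem_reachSet.2 ⟨u, hu, .refl⟩
    | @tail v w hr ha ih =>
      have hvX : v ∈ G.reachSet c β y M := mem_reachSet.2 ⟨u, hu, hr⟩
      have ih := ih hvX
      rcases ha with ⟨e, rfl, rfl, ht⟩ | ⟨e, rfl, rfl, ht⟩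
      · refine reach_right_of_tight ih ?_
        simp only [BipartiteGraph.shift, hvX, hv, left_mem_lefts, right_mem_rights,
          right_notMem_lefts, if_true, if_false]; omega
      · exact reach_left_of_pos ih ht
  refine (Finset.ssubset_iff_of_subset hsub).2 ?_
  obtain ⟨⟨e₀, h1, h2, h3⟩, -⟩ := hδ
  refine ⟨G.right e₀, reach_right_of_tight (hsub h1) ?_, h2⟩
  simp only [BipartiteGraph.shift, h1, h2, left_mem_lefts, if_true, if_false]; omega

/-- The reachable set of a stuck complementary matching does not depend on the matching: it is
the least minimum cut. -/
theorem Compl.reachSet_subset {M' : Fin m → ℕ} (h : G.Compl c β y M) (hs : G.Stuck c β y M)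
    (h' : G.Compl c β y M') (hs' : G.Stuck c β y M') :
    G.reachSet c β y M ⊆ G.reachSet c β y M' := by
  set X' := G.reachSet c β y M' with hX'
  have hcov : ∀ e, 0 < M e → G.left e ∈ cover G X' ∨ G.right e ∈ cover G X' := fun e he =>
    mem_cover_of_imp fun hl => reach_right_of_tight hl (h.tight e he)
  have hcov' : ∀ e, 0 < M' e → G.left e ∈ cover G (G.reachSet c β y M) ∨
      G.right e ∈ cover G (G.reachSet c β y M) := fun e he =>
    mem_cover_of_imp fun hl => reach_right_of_tight hl (h'.tight e he)
  have e1 : ∑ e, M' e ≤ ∑ e, M e :=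
    (sum_le_of_cover hcov' fun v _ => h'.sub v).trans (h.sum_cover_eq hs).le
  have e2 : ∑ v ∈ cover G X', β v ≤ ∑ e, M e := (h'.sum_cover_eq hs').le.trans e1
  have e3 : ∑ v ∈ cover G X', G.deg M v ≤ ∑ v ∈ cover G X', β v :=
    Finset.sum_le_sum fun v _ => h.sub v
  have e4 : ∑ v ∈ cover G X', G.deg M v = ∑ e, ((if G.left e ∈ X' then 0 else M e) +
      if G.right e ∈ X' then M e else 0) := by
    rw [sum_cover, sum_deg_of_lefts _ Finset.sdiff_subset,
      sum_deg_of_rights _ Finset.inter_subset_left, ← Finset.sum_add_distrib]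
    refine Finset.sum_congr rfl fun e _ => ?_
    by_cases h1 : G.left e ∈ X' <;> by_cases h2 : G.right e ∈ X' <;>
      simp [h1, h2, left_mem_lefts, right_mem_rights]
  have e5 : ∀ e ∈ (Finset.univ : Finset (Fin m)), M e ≤ (if G.left e ∈ X' then 0 else M e) +
      if G.right e ∈ X' then M e else 0 := by
    intro e _
    rcases Nat.eq_zero_or_pos (M e) with h0 | h0
    · omega
    · by_cases h1 : G.left e ∈ X'
      · have h2 : G.right e ∈ X' := reach_right_of_tight h1 (h.tight e h0)
        simp [h1, h2]
      · simp [h1]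
  have e6 : ∑ e, M e ≤ ∑ v ∈ cover G X', G.deg M v := e4 ▸ Finset.sum_le_sum e5
  -- both chains of inequalities are tight: `M` saturates the cover of `M'`, and no edge of `M` has
  -- both endpoints in it
  have e7 := (Finset.sum_eq_sum_iff_of_le e5).1 (by rw [← e4]; omega)
  have e8 := (Finset.sum_eq_sum_iff_of_le fun v _ => h.sub v).1
    (show ∑ v ∈ cover G X', G.deg M v = ∑ v ∈ cover G X', β v by omega)
  have hroot : ∀ u, G.Root β M u → u ∈ X' := by
    rintro u ⟨hl, hu⟩
    by_contra hc
    have := e8 u (Finset.mem_union_left _ (Finset.mem_sdiff.2 ⟨mem_lefts.2 hl, hc⟩))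
    omega
  intro v hv
  obtain ⟨u, hu, hr⟩ := mem_reachSet.1 hv
  induction hr with
  | refl => exact hroot u hu
  | @tail v w hr ha ih =>
    have ih := ih (mem_reachSet.2 ⟨u, hu, hr⟩)
    rcases ha with ⟨e, rfl, rfl, ht⟩ | ⟨e, rfl, rfl, ht⟩
    · exact reach_right_of_tight ih ht
    · by_contra hc
      have := e7 e (Finset.mem_univ _)
      simp [hc, ih] at this
      omega

theorem Compl.reachSet_eq {M' : Fin m → ℕ} (h : G.Compl c β y M) (hs : G.Stuck c β y M)
    (h' : G.Compl c β y M') (hs' : G.Stuck c β y M') :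
    G.reachSet c β y M = G.reachSet c β y M' :=
  (h.reachSet_subset hs h' hs').antisymm (h'.reachSet_subset hs' h hs)

/-! ### Perfect b-matchings and optimality -/

theorem IsPerfectBMatching.deg_eq {b : Fin n → ℕ} (h : G.IsPerfectBMatching b M) (v : Fin n) :
    G.deg M v = b v := h v

theorem IsPerfectBMatching.sum_lefts {b : Fin n → ℕ} (h : G.IsPerfectBMatching b M) :
    ∑ v ∈ G.lefts, b v = ∑ e, M e := by
  rw [← sum_deg_lefts]; exact Finset.sum_congr rfl fun v _ => (h v).symm

theorem IsPerfectBMatching.sum_rights {b : Fin n → ℕ} (h : G.IsPerfectBMatching b M) :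
    ∑ v ∈ G.rights, b v = ∑ e, M e := by
  rw [← sum_deg_rights]; exact Finset.sum_congr rfl fun v _ => (h v).symm

theorem perfect_of_sum_eq {b : Fin n → ℕ} {M' : Fin m → ℕ} (hM' : G.IsPerfectBMatching b M')
    (hsub : ∀ v, G.deg M v ≤ b v) (h : ∑ e, M' e ≤ ∑ e, M e) : G.IsPerfectBMatching b M := by
  have e1 := (Finset.sum_eq_sum_iff_of_le fun v (_ : v ∈ G.lefts) => hsub v).1 (by
    have := Finset.sum_le_sum fun v (_ : v ∈ G.lefts) => hsub v
    rw [sum_deg_lefts, hM'.sum_lefts] at *; omega)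
  have e2 := (Finset.sum_eq_sum_iff_of_le fun v (_ : v ∈ G.rights) => hsub v).1 (by
    have := Finset.sum_le_sum fun v (_ : v ∈ G.rights) => hsub v
    rw [sum_deg_rights, hM'.sum_rights] at *; omega)
  intro v
  by_cases hl : v ∈ G.lefts
  · exact e1 v hl
  by_cases hr : v ∈ G.rights
  · exact e2 v hr
  · have h0 : ∀ N : Fin m → ℕ, G.deg N v = 0 := fun N => by
      rw [deg, Finset.sum_eq_zero]
      intro e he
      rcases (Finset.mem_filter.1 he).2 with h | h
      · exact absurd (mem_lefts.2 ⟨e, h⟩) hl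
      · exact absurd (mem_rights.2 ⟨e, h⟩) hr
    exact (h0 M).trans ((h0 M').symm.trans (hM' v))

/-- If nothing leaves the reachable set and a perfect matching exists, then the matching is
perfect. -/
theorem Compl.perfect {b : Fin n → ℕ} {M' : Fin m → ℕ} (h : G.Compl c b y M)
    (hs : G.Stuck c b y M) (hc : G.Closed (G.reachSet c b y M))
    (hM' : G.IsPerfectBMatching b M') : G.IsPerfectBMatching b M := by
  refine perfect_of_sum_eq hM' h.sub ?_
  exact (sum_le_of_cover (fun e _ => mem_cover_of_imp (hc e)) fun v _ => (hM' v).le).trans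
    (h.sum_cover_eq hs).le

theorem sum_mul_dual {b : Fin n → ℕ} {R : Type*} [CommRing R] (h : G.IsPerfectBMatching b M)
    (z : Fin n → R) :
    ∑ v, (b v : R) * z v = ∑ e, (M e : R) * (z (G.left e) + z (G.right e)) := by
  have h1 : ∀ v, (b v : R) * z v = ∑ e, if G.left e = v ∨ G.right e = v then (M e : R) * z v
      else 0 := fun v => by
    rw [← h.deg_eq v, deg_eq_sum, Nat.cast_sum, Finset.sum_mul]
    refine Finset.sum_congr rfl fun e _ => ?_
    split_ifs <;> simp
  have h2 : ∀ e v, (if G.left e = v ∨ G.right e = v then (M e : R) * z v else 0) =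
      (if G.left e = v then (M e : R) * z v else 0) +
        if G.right e = v then (M e : R) * z v else 0 := fun e v => by
    by_cases ha : G.left e = v <;> by_cases hb : G.right e = v <;> simp [ha, hb]
    exact absurd (ha.trans hb.symm) (G.left_ne_right e e)
  simp_rw [h1]
  rw [Finset.sum_comm]
  refine Finset.sum_congr rfl fun e _ => ?_
  simp_rw [h2, Finset.sum_add_distrib]
  simp [mul_add]

/-- Weak duality. -/
theorem weak_duality {b : Fin n → ℕ} {R : Type*} [CommRing R] [LinearOrder R]
    [IsStrictOrderedRing R] (h : G.IsPerfectBMatching b M) {z : Fin n → R}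
    (hz : ∀ e, z (G.left e) + z (G.right e) ≤ (c e : R)) :
    ∑ v, (b v : R) * z v ≤ ((∑ e, c e * M e : ℕ) : R) := by
  rw [sum_mul_dual h, Nat.cast_sum]
  refine Finset.sum_le_sum fun e _ => ?_
  rw [Nat.cast_mul, mul_comm]
  exact mul_le_mul_of_nonneg_right (hz e) (Nat.cast_nonneg _)

theorem Compl.sum_eq {b : Fin n → ℕ} (h : G.Compl c b y M) (hM : G.IsPerfectBMatching b M) :
    ∑ v, (b v : ℤ) * y v = ((∑ e, c e * M e : ℕ) : ℤ) := by
  rw [sum_mul_dual hM, Nat.cast_sum]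
  refine Finset.sum_congr rfl fun e _ => ?_
  rcases Nat.eq_zero_or_pos (M e) with h0 | h0
  · simp [h0]
  · rw [h.tight e h0]; push_cast; ring

theorem Compl.isMinWeight {b : Fin n → ℕ} (h : G.Compl c b y M)
    (hM : G.IsPerfectBMatching b M) : G.IsMinWeightPerfectBMatching c b M := by
  refine ⟨hM, fun M' hM' => ?_⟩
  have h1 := h.sum_eq hM
  have h2 := weak_duality hM' h.feas
  rw [h1] at h2
  exact_mod_cast h2

theorem Compl.isOptimalDual {b : Fin n → ℕ} (h : G.Compl c b y M)
    (hM : G.IsPerfectBMatching b M) : G.IsOptimalDual c b fun v => (y v : ℝ) := by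
  refine ⟨fun e => by have := h.feas e; beta_reduce; exact_mod_cast this, fun z hz => ?_⟩
  have h1 : ∑ v, (b v : ℝ) * (y v : ℝ) = ((∑ e, c e * M e : ℕ) : ℝ) := by
    have := h.sum_eq hM
    exact_mod_cast congrArg (Int.cast : ℤ → ℝ) this
  rw [h1]
  exact weak_duality hM hz

end BipartiteGraph

namespace Machine

open BipartiteGraph

infixr:60 " ;; " => Program.seq

variable {n m : ℕ} {G : BipartiteGraph n m} {c : Fin m → ℕ} {b : Fin n → ℕ}

/-! ### Registers and arrays of the primal-dual algorithm

Arrays 0 and 1 hold the endpoints of the edges, arrays 2 and 3 the costs and demands, array 4 the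
dual vector and array 5 the multiplicities. Array 6 holds the excess of the vertices, array 7 the
heads of the adjacency lists, and arrays 8 and 9 the successor and the target of each arc. The
search uses array 10 for marks, array 11 for parent pointers and array 12 as its stack; array 13
holds a new dual vector before it is copied to array 4.

Register 11 holds the divisor of the demands, registers 12 and 13 hold the addresses of the current
instance. Register 14 forbids dual steps if it is nonzero, and register 15 signals the end of a
phase. Registers 16, 17 and 18 hold the current list, the height of the stack and the number of
marked vertices. Register 19 holds the vertex found by the search, and register 20 the size of the
dual step. -/

/-- The current edge of a sweep. -/
abbrev eI : Expr := .reg 10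
/-- The left endpoint of the current edge. -/
abbrev eL : Expr := .get 0 eI
/-- The right endpoint of the current edge. -/
abbrev eR : Expr := .get 1 eI
/-- The cost of the current edge. -/
abbrev eC : Expr := .get 2 (.reg 12 + eI)
/-- The multiplicity of the current edge. -/
abbrev eM : Expr := .get 5 eI
/-- The demand of the vertex `v`. -/
abbrev eB (v : Expr) : Expr := .get 3 (.reg 13 + v)
/-- The dual value of the vertex `v`. -/
abbrev eY (v : Expr) : Expr := .get 4 (.reg 13 + v)

/-- The memory holds the graph `G`, the costs `c` and the demands `b`; costs start at the address
in register 12 of array 2, demands at the address in register 13 of array 3. -/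
structure Holds (G : BipartiteGraph n m) (c : Fin m → ℕ) (b : Fin n → ℕ) (σ : State) : Prop where
  hm : σ.reg 1 = m
  left : ∀ e : Fin m, σ.arr 0 (e : ℕ) = (G.left e : ℕ)
  right : ∀ e : Fin m, σ.arr 1 (e : ℕ) = (G.right e : ℕ)
  cost : ∀ e : Fin m, σ.arr 2 (σ.reg 12 + (e : ℕ)) = c e
  dem : ∀ v : Fin n, σ.arr 3 (σ.reg 13 + (v : ℕ)) = b v

/-- The memory holds the dual vector `y` (array 4, from the address in register 13). -/
def HoldsY (y : Fin n → ℤ) (σ : State) : Prop := ∀ v : Fin n, σ.arr 4 (σ.reg 13 + (v : ℕ)) = y v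

/-- The memory holds the edge multiplicities `M` (array 5). -/
def HoldsM (M : Fin m → ℕ) (σ : State) : Prop := ∀ e : Fin m, σ.arr 5 (e : ℕ) = M e

/-- The program leaves the input alone. -/
structure Keeps (p : Program) : Prop where
  r1 : ¬ p.modReg 1
  r12 : ¬ p.modReg 12
  r13 : ¬ p.modReg 13
  a0 : ¬ p.modArr 0
  a1 : ¬ p.modArr 1
  a2 : ¬ p.modArr 2
  a3 : ¬ p.modArr 3

theorem Holds.same {p : Program} {σ τ : State} (h : Holds G c b σ) (hS : Same p σ τ)
    (hp : Keeps p) : Holds G c b τ where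
  hm := by rw [hS.1 1 hp.r1]; exact h.hm
  left := by rw [hS.2 0 hp.a0]; exact h.left
  right := by rw [hS.2 1 hp.a1]; exact h.right
  cost := by rw [hS.2 2 hp.a2, hS.1 12 hp.r12]; exact h.cost
  dem := by rw [hS.2 3 hp.a3, hS.1 13 hp.r13]; exact h.dem

theorem HoldsY.same {p : Program} {σ τ : State} {y : Fin n → ℤ} (h : HoldsY y σ)
    (hS : Same p σ τ) (h13 : ¬ p.modReg 13) (h4 : ¬ p.modArr 4) : HoldsY y τ := by
  unfold HoldsY; rw [hS.1 13 h13, hS.2 4 h4]; exact h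

theorem HoldsM.same {p : Program} {σ τ : State} {M : Fin m → ℕ} (h : HoldsM M σ)
    (hS : Same p σ τ) (h5 : ¬ p.modArr 5) : HoldsM M τ := by
  unfold HoldsM; rw [hS.2 5 h5]; exact h

/-- Partial sums along a sweep. -/
def psum (f : Fin m → ℕ) (i : ℕ) : ℕ := ∑ e : Fin m, if (e : ℕ) < i then f e else 0

theorem psum_zero (f : Fin m → ℕ) : psum f 0 = 0 := by simp [psum]

theorem psum_succ (f : Fin m → ℕ) (e : Fin m) : psum f (e + 1) = psum f e + f e := by
  have : ∀ e' : Fin m, (if (e' : ℕ) < e + 1 then f e' else 0) =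
      (if (e' : ℕ) < e then f e' else 0) + if e' = e then f e' else 0 := by
    intro e'
    rcases lt_trichotomy e' e with h | h | h
    · have h1 : (e' : ℕ) < e := h
      simp [h1, h.ne, Nat.lt_succ_of_lt h1]
    · simp [h]
    · have h1 : (e : ℕ) < e' := h
      simp [h.ne', not_lt.2 h1.le, show ¬ (e' : ℕ) < e + 1 by omega]
  simp only [psum, this, Finset.sum_add_distrib, Finset.sum_ite_eq', Finset.mem_univ, if_true]

theorem psum_self (f : Fin m → ℕ) : psum f m = ∑ e, f e := by simp [psum]

theorem psum_le (f : Fin m → ℕ) (i : ℕ) : psum f i ≤ ∑ e, f e :=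
  Finset.sum_le_sum fun e _ => by split_ifs <;> simp

/-- Property `Q` holds at the endpoints of the first `i` edges. -/
def Upto (G : BipartiteGraph n m) (i : ℕ) (Q : Fin n → Prop) : Prop :=
  ∀ e : Fin m, (e : ℕ) < i → Q (G.left e) ∧ Q (G.right e)

theorem Upto.zero {Q : Fin n → Prop} : Upto G 0 Q := fun _ h => absurd h (Nat.not_lt_zero _)

theorem Upto.succ {Q Q' : Fin n → Prop} {e : Fin m} (h : Upto G e Q) (hQ : ∀ v, Q v → Q' v)
    (h1 : Q' (G.left e)) (h2 : Q' (G.right e)) : Upto G (e + 1) Q' := by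
  intro e' he'
  rcases Nat.lt_succ_iff_lt_or_eq.1 he' with h' | h'
  · exact ⟨hQ _ (h e' h').1, hQ _ (h e' h').2⟩
  · rw [Fin.ext h']; exact ⟨h1, h2⟩

/-- The vertex `v` is an endpoint of an edge. -/
def Inc (G : BipartiteGraph n m) (v : Fin n) : Prop := ∃ e, G.left e = v ∨ G.right e = v

theorem Inc.left (e : Fin m) : Inc G (G.left e) := ⟨e, Or.inl rfl⟩
theorem Inc.right (e : Fin m) : Inc G (G.right e) := ⟨e, Or.inr rfl⟩

theorem Upto.inc {Q : Fin n → Prop} (h : Upto G m Q) {v : Fin n} (hv : Inc G v) : Q v := by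
  obtain ⟨e, rfl | rfl⟩ := hv
  exacts [(h e e.2).1, (h e e.2).2]

/-! ### Excess and adjacency lists -/

/-- The scaled demands in array 6, empty adjacency lists, and no marks. -/
def initSweep : Program := forEdges <|
  .store 6 eL (eB eL / .reg 11) ;; .store 6 eR (eB eR / .reg 11) ;;
  .store 7 eL (.const 0) ;; .store 7 eR (.const 0) ;;
  .store 10 eL (.const 0) ;; .store 10 eR (.const 0)

theorem initSweep_spec {U D : ℕ} {σ : State} (H : Holds G c b σ) (hD : σ.reg 11 = D) (hm : m ≤ U)
    (hb : ∀ v, b v ≤ U) :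
    HT U initSweep σ (m * 8 + 2) fun τ => ∀ v, Inc G v →
      τ.arr 6 (v : ℕ) = (b v / D : ℕ) ∧ τ.arr 7 (v : ℕ) = 0 ∧ τ.arr 10 (v : ℕ) = 0 := by
  refine HT.mono (HT.forEdges (fun i τ => Upto G i fun v =>
      τ.arr 6 (v : ℕ) = (b v / D : ℕ) ∧ τ.arr 7 (v : ℕ) = 0 ∧ τ.arr 10 (v : ℕ) = 0)
    H.hm hm (by simp) (by simp) (fun _ _ _ h => h) Upto.zero ?_) le_rfl
    fun τ _ h v hv => h.inc hv
  intro e τ hi _ hS hI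
  have H' := H.same hS (by constructor <;> simp [forEdges])
  have hD' : τ.reg 11 = D := (hS.1 11 (by simp [forEdges])).trans hD
  have hs : ∀ v, Small U ((b v : ℤ) / D) := fun v => by
    have h1 := (Nat.div_le_self (b v) D).trans (hb v)
    exact Small.of_nonneg (by positivity) (by exact_mod_cast h1)
  have h0 : Small U 0 := Small.of_nonneg le_rfl (by positivity)
  refine HT.of_wp _ ?_
  simp [hi, H'.left, H'.right, H'.dem, hD', hs, h0]
  refine hI.succ (fun v h => ?_) ?_ ?_
  all_goals grind

/-- Subtraction of the degrees from the scaled demands in array 6. -/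
def excessSweep : Program := forEdges <|
  .store 6 eL (.get 6 eL - eM) ;; .store 6 eR (.get 6 eR - eM)

theorem excessSweep_spec {U : ℕ} {σ : State} {β : Fin n → ℕ} {M : Fin m → ℕ} (H : Holds G c b σ)
    (hM : HoldsM M σ) (hm : m ≤ U) (hβ : ∀ v, β v ≤ U) (hsub : ∀ v, G.deg M v ≤ β v)
    (h6 : ∀ v, Inc G v → σ.arr 6 (v : ℕ) = β v) :
    HT U excessSweep σ (m * 4 + 2) fun τ => ∀ v, Inc G v →
      τ.arr 6 (v : ℕ) = (β v : ℤ) - G.deg M v := by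
  set f : Fin n → Fin m → ℕ := fun v e => if G.left e = v ∨ G.right e = v then M e else 0 with hf
  have hdeg : ∀ v, psum (f v) m = G.deg M v := fun v => by rw [psum_self, deg_eq_sum]
  have hps : ∀ v i, psum (f v) i ≤ β v := fun v i =>
    (psum_le _ _).trans (by rw [← psum_self, hdeg]; exact hsub v)
  refine HT.mono (HT.forEdges (fun i τ => ∀ v, Inc G v →
      τ.arr 6 (v : ℕ) = (β v : ℤ) - psum (f v) i)
    H.hm hm (by simp) (by simp) (fun _ _ _ h => h) (by simpa [psum_zero] using h6) ?_) le_rfl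
    fun τ _ h v hv => by rw [h v hv, hdeg]
  intro e τ hi _ hS hI
  have H' := H.same hS (by constructor <;> simp [forEdges])
  have hM' := hM.same hS (by simp [forEdges])
  have hl : psum (f (G.left e)) (e + 1) = psum (f (G.left e)) e + M e := by
    rw [psum_succ]; simp [hf]
  have hr : psum (f (G.right e)) (e + 1) = psum (f (G.right e)) e + M e := by
    rw [psum_succ]; simp [hf]
  have h1 := hps (G.left e) (e + 1)
  have h2 := hps (G.right e) (e + 1)
  have h3 := hβ (G.left e)
  have h4 := hβ (G.right e)
  have hne : (G.right e : ℕ) ≠ (G.left e : ℕ) := fun h => G.left_ne_right e e (Fin.ext h).symm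
  have h5 := hI _ (Inc.left e)
  have h6 := hI _ (Inc.right e)
  refine HT.of_wp _ ?_
  simp [hi, H'.left, H'.right, hM' e, h5, h6, Small, hne]
  refine ⟨by omega, by omega, fun v hv => ?_⟩
  have hv' := hI v hv
  by_cases hvr : v = G.right e
  · subst hvr; simp; omega
  by_cases hvl : v = G.left e
  · subst hvl; simp [Ne.symm hne]; omega
  · have : psum (f v) (e + 1) = psum (f v) e := by
      rw [psum_succ]; simp [hf, Ne.symm hvl, Ne.symm hvr]
    rw [if_neg (fun h => hvr (Fin.ext h)), if_neg (fun h => hvl (Fin.ext h)), hv', this]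

/-- The pointer `p` is the head of a linked list with entries `l`, where `nxt` yields the
successors; 0 is the null pointer. -/
def Linked (nxt : ℤ → ℤ) : ℤ → List ℕ → Prop
  | p, [] => p = 0
  | p, q :: l => p = (q : ℤ) ∧ 0 < q ∧ Linked nxt (nxt q) l

theorem Linked.congr {nxt nxt' : ℤ → ℤ} : ∀ {l : List ℕ} {p : ℤ}, Linked nxt p l →
    (∀ q ∈ l, nxt' (q : ℕ) = nxt (q : ℕ)) → Linked nxt' p l
  | [], _, h, _ => h
  | q :: l, _, h, h' => ⟨h.1, h.2.1, by
      rw [h' q (by simp)]; exact h.2.2.congr fun q' hq' => h' q' (by simp [hq'])⟩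

/-- Adjacency lists: the pointers in the list of `u` are the names `q` of the arcs `A q u v` with
tail `u`; `hd` yields the first pointer and `tgt` the head of an arc. There are at most `k` arcs. -/
structure AdjLists (G : BipartiteGraph n m) (hd nxt tgt : ℤ → ℤ)
    (A : ℕ → Fin n → Fin n → Prop) (k : ℕ) (adj : Fin n → List ℕ) : Prop where
  linked : ∀ v, Inc G v → Linked nxt (hd (v : ℕ)) (adj v)
  mem : ∀ q u, q ∈ adj u ↔ ∃ v, A q u v
  tgt : ∀ q u v, A q u v → tgt (q : ℕ) = (v : ℕ)
  card : ∑ v, (adj v).length ≤ k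

theorem AdjLists.congr {hd nxt tgt : ℤ → ℤ} {A A' : ℕ → Fin n → Fin n → Prop} {k k' : ℕ}
    {adj : Fin n → List ℕ} (h : AdjLists G hd nxt tgt A k adj) (hk : k ≤ k')
    (hA : ∀ q u v, A q u v ↔ A' q u v) : AdjLists G hd nxt tgt A' k' adj where
  linked := h.linked
  mem q u := by rw [h.mem]; exact exists_congr fun v => hA q u v
  tgt q u v ha := h.tgt q u v ((hA q u v).2 ha)
  card := h.card.trans hk

/-- Insertion of the arc `q` from `u` to `v` at the front of the list of `u`. -/
theorem AdjLists.insert {hd nxt tgt hd' nxt' tgt' : ℤ → ℤ} {A : ℕ → Fin n → Fin n → Prop} {k : ℕ}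
    {adj : Fin n → List ℕ} (h : AdjLists G hd nxt tgt A k adj) {q : ℕ} {u v : Fin n} (hq : 0 < q)
    (hA : ∀ u v, ¬ A q u v) (hu : Inc G u)
    (h1 : ∀ x, nxt' x = if x = (q : ℤ) then hd (u : ℕ) else nxt x)
    (h2 : ∀ x, tgt' x = if x = (q : ℤ) then ((v : ℕ) : ℤ) else tgt x)
    (h3 : ∀ x, hd' x = if x = ((u : ℕ) : ℤ) then (q : ℤ) else hd x) :
    AdjLists G hd' nxt' tgt' (fun q' u' v' => A q' u' v' ∨ (q' = q ∧ u' = u ∧ v' = v)) (k + 1)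
      (Function.update adj u (q :: adj u)) := by
  have hnq : ∀ u', q ∉ adj u' := fun u' hc => by
    obtain ⟨v', hv'⟩ := (h.mem q u').1 hc
    exact hA _ _ hv'
  have hl : ∀ w, Inc G w → Linked nxt' (hd (w : ℕ)) (adj w) := fun w hw =>
    (h.linked w hw).congr fun q' hq' => by
      rw [h1, if_neg]
      intro hc
      exact hnq w (by rwa [Nat.cast_inj.1 hc] at hq')
  refine ⟨fun w hw => ?_, fun q' u' => ?_, fun q' u' v' ha => ?_, ?_⟩
  · by_cases hwu : w = u
    · subst hwu
      simp only [Function.update_self, h3, if_true, Linked, h1, true_and]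
      exact ⟨hq, hl w hw⟩
    · rw [Function.update_of_ne hwu, h3, if_neg (by rwa [Nat.cast_inj, ← Fin.ext_iff])]
      exact hl w hw
  · by_cases hwu : u' = u
    · subst hwu
      simp only [Function.update_self, List.mem_cons, h.mem]
      constructor
      · rintro (rfl | ⟨v', h'⟩)
        exacts [⟨v, by simp⟩, ⟨v', Or.inl h'⟩]
      · rintro ⟨v', h' | h'⟩
        exacts [Or.inr ⟨v', h'⟩, Or.inl h'.1]
    · simp [h.mem, hwu]
  · rcases ha with ha | ⟨rfl, rfl, rfl⟩
    · rw [h2, if_neg, h.tgt _ _ _ ha]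
      intro hc
      exact hA u' v' (by rwa [Nat.cast_inj.1 hc] at ha)
    · simp [h2]
  · have : ∀ w, (Function.update adj u (q :: adj u) w).length =
        (adj w).length + if w = u then 1 else 0 := fun w => by
      by_cases hwu : w = u
      · subst hwu; simp
      · simp [hwu]
    simp only [this, Finset.sum_add_distrib, Finset.sum_ite_eq', Finset.mem_univ, if_true]
    have := h.card
    omega

/-- The names of the residual arcs of the first `i` edges: `e + 1` for the edge `e` from left to
right, if it is tight, and `m + e + 1` for the edge `e` from right to left, if it is used. -/
def ArcName (G : BipartiteGraph n m) (c : Fin m → ℕ) (y : Fin n → ℤ) (M : Fin m → ℕ) (i : ℕ)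
    (q : ℕ) (u v : Fin n) : Prop :=
  (∃ e : Fin m, (e : ℕ) < i ∧ q = e + 1 ∧ G.left e = u ∧ G.right e = v ∧
      y (G.left e) + y (G.right e) = c e) ∨
    ∃ e : Fin m, (e : ℕ) < i ∧ q = m + e + 1 ∧ G.right e = u ∧ G.left e = v ∧ 0 < M e

/-- The arc names of the first `i` edges, together with the forward name of edge `i`. -/
def ArcName' (G : BipartiteGraph n m) (c : Fin m → ℕ) (y : Fin n → ℤ) (M : Fin m → ℕ) (i : Fin m)
    (q : ℕ) (u v : Fin n) : Prop :=
  ArcName G c y M i q u v ∨ (q = i + 1 ∧ G.left i = u ∧ G.right i = v ∧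
      y (G.left i) + y (G.right i) = c i)

theorem arcName_succ {y : Fin n → ℤ} {M : Fin m → ℕ} (i : Fin m) (q : ℕ) (u v : Fin n) :
    ArcName G c y M (i + 1) q u v ↔ ArcName' G c y M i q u v ∨
      (q = m + i + 1 ∧ G.right i = u ∧ G.left i = v ∧ 0 < M i) := by
  have key : ∀ P : Fin m → Prop, (∃ e : Fin m, (e : ℕ) < i + 1 ∧ P e) ↔
      (∃ e : Fin m, (e : ℕ) < i ∧ P e) ∨ P i := by
    intro P
    constructor
    · rintro ⟨e, he, hP⟩
      rcases Nat.lt_succ_iff_lt_or_eq.1 he with h | h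
      exacts [Or.inl ⟨e, h, hP⟩, Or.inr (Fin.ext h ▸ hP)]
    · rintro (⟨e, he, hP⟩ | hP)
      exacts [⟨e, by omega, hP⟩, ⟨i, by omega, hP⟩]
  unfold ArcName' ArcName
  rw [key, key]
  constructor
  · rintro ((h | h) | (h | h))
    exacts [Or.inl (Or.inl (Or.inl h)), Or.inl (Or.inr h), Or.inl (Or.inl (Or.inr h)), Or.inr h]
  · rintro (((h | h) | h) | h)
    exacts [Or.inl (Or.inl h), Or.inr (Or.inl h), Or.inl (Or.inr h), Or.inr (Or.inr h)]

theorem ArcName.le {y : Fin n → ℤ} {M : Fin m → ℕ} {i q : ℕ} {u v : Fin n}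
    (h : ArcName G c y M i q u v) : 0 < q ∧ (q ≤ i ∨ (m < q ∧ q ≤ m + i)) ∧ q ≤ 2 * m := by
  rcases h with ⟨e, h1, rfl, -⟩ | ⟨e, h1, rfl, -⟩ <;> have := e.2 <;> omega

theorem Linked.head_le {nxt : ℤ → ℤ} {l : List ℕ} {p : ℤ} {K : ℕ} (h : Linked nxt p l)
    (hl : ∀ q ∈ l, q ≤ K) : 0 ≤ p ∧ p ≤ K := by
  cases l with
  | nil => have : p = 0 := h; omega
  | cons q l => have := hl q (by simp); have := h.1; omega

/-- Insertion of the forward arc of the current edge, if it is tight, into its adjacency list. -/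
def forwardArc : Program :=
  .branch ((eY eL + eY eR).eq eC)
    (.store 8 (eI + .const 1) (.get 7 eL) ;; .store 9 (eI + .const 1) eR ;;
      .store 7 eL (eI + .const 1)) .skip

/-- Insertion of the backward arc of the current edge, if it is used, into its adjacency list. -/
def backwardArc : Program :=
  .branch ((Expr.const 0).lt eM)
    (.store 8 (.reg 1 + eI + .const 1) (.get 7 eR) ;; .store 9 (.reg 1 + eI + .const 1) eL ;;
      .store 7 eR (.reg 1 + eI + .const 1)) .skip

/-- The adjacency lists of the residual graph. -/
def adjSweep : Program := forEdges (forwardArc ;; backwardArc)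

theorem adjSweep_spec {U : ℕ} {σ : State} {y : Fin n → ℤ} {M : Fin m → ℕ} (H : Holds G c b σ)
    (hy : HoldsY y σ) (hM : HoldsM M σ) (hm : 2 * m ≤ U) (hn : n ≤ U)
    (h7 : ∀ v, Inc G v → σ.arr 7 (v : ℕ) = 0) :
    HT U adjSweep σ (m * 10 + 2) fun τ =>
      ∃ adj, AdjLists G (τ.arr 7) (τ.arr 8) (τ.arr 9) (ArcName G c y M m) (2 * m) adj := by
  have hvU : ∀ v : Fin n, Small U ((v : ℕ) : ℤ) := fun v =>
    Small.of_nonneg (by positivity) (by have := v.2; omega)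
  refine HT.forEdges (body := forwardArc ;; backwardArc) (fun i τ => ∃ adj, AdjLists G (τ.arr 7)
      (τ.arr 8) (τ.arr 9) (ArcName G c y M i) (2 * i) adj) H.hm (by omega)
    (by simp [forwardArc, backwardArc]) (by simp [forwardArc, backwardArc]) (fun _ _ _ h => h)
    ⟨fun _ => [], fun v hv => h7 v hv, by simp [ArcName], by simp [ArcName], by simp⟩ ?_
  rintro e τ hi h1 hS ⟨adj, hadj⟩
  have hke : Keeps (forEdges (forwardArc ;; backwardArc)) := by
    constructor <;> simp [forEdges, forwardArc, backwardArc]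
  have H' := H.same hS hke
  have hM' := hM.same hS (by simp [forEdges, forwardArc, backwardArc])
  have hy' := hy.same hS (by simp [forEdges, forwardArc, backwardArc])
    (by simp [forEdges, forwardArc, backwardArc])
  have hhd : ∀ v, Inc G v → Small U (τ.arr 7 (v : ℕ)) := fun v hv => by
    have := (hadj.linked v hv).head_le (K := 2 * m) fun q hq => by
      obtain ⟨w, hw⟩ := (hadj.mem q v).1 hq; exact hw.le.2.2
    exact Small.of_nonneg this.1 (by omega)
  have he := e.2
  -- the forward arc
  have first : HT U forwardArc τ 4 fun τ' => ∃ adj, AdjLists G (τ'.arr 7)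
      (τ'.arr 8) (τ'.arr 9) (ArcName' G c y M e) (2 * e + 1) adj := by
    refine HT.of_wp forwardArc ?_
    simp [forwardArc, hi, H'.left, H'.right, hy' _, H'.cost, hhd _ (Inc.left e), hvU]
    refine ⟨fun ht => ⟨Small.of_nonneg (by positivity) (by omega), ?_⟩,
      fun ht => ⟨adj, ?_⟩⟩
    · refine ⟨_, (hadj.insert (q := e + 1) (u := G.left e) (v := G.right e) (by omega)
        (fun u v ha => ?_) (Inc.left e) (fun x => ?_) (fun x => ?_) fun x => ?_).congr le_rfl ?_⟩
      · have := ha.le; omega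
      · simp
      · simp
      · simp
      · intro q u v
        simp only [ArcName', ht, and_true, eq_comm]
    · refine hadj.congr (by omega) fun q u v => ?_
      simp [ArcName', ht]
  refine first.seq (s₂ := 4) fun τ' hS' ⟨adj', hadj'⟩ => ?_
  have hle : ∀ q u v, ArcName' G c y M e q u v → q ≤ m + e ∧ q ≤ 2 * m := fun q u v h => by
    rcases h with h | ⟨rfl, -⟩
    · have := h.le; omega
    · omega
  have hke' : Keeps forwardArc := by constructor <;> simp [forwardArc]
  have H'' := H'.same hS' hke'
  have hM'' := hM'.same hS' (by simp [forwardArc])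
  have hi' : τ'.reg 10 = (e : ℕ) := (hS'.1 10 (by simp [forwardArc])).trans hi
  have hhd' : ∀ v, Inc G v → Small U (τ'.arr 7 (v : ℕ)) := fun v hv => by
    have := (hadj'.linked v hv).head_le (K := 2 * m) fun q hq => by
      obtain ⟨w, hw⟩ := (hadj'.mem q v).1 hq; exact (hle _ _ _ hw).2
    exact Small.of_nonneg this.1 (by omega)
  refine HT.of_wp backwardArc ?_
  simp [backwardArc, hi', H''.left, H''.right, H''.hm, hM'' _, hhd' _ (Inc.right e), hvU]
  refine ⟨fun ht => ⟨Small.of_nonneg (by positivity) (by omega), ?_⟩,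
      fun ht => ⟨adj', ?_⟩⟩
  · refine ⟨_, (hadj'.insert (q := m + e + 1) (u := G.right e) (v := G.left e) (by omega)
      (fun u v ha => ?_) (Inc.right e) (fun x => ?_) (fun x => ?_) fun x => ?_).congr
      (by omega) ?_⟩
    · have := hle _ _ _ ha; omega
    · simp
    · simp
    · simp
    · intro q u v
      rw [arcName_succ]
      simp only [Nat.pos_of_ne_zero ht, and_true, eq_comm]
  · refine hadj'.congr (by omega) fun q u v => ?_
    rw [arcName_succ]
    simp [ht]

end Machine

namespace Machine

open BipartiteGraph

variable {n m : ℕ} {G : BipartiteGraph n m} {c : Fin m → ℕ} {b β : Fin n → ℕ}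
  {y : Fin n → ℤ} {M : Fin m → ℕ} {adj : Fin n → List ℕ}

/-! ### Graph search in the residual graph -/

theorem ArcName.arc {i q : ℕ} {u v : Fin n} (h : ArcName G c y M i q u v) : G.Arc c y M u v := by
  rcases h with ⟨e, -, -, h⟩ | ⟨e, -, -, h⟩
  exacts [Or.inl ⟨e, h⟩, Or.inr ⟨e, h⟩]

theorem ArcName.inc {i q : ℕ} {u v : Fin n} (h : ArcName G c y M i q u v) :
    Inc G u ∧ Inc G v := by
  rcases h with ⟨e, -, -, rfl, rfl, -⟩ | ⟨e, -, -, rfl, rfl, -⟩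
  exacts [⟨Inc.left e, Inc.right e⟩, ⟨Inc.right e, Inc.left e⟩]

theorem exists_arcName {u v : Fin n} (h : G.Arc c y M u v) : ∃ q, ArcName G c y M m q u v := by
  rcases h with ⟨e, h⟩ | ⟨e, h⟩
  exacts [⟨_, Or.inl ⟨e, e.2, rfl, h⟩⟩, ⟨_, Or.inr ⟨e, e.2, rfl, h⟩⟩]

theorem ArcName.head_unique {i q : ℕ} {u v u' v' : Fin n} (h : ArcName G c y M i q u v)
    (h' : ArcName G c y M i q u' v') : u = u' ∧ v = v' := by
  rcases h with ⟨e, -, he, rfl, rfl, -⟩ | ⟨e, -, he, rfl, rfl, -⟩ <;>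
    rcases h' with ⟨e', -, he', rfl, rfl, -⟩ | ⟨e', -, he', rfl, rfl, -⟩ <;>
    have := e.2 <;> have := e'.2
  · have : e = e' := Fin.ext (by omega)
    subst this; simp
  · omega
  · omega
  · have : e = e' := Fin.ext (by omega)
    subst this; simp

/-- What the search knows about a marked vertex: its mark is a time stamp, and its parent is
either the null pointer, for a root, or an arc from a vertex with a smaller mark. -/
def HasParent (G : BipartiteGraph n m) (c : Fin m → ℕ) (β : Fin n → ℕ) (y : Fin n → ℤ)
    (M : Fin m → ℕ) (mark par : ℤ → ℤ) (v : Fin n) : Prop :=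
  (par (v : ℕ) = 0 ∧ G.Root β M v) ∨ ∃ q u, par (v : ℕ) = (q : ℕ) ∧ ArcName G c y M m q u v ∧
    mark (u : ℕ) ≠ 0 ∧ mark (u : ℕ) < mark (v : ℕ)

/-- The pointers that the search still has to follow: the rest `lc` of the current list, and the
lists `pend j`, for `j < s`, on the stack. -/
def Pending (lc : List ℕ) (pend : ℕ → List ℕ) (s q : ℕ) : Prop :=
  q ∈ lc ∨ ∃ j < s, q ∈ pend j

/-- The number of arcs that the search has not followed yet. -/
def work (mark : ℤ → ℤ) (adj : Fin n → List ℕ) (lc : List ℕ) (pend : ℕ → List ℕ) (s : ℕ) : ℕ :=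
  lc.length + ∑ j ∈ Finset.range s, (pend j).length +
    ∑ v : Fin n, if mark (v : ℕ) = 0 then (adj v).length else 0

/-- The invariant of the search, with stack height `s`, `k` marked vertices, and at most `w` arcs
to follow. Arcs into vertices with property `exc` may have been dropped. -/
structure SearchInv (G : BipartiteGraph n m) (c : Fin m → ℕ) (β : Fin n → ℕ) (y : Fin n → ℤ)
    (M : Fin m → ℕ) (adj : Fin n → List ℕ) (exc : Fin n → Prop) (lc : List ℕ)
    (pend : ℕ → List ℕ) (s k w : ℕ) (τ : State) : Prop where
  adjl : AdjLists G (τ.arr 7) (τ.arr 8) (τ.arr 9) (ArcName G c y M m) (2 * m) adj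
  sp : τ.reg 17 = s
  cnt : τ.reg 18 = k
  stk : ∀ j < s, Linked (τ.arr 8) (τ.arr 12 (j : ℕ)) (pend j)
  cur : Linked (τ.arr 8) (τ.reg 16) lc
  mark_nonneg : ∀ v, Inc G v → 0 ≤ τ.arr 10 (v : ℕ)
  mark_le : ∀ v, Inc G v → τ.arr 10 (v : ℕ) ≤ k
  parent : ∀ v, Inc G v → τ.arr 10 (v : ℕ) ≠ 0 →
    HasParent G c β y M (τ.arr 10) (τ.arr 11) v
  reach : ∀ v, Inc G v → τ.arr 10 (v : ℕ) ≠ 0 → v ∈ G.reachSet c β y M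
  follow : ∀ (q : ℕ) (u v : Fin n), τ.arr 10 (u : ℕ) ≠ 0 → ArcName G c y M m q u v →
    τ.arr 10 (v : ℕ) ≠ 0 ∨ exc v ∨ Pending lc pend s q
  pending : ∀ q, Pending lc pend s q → ∃ u v, ArcName G c y M m q u v ∧ τ.arr 10 (u : ℕ) ≠ 0
  work_le : work (τ.arr 10) adj lc pend s ≤ w
  height : s ≤ k

/-- Marking a vertex `v` and pushing its list. -/
theorem SearchInv.push {lc : List ℕ} {pend : ℕ → List ℕ} {s k w : ℕ} {τ τ' : State}
    {exc : Fin n → Prop} {v : Fin n} {p : ℤ}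
    (h : SearchInv G c β y M adj exc lc pend s k w τ) (hexc : ∀ w, exc w → w = v)
    (hv : Inc G v) (hv0 : τ.arr 10 (v : ℕ) = 0)
    (hp : (p = 0 ∧ G.Root β M v) ∨ ∃ q u, p = (q : ℕ) ∧ ArcName G c y M m q u v ∧
      τ.arr 10 (u : ℕ) ≠ 0)
    (e7 : τ'.arr 7 = τ.arr 7) (e8 : τ'.arr 8 = τ.arr 8) (e9 : τ'.arr 9 = τ.arr 9)
    (e16 : τ'.reg 16 = τ.reg 16) (e17 : τ'.reg 17 = s + 1) (e18 : τ'.reg 18 = k + 1)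
    (e10 : ∀ x, τ'.arr 10 x = if x = ((v : ℕ) : ℤ) then (k : ℤ) + 1 else τ.arr 10 x)
    (e11 : ∀ x, τ'.arr 11 x = if x = ((v : ℕ) : ℤ) then p else τ.arr 11 x)
    (e12 : ∀ x, τ'.arr 12 x = if x = (s : ℤ) then τ.arr 7 (v : ℕ) else τ.arr 12 x) :
    SearchInv G c β y M adj (fun _ => False) lc (Function.update pend s (adj v)) (s + 1) (k + 1)
      w τ' := by
  have hcast : ∀ u : Fin n, (((u : ℕ) : ℤ) = ((v : ℕ) : ℤ)) ↔ u = v := fun u => by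
    rw [Nat.cast_inj, Fin.ext_iff]
  have m10 : ∀ u : Fin n, τ'.arr 10 (u : ℕ) = if u = v then (k : ℤ) + 1 else τ.arr 10 (u : ℕ) :=
    fun u => by rw [e10]; simp only [hcast]
  have m11 : ∀ u : Fin n, τ'.arr 11 (u : ℕ) = if u = v then p else τ.arr 11 (u : ℕ) :=
    fun u => by rw [e11]; simp only [hcast]
  have hne : ∀ u : Fin n, τ.arr 10 (u : ℕ) ≠ 0 → u ≠ v := fun u hu huv => hu (huv ▸ hv0)
  have hmono : ∀ u : Fin n, τ.arr 10 (u : ℕ) ≠ 0 → τ'.arr 10 (u : ℕ) ≠ 0 := fun u hu => by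
    rw [m10, if_neg (hne u hu)]; exact hu
  have hpend : ∀ q, Pending lc (Function.update pend s (adj v)) (s + 1) q ↔
      Pending lc pend s q ∨ q ∈ adj v := by
    intro q
    constructor
    · rintro (h | ⟨j, hj, h⟩)
      · exact Or.inl (Or.inl h)
      · by_cases hjs : j = s
        · subst hjs; right; simpa using h
        · rw [Function.update_of_ne hjs] at h
          exact Or.inl (Or.inr ⟨j, by omega, h⟩)
    · rintro ((h | ⟨j, hj, h⟩) | h)
      · exact Or.inl h
      · exact Or.inr ⟨j, by omega, by rwa [Function.update_of_ne hj.ne]⟩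
      · exact Or.inr ⟨s, by omega, by simpa using h⟩
  refine ⟨by rw [e7, e8, e9]; exact h.adjl, by rw [e17]; push_cast; rfl,
    by rw [e18]; push_cast; rfl, ?_, by rw [e8, e16]; exact h.cur, ?_, ?_, ?_, ?_, ?_, ?_, ?_, ?_⟩
  · intro j hj
    by_cases hjs : j = s
    · subst hjs
      rw [e12, if_pos rfl, Function.update_self, e8]
      exact h.adjl.linked v hv
    · rw [e12, if_neg (by exact_mod_cast hjs), Function.update_of_ne hjs, e8]
      exact h.stk j (by omega)
  · intro u hu
    rw [m10]
    split_ifs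
    · positivity
    · exact h.mark_nonneg u hu
  · intro u hu
    rw [m10]
    have := h.mark_le u hu
    push_cast
    split_ifs <;> omega
  · intro u hu hu0
    unfold HasParent
    rw [m11, m10]
    by_cases huv : u = v
    · subst huv
      simp only [if_true]
      rcases hp with hp | ⟨q, u', rfl, h1, h2⟩
      · exact Or.inl hp
      · refine Or.inr ⟨q, u', rfl, h1, hmono _ h2, ?_⟩
        rw [m10, if_neg (hne _ h2)]
        have := h.mark_le u' h1.inc.1
        omega
    · rw [m10, if_neg huv] at hu0
      simp only [huv, if_false]
      rcases h.parent u hu hu0 with hp | ⟨q, u', h0, h1, h2, h3⟩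
      · exact Or.inl hp
      · refine Or.inr ⟨q, u', h0, h1, hmono _ h2, ?_⟩
        rwa [m10, if_neg (hne _ h2)]
  · intro u hu hu0
    by_cases huv : u = v
    · subst huv
      rcases hp with ⟨-, hr⟩ | ⟨q, u', rfl, h1, h2⟩
      · exact reach_root (mem_lefts.2 hr.1) hr.2
      · have := h.reach u' h1.inc.1 h2
        rw [mem_reachSet] at this ⊢
        obtain ⟨r, hr, hc⟩ := this
        exact ⟨r, hr, hc.tail h1.arc⟩
    · rw [m10, if_neg huv] at hu0
      exact h.reach u hu hu0
  · intro q u x hu ha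
    rw [hpend]
    by_cases huv : u = v
    · subst huv
      exact Or.inr (Or.inr (Or.inr ((h.adjl.mem q u).2 ⟨x, ha⟩)))
    · rw [m10, if_neg huv] at hu
      rcases h.follow q u x hu ha with h1 | h1 | h1
      · exact Or.inl (hmono _ h1)
      · left
        rw [hexc x h1, m10, if_pos rfl]
        positivity
      · exact Or.inr (Or.inr (Or.inl h1))
  · intro q hq
    rw [hpend] at hq
    rcases hq with hq | hq
    · obtain ⟨u, x, h1, h2⟩ := h.pending q hq
      exact ⟨u, x, h1, hmono _ h2⟩
    · obtain ⟨x, hx⟩ := (h.adjl.mem q v).1 hq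
      refine ⟨v, x, hx, ?_⟩
      rw [m10, if_pos rfl]
      positivity
  · refine le_trans (le_of_eq ?_) h.work_le
    unfold work
    have h1 : ∑ j ∈ Finset.range s, (Function.update pend s (adj v) j).length =
        ∑ j ∈ Finset.range s, (pend j).length := by
      refine Finset.sum_congr rfl fun j hj => ?_
      rw [Function.update_of_ne (Finset.mem_range.1 hj).ne]
    have h2 : ∀ u : Fin n, (if τ.arr 10 (u : ℕ) = 0 then (adj u).length else 0) =
        (if τ'.arr 10 (u : ℕ) = 0 then (adj u).length else 0) +
          if u = v then (adj u).length else 0 := fun u => by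
      rw [m10]
      by_cases huv : u = v
      · subst huv
        have : (k : ℤ) + 1 ≠ 0 := by positivity
        simp [hv0, this]
      · simp [huv]
    simp only [h2, Finset.sum_add_distrib, Finset.sum_ite_eq', Finset.mem_univ, if_true,
      Finset.sum_range_succ, h1, Function.update_self]
    omega
  · have := h.height; omega

theorem SearchInv.setReg {lc : List ℕ} {pend : ℕ → List ℕ} {s k w : ℕ} {τ : State}
    {exc : Fin n → Prop} {r : ℕ} {z : ℤ} (h : SearchInv G c β y M adj exc lc pend s k w τ)
    (hr : r ≠ 16 ∧ r ≠ 17 ∧ r ≠ 18) :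
    SearchInv G c β y M adj exc lc pend s k w (τ.setReg r z) where
  adjl := h.adjl
  sp := by simpa [hr.2.1.symm] using h.sp
  cnt := by simpa [hr.2.2.symm] using h.cnt
  stk := h.stk
  cur := by simpa [hr.1.symm] using h.cur
  mark_nonneg := h.mark_nonneg
  mark_le := h.mark_le
  parent := h.parent
  reach := h.reach
  follow := h.follow
  pending := h.pending
  work_le := h.work_le
  height := h.height

theorem SearchInv.small_head {lc : List ℕ} {pend : ℕ → List ℕ} {s k w U : ℕ} {τ : State}
    {exc : Fin n → Prop} {v : Fin n} (h : SearchInv G c β y M adj exc lc pend s k w τ)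
    (hv : Inc G v) (hU : 2 * m ≤ U) : Small U (τ.arr 7 (v : ℕ)) := by
  have := (h.adjl.linked v hv).head_le (K := 2 * m) fun q hq => by
    obtain ⟨w, hw⟩ := (h.adjl.mem q v).1 hq; exact hw.le.2.2
  exact Small.of_nonneg this.1 (by omega)

/-- The code that marks the vertex `v` with parent pointer `p` and pushes its list. -/
def pushCode (v p : Expr) : Program :=
  .assign 18 (.reg 18 + .const 1) ;; .store 10 v (.reg 18) ;; .store 11 v p ;;
  .store 12 (.reg 17) (.get 7 v) ;; .assign 17 (.reg 17 + .const 1)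

/-- The unsaturated left vertices are marked and pushed, with null parent pointers. -/
def rootSweep : Program :=
  .assign 16 (.const 0) ;; .assign 17 (.const 0) ;; .assign 18 (.const 0) ;;
  forEdges (.branch ((Expr.const 0).lt (.get 6 eL) * (Expr.get 10 eL).eq (.const 0))
    (pushCode eL (.const 0)) .skip)

theorem rootSweep_spec {U : ℕ} {σ : State} (H : Holds G c b σ)
    (hadj : AdjLists G (σ.arr 7) (σ.arr 8) (σ.arr 9) (ArcName G c y M m) (2 * m) adj)
    (h6 : ∀ v, Inc G v → σ.arr 6 (v : ℕ) = (β v : ℤ) - G.deg M v)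
    (h10 : ∀ v, Inc G v → σ.arr 10 (v : ℕ) = 0) (hm : 3 * m + 1 ≤ U) :
    HT U rootSweep σ (m * 8 + 5) fun τ => ∃ pend s k,
      SearchInv G c β y M adj (fun _ => False) [] pend s k (2 * m) τ ∧ k ≤ m ∧
      ∀ v, G.Root β M v → τ.arr 10 (v : ℕ) ≠ 0 := by
  have h0 : Small U 0 := Small.of_nonneg le_rfl (by positivity)
  have first : HT U (.assign 16 (.const 0)) σ 1 fun τ => τ = σ.setReg 16 0 :=
      HT.of_wp _ (by simp [h0])
  have second : ∀ σ, HT U (.assign 17 (.const 0)) σ 1 fun τ => τ = σ.setReg 17 0 :=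
    fun σ => HT.of_wp _ (by simp [h0])
  have third : ∀ σ, HT U (.assign 18 (.const 0)) σ 1 fun τ => τ = σ.setReg 18 0 :=
    fun σ => HT.of_wp _ (by simp [h0])
  refine HT.mono (first.seq fun τ₁ _ e₁ => (second τ₁).seq fun τ₂ _ e₂ => (third τ₂).seq
    fun τ₃ _ e₃ => HT.forEdges (m := m) (s := 6) (fun i τ => ∃ pend s k,
      SearchInv G c β y M adj (fun _ => False) [] pend s k (2 * m) τ ∧ k ≤ i ∧
      ∀ e : Fin m, (e : ℕ) < i → G.Root β M (G.left e) → τ.arr 10 (G.left e : ℕ) ≠ 0)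
    (by rw [e₃, e₂, e₁]; simp [H.hm]) (by omega) (by simp [pushCode]) (by simp [pushCode])
    ?_ ?_ ?_) (by omega) ?_
  · rintro i τ z ⟨pend, s, k, h1, h2, h3⟩
    exact ⟨pend, s, k, h1.setReg (by simp), h2, h3⟩
  · refine ⟨fun _ => [], 0, 0, ?_, le_rfl, by simp⟩
    rw [e₃, e₂, e₁]
    constructor <;> simp
    · exact hadj
    · simp [Linked]
    · exact fun v hv => (h10 v hv).ge
    · exact fun v hv => (h10 v hv).le
    · exact fun v hv h => absurd (h10 v hv) h
    · exact fun v hv h => absurd (h10 v hv) h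
    · exact fun q u v h ha => absurd (h10 u ha.inc.1) h
    · simp [Pending]
    · simp only [work]
      refine le_trans ?_ hadj.card
      simp
      exact Finset.sum_le_sum fun v _ => by split_ifs <;> simp
  · rintro e τ hi hm1 hS ⟨pend, s, k, h1, h2, h3⟩
    have H₃ : Holds G c b τ₃ := by
      rw [e₃, e₂, e₁]
      exact ⟨by simp [H.hm], H.left, H.right, by simpa using H.cost, by simpa using H.dem⟩
    have H' := H₃.same hS (by constructor <;> simp [forEdges, pushCode])
    have h6' : τ.arr 6 (G.left e : ℕ) = (β (G.left e) : ℤ) - G.deg M (G.left e) := by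
      rw [hS.2 6 (by simp [forEdges, pushCode]), e₃, e₂, e₁]
      exact h6 _ (Inc.left e)
    have hk : k < m := by have := e.2; omega
    have hs := h1.height
    have hhd := h1.small_head (Inc.left e) (U := U) (by omega)
    refine HT.of_wp _ ?_
    simp [pushCode, hi, H'.left, h6', h1.cnt, h1.sp, hhd, h0]
    refine ⟨fun h10 hd => ⟨⟨by omega, by omega⟩, ⟨by omega, by omega⟩, ?_⟩, fun hd => ?_⟩
    · have hr : G.Root β M (G.left e) := ⟨⟨e, rfl⟩, hd⟩
      refine ⟨_, _, _, h1.push (v := G.left e) (p := 0) (by simp) (Inc.left e) h10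
        (Or.inl ⟨rfl, hr⟩) ?_ ?_ ?_ ?_ ?_ ?_ ?_ ?_ ?_, by omega, ?_⟩
      · funext x; simp
      · funext x; simp
      · funext x; simp
      · simp
      · simp
      · simp
      · simp
      · simp
      · simp
      · intro e' he' hr'
        by_cases hee : (G.left e' : ℕ) = G.left e
        · simp [hee]; positivity
        · rcases lt_or_eq_of_le he' with hlt | heq
          · simpa [hee] using h3 e' hlt hr'
          · exact absurd (by rw [heq]) hee
    · refine ⟨pend, s, k, h1, by omega, fun e' he' hr' => ?_⟩
      rcases lt_or_eq_of_le he' with hlt | heq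
      · exact h3 e' hlt hr'
      · rw [heq] at hr' ⊢
        exact fun h10 => absurd hr'.2 (not_lt.2 (hd h10))
  · rintro τ - ⟨pend, s, k, h1, h2, h3⟩
    refine ⟨pend, s, k, h1, h2, ?_⟩
    rintro v ⟨⟨e, rfl⟩, hv⟩
    exact h3 e e.2 ⟨⟨e, rfl⟩, hv⟩

/-- Depth-first search: the next arc of the current list is followed, or, if the list is exhausted,
the next list is popped. -/
def searchLoop : Program :=
  .loop (.reg 16 + .reg 17) <|
    .branch (.reg 16)
      (.assign 21 (.get 9 (.reg 16)) ;; .assign 22 (.reg 16) ;; .assign 16 (.get 8 (.reg 16)) ;;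
        .branch ((Expr.get 10 (.reg 21)).eq (.const 0)) (pushCode (.reg 21) (.reg 22)) .skip)
      (.assign 17 (.reg 17 - .const 1) ;; .assign 16 (.get 12 (.reg 17)))

/-- The result of the search: the marked vertices are the reachable ones. -/
structure Searched (G : BipartiteGraph n m) (c : Fin m → ℕ) (β : Fin n → ℕ) (y : Fin n → ℤ)
    (M : Fin m → ℕ) (τ : State) : Prop where
  mark_iff : ∀ v, Inc G v → (τ.arr 10 (v : ℕ) ≠ 0 ↔ v ∈ G.reachSet c β y M)
  mark_nonneg : ∀ v, Inc G v → 0 ≤ τ.arr 10 (v : ℕ)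
  mark_le : ∀ v, Inc G v → τ.arr 10 (v : ℕ) ≤ 3 * m
  parent : ∀ v, Inc G v → τ.arr 10 (v : ℕ) ≠ 0 →
    HasParent G c β y M (τ.arr 10) (τ.arr 11) v

theorem SearchInv.searched {pend : ℕ → List ℕ} {k w : ℕ} {τ : State}
    (h : SearchInv G c β y M adj (fun _ => False) [] pend 0 k w τ) (hk : k ≤ 3 * m)
    (hr : ∀ v, G.Root β M v → τ.arr 10 (v : ℕ) ≠ 0) : Searched G c β y M τ where
  mark_iff v hv := by
    refine ⟨h.reach v hv, fun h' => ?_⟩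
    obtain ⟨u, hu, hc⟩ := mem_reachSet.1 h'
    clear hv h'
    induction hc with
    | refl => exact hr u hu
    | tail _ ha ih =>
      obtain ⟨q, hq⟩ := exists_arcName ha
      rcases h.follow q _ _ ih hq with h1 | h1 | h1
      · exact h1
      · exact h1.elim
      · simp [Pending] at h1
  mark_nonneg := h.mark_nonneg
  mark_le v hv := (h.mark_le v hv).trans (by exact_mod_cast hk)
  parent := h.parent

/-- Each round follows an arc or pops a list. With `w` arcs to follow and `s` lists on the stack, at
most `2 * w + s` rounds remain, since following an arc pushes at most one list. -/
theorem searchLoop_spec {U : ℕ} {σ : State} {pend : ℕ → List ℕ} {s k : ℕ}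
    (h : SearchInv G c β y M adj (fun _ => False) [] pend s k (2 * m) σ) (hk : k ≤ m)
    (hr : ∀ v, G.Root β M v → σ.arr 10 (v : ℕ) ≠ 0) (hU : 3 * m + 1 ≤ U) (hn : n ≤ U) :
    HT U searchLoop σ (5 * m * 11 + 1) (Searched G c β y M) := by
  refine HT.mono (HT.loop (s := 10) (fun K τ => ∃ lc pend s k w,
    SearchInv G c β y M adj (fun _ => False) lc pend s k w τ ∧ k + w ≤ 3 * m ∧ 2 * w + s ≤ K ∧
    ∀ v, G.Root β M v → τ.arr 10 (v : ℕ) ≠ 0) ?_ (5 * m) σ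
    ⟨[], pend, s, k, 2 * m, h, by omega, by have := h.height; omega, hr⟩) le_rfl ?_
  · rintro K τ ⟨lc, pend, s, k, w, hI, hkw, hK, hroot⟩ he
    have hsk := hI.height
    simp only [Expr.eval_add, Expr.eval_reg, hI.sp] at he
    have hsmall : ∀ p l, Linked (τ.arr 8) p l → (∀ q ∈ l, Pending lc pend s q) → Small U p := by
      intro p l hp hl
      have := hp.head_le (K := 2 * m) fun q hq => by
        obtain ⟨u, v, h1, -⟩ := hI.pending q (hl q hq)
        exact h1.le.2.2
      exact Small.of_nonneg this.1 (by omega)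
    cases lc with
    | nil =>
      -- the current list is exhausted, and the top of the stack is popped
      have hcur : τ.reg 16 = 0 := hI.cur
      have hs : s ≠ 0 := by rintro rfl; simp [hcur] at he
      obtain ⟨s, rfl⟩ := Nat.exists_eq_succ_of_ne_zero hs
      have hst := hI.stk s (Nat.lt_succ_self s)
      have hsm := hsmall _ _ hst fun q hq => Or.inr ⟨s, Nat.lt_succ_self s, hq⟩
      refine HT.mono (HT.of_wp (.branch _ _ _) ?_) (s := 10) (by simp) fun _ _ h => h
      simp [hcur, hI.sp, hsm]
      refine ⟨⟨by omega, by omega⟩, 2 * w + s, by omega, pend s, pend, s, k, w, ?_, hkw, le_rfl,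
        hroot⟩
      have hpe : ∀ q, Pending (pend s) pend s q → Pending [] pend (s + 1) q := by
        rintro q (h | ⟨j, hj, h⟩)
        exacts [Or.inr ⟨s, by omega, h⟩, Or.inr ⟨j, by omega, h⟩]
      refine ⟨hI.adjl, by simp, by simp [hI.cnt], fun j hj => hI.stk j (by omega),
        by simpa using hst, hI.mark_nonneg, hI.mark_le, hI.parent, hI.reach, ?_,
        fun q hq => hI.pending q (hpe q hq), ?_, by omega⟩
      · intro q u v hu ha
        rcases hI.follow q u v hu ha with h1 | h1 | h1
        · exact Or.inl h1
        · exact Or.inr (Or.inl h1)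
        · refine Or.inr (Or.inr ?_)
          rcases h1 with h1 | ⟨j, hj, h1⟩
          · simp at h1
          · by_cases hjs : j = s
            · subst hjs; exact Or.inl h1
            · exact Or.inr ⟨j, by omega, h1⟩
      · refine le_trans (le_of_eq ?_) hI.work_le
        simp only [work, Finset.sum_range_succ, List.length_nil, State.arr_setReg]
        rw [zero_add, add_comm (pend s).length]
        rfl
    | cons q lc =>
      obtain ⟨hq1, hq2, hq3⟩ := hI.cur
      obtain ⟨u, v, ha, hu⟩ := hI.pending q (Or.inl (by simp))
      have htgt := hI.adjl.tgt q u v ha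
      have hw : 1 ≤ w := by
        have := hI.work_le
        simp only [work, List.length_cons] at this
        omega
      have hqU : Small U (q : ℤ) := hsmall q (q :: lc) ⟨rfl, hq2, hq3⟩ fun q' hq' => Or.inl hq'
      have hnq := hsmall _ _ hq3 fun q' hq' => Or.inl (by simp [hq'])
      have hvU : Small U ((v : ℕ) : ℤ) := Small.of_nonneg (by positivity) (by have := v.2; omega)
      have hhd := hI.small_head ha.inc.2 (U := U) (by omega)
      -- the arc `q` is dropped; only its head may be left out
      have hdrop : SearchInv G c β y M adj (· = v) lc pend s k (w - 1)
          (((τ.setReg 21 v).setReg 22 q).setReg 16 (τ.arr 8 q)) := by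
        have hpe : ∀ q', Pending lc pend s q' → Pending (q :: lc) pend s q' := by
          rintro q' (h | h)
          exacts [Or.inl (by simp [h]), Or.inr h]
        refine ⟨hI.adjl, by simp [hI.sp], by simp [hI.cnt], hI.stk, by simpa using hq3,
          hI.mark_nonneg, hI.mark_le, hI.parent, hI.reach, ?_,
          fun q hq => hI.pending q (hpe q hq), ?_, hI.height⟩
        · intro q' u' v' hu' ha'
          rcases hI.follow q' u' v' hu' ha' with h1 | h1 | h1
          · exact Or.inl h1
          · exact h1.elim
          · rcases h1 with h1 | h1
            · rcases List.mem_cons.1 h1 with rfl | h1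
              · exact Or.inr (Or.inl (ha'.head_unique ha).2)
              · exact Or.inr (Or.inr (Or.inl h1))
            · exact Or.inr (Or.inr (Or.inr h1))
        · have := hI.work_le
          change work (τ.arr 10) adj lc pend s ≤ w - 1
          simp only [work, List.length_cons] at this ⊢
          omega
      refine HT.mono (HT.of_wp (.branch _ _ _) ?_) (s := 10) (by simp) fun _ _ h => h
      simp [pushCode, hq1, hq2.ne', htgt, hI.sp, hI.cnt, hqU, hnq, hvU, hhd]
      refine ⟨fun h10 => ⟨⟨by omega, by omega⟩, ⟨by omega, by omega⟩, 2 * (w - 1) + (s + 1),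
        by omega, lc, Function.update pend s (adj v), s + 1, k + 1, w - 1, ?_, by omega, le_rfl,
        fun r hr => ?_⟩, fun h10 => ⟨2 * (w - 1) + s, by omega, lc, pend, s, k, w - 1, ?_,
        by omega, le_rfl, hroot⟩⟩
      · refine hdrop.push (v := v) (p := q) (fun _ h => h) ha.inc.2 (by simpa using h10)
          (Or.inr ⟨q, u, rfl, ha, by simpa using hu⟩) ?_ ?_ ?_ ?_ ?_ ?_ ?_ ?_ ?_
        · funext x; simp
        · funext x; simp
        · funext x; simp
        · simp
        · simp
        · simp
        · simp
        · simp
        · simp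
      · by_cases hrv : (r : ℕ) = v
        · simp [hrv]; positivity
        · simpa [hrv] using hroot r hr
      · refine { hdrop with follow := fun q' u' v' hu' ha' => ?_ }
        rcases hdrop.follow q' u' v' hu' ha' with h1 | h1 | h1
        · exact Or.inl h1
        · exact Or.inl (by rw [h1]; exact h10)
        · exact Or.inr (Or.inr h1)
  · rintro τ - ⟨⟨K, -, lc, pend, s, k, w, hI, hkw, hK, hroot⟩, he⟩
    simp only [Expr.eval_add, Expr.eval_reg, hI.sp] at he
    cases lc with
    | nil =>
      have hcur : τ.reg 16 = 0 := hI.cur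
      have : s = 0 := by omega
      subst this
      exact hI.searched (by omega) hroot
    | cons q lc =>
      obtain ⟨hq1, hq2, -⟩ := hI.cur
      omega

end Machine

namespace Machine

open BipartiteGraph

variable {n m : ℕ} {G : BipartiteGraph n m} {c : Fin m → ℕ} {b β : Fin n → ℕ}
  {y : Fin n → ℤ} {M : Fin m → ℕ}

/-! ### Augmentation -/

/-- Register 19 becomes `v + 1` for some unsaturated marked right vertex `v`, or 0 if there is none.
-/
def foundSweep : Program :=
  .assign 19 (.const 0) ;; forEdges (.branch
    ((Expr.const 0).lt (.get 6 eR) * (Expr.const 0).lt (.get 10 eR))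
    (.assign 19 (eR + .const 1)) .skip)

theorem Searched.pos_iff {τ : State} (h : Searched G c β y M τ) {v : Fin n} (hv : Inc G v) :
    0 < τ.arr 10 (v : ℕ) ↔ v ∈ G.reachSet c β y M := by
  rw [← h.mark_iff v hv]
  have := h.mark_nonneg v hv
  omega

theorem foundSweep_spec {U : ℕ} {σ : State} (H : Holds G c b σ) (hS : Searched G c β y M σ)
    (h6 : ∀ v, Inc G v → σ.arr 6 (v : ℕ) = (β v : ℤ) - G.deg M v)
    (hsub : ∀ v, G.deg M v ≤ β v) (hm : m ≤ U) (hn : n ≤ U) :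
    HT U foundSweep σ (m * 4 + 3) fun τ => (τ.reg 19 = 0 ∧ G.Stuck c β y M) ∨
      ∃ e, τ.reg 19 = (G.right e : ℕ) + 1 ∧ G.right e ∈ G.reachSet c β y M ∧
        G.deg M (G.right e) < β (G.right e) := by
  have h0 : Small U 0 := Small.of_nonneg le_rfl (by positivity)
  have first : HT U (.assign 19 (.const 0)) σ 1 fun τ => τ = σ.setReg 19 0 :=
    HT.of_wp _ (by simp [h0])
  refine HT.mono (first.seq fun τ₁ _ e₁ => HT.forEdges (m := m) (s := 2) (fun i τ =>
      (τ.reg 19 = 0 ∧ ∀ e : Fin m, (e : ℕ) < i → G.right e ∈ G.reachSet c β y M →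
        G.deg M (G.right e) = β (G.right e)) ∨
      ∃ e, τ.reg 19 = (G.right e : ℕ) + 1 ∧ G.right e ∈ G.reachSet c β y M ∧
        G.deg M (G.right e) < β (G.right e))
    (by rw [e₁]; simp [H.hm]) hm (by simp) (by simp) ?_ ?_ ?_) (by omega) ?_
  · intro i τ z h
    simpa using h
  · left; rw [e₁]; simp
  · intro e τ hi hm1 hS' hI
    have H₁ : Holds G c b τ₁ := by
      rw [e₁]
      exact ⟨by simp [H.hm], H.left, H.right, by simpa using H.cost, by simpa using H.dem⟩
    have H' := H₁.same hS' (by constructor <;> simp [forEdges])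
    have h6' : τ.arr 6 (G.right e : ℕ) = (β (G.right e) : ℤ) - G.deg M (G.right e) := by
      rw [hS'.2 6 (by simp [forEdges]), e₁]
      exact h6 _ (Inc.right e)
    have h10 : τ.arr 10 (G.right e : ℕ) = σ.arr 10 (G.right e : ℕ) := by
      rw [hS'.2 10 (by simp [forEdges]), e₁]; rfl
    have hpos := hS.pos_iff (Inc.right e)
    have hR := (G.right e).2
    have hsm : Small U ((G.right e : ℕ) + 1 : ℤ) := Small.of_nonneg (by positivity) (by omega)
    refine HT.of_wp _ ?_
    simp [hi, H'.right, h6', h10, hsm, hpos]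
    refine ⟨fun hr hd => Or.inr ⟨e, rfl, hr, hd⟩, fun h => ?_⟩
    rcases hI with ⟨h1, h2⟩ | h1
    · refine Or.inl ⟨h1, fun e' he' hr' => ?_⟩
      rcases lt_or_eq_of_le he' with hlt | heq
      · exact h2 e' hlt hr'
      · subst heq
        exact le_antisymm (hsub _) (h hr')
    · exact Or.inr h1
  · rintro τ - (⟨h1, h2⟩ | h)
    · exact Or.inl ⟨h1, fun e => h2 e e.2⟩
    · exact Or.inr h

theorem deg_update (M : Fin m → ℕ) (e : Fin m) (k : ℕ) (v : Fin n) :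
    G.deg (Function.update M e k) v + (if G.left e = v ∨ G.right e = v then M e else 0) =
      G.deg M v + if G.left e = v ∨ G.right e = v then k else 0 := by
  rw [deg_eq_sum, deg_eq_sum, ← Finset.add_sum_erase _ _ (Finset.mem_univ e),
    ← Finset.add_sum_erase (Finset.univ : Finset (Fin m)) (fun e => if G.left e = v ∨ G.right e = v
      then M e else 0) (Finset.mem_univ e), Function.update_self]
  rw [Finset.sum_congr rfl (g := fun e => if G.left e = v ∨ G.right e = v
      then M e else 0) fun e' he' => by
    rw [Function.update_of_ne (Finset.ne_of_mem_erase he')]]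
  omega

theorem sum_update (M : Fin m → ℕ) (e : Fin m) (k : ℕ) :
    ∑ e', Function.update M e k e' + M e = ∑ e', M e' + k := by
  rw [← Finset.add_sum_erase _ _ (Finset.mem_univ e),
    ← Finset.add_sum_erase (Finset.univ : Finset (Fin m)) (fun e => M e) (Finset.mem_univ e),
    Function.update_self]
  rw [Finset.sum_congr rfl (g := fun e => M e) fun e' he' => by
    rw [Function.update_of_ne (Finset.ne_of_mem_erase he')]]
  omega

theorem le_deg_left (M : Fin m → ℕ) (e : Fin m) : M e ≤ G.deg M (G.left e) := by
  rw [deg]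
  exact Finset.single_le_sum (f := M) (fun _ _ => Nat.zero_le _)
    (Finset.mem_filter.2 ⟨Finset.mem_univ e, Or.inl rfl⟩)

/-- The follow-up of the parent pointers from a vertex `t` has arrived at the vertex `v`; the
multiplicities `M'` arise from `M` by changes along the path from `v` to `t`. -/
structure Augmenting (G : BipartiteGraph n m) (c : Fin m → ℕ) (y : Fin n → ℤ) (M : Fin m → ℕ)
    (mark : ℤ → ℤ) (t v : Fin n) (M' : Fin m → ℕ) : Prop where
  tight : ∀ e, 0 < M' e → y (G.left e) + y (G.right e) = c e
  fresh : ∀ e, mark (G.left e : ℕ) ≤ mark (v : ℕ) → M e ≤ M' e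
  side : (v ∈ G.rights ∧ ∑ e, M' e = ∑ e, M e ∧
      ∀ w, G.deg M' w + (if v = w then 1 else 0) = G.deg M w + if t = w then 1 else 0) ∨
    (v ∈ G.lefts ∧ ∑ e, M' e = ∑ e, M e + 1 ∧
      ∀ w, G.deg M' w = G.deg M w + (if t = w then 1 else 0) + if v = w then 1 else 0)

theorem Augmenting.forward {mark : ℤ → ℤ} {t : Fin n} {M' : Fin m → ℕ} {e : Fin m}
    (h : Augmenting G c y M mark t (G.right e) M')
    (ht : y (G.left e) + y (G.right e) = c e)
    (hlt : mark (G.left e : ℕ) < mark (G.right e : ℕ)) :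
    Augmenting G c y M mark t (G.left e) (Function.update M' e (M' e + 1)) := by
  refine ⟨fun e' he' => ?_, fun e' he' => ?_, Or.inr ?_⟩
  · by_cases h' : e' = e
    · rwa [h']
    · rw [Function.update_of_ne h'] at he'
      exact h.tight e' he'
  · have := h.fresh e' (by omega)
    by_cases h' : e' = e
    · subst h'; simp; omega
    · rwa [Function.update_of_ne h']
  · rcases h.side with ⟨h1, h2, h3⟩ | ⟨h1, -⟩
    · refine ⟨left_mem_lefts e, ?_, fun w => ?_⟩
      · have := sum_update M' e (M' e + 1); omega
      · have h4 := deg_update (G := G) M' e (M' e + 1) w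
        have h5 := h3 w
        have h6 := G.left_ne_right e e
        by_cases hl : G.left e = w <;> by_cases hr : G.right e = w <;>
          simp only [hl, hr, or_true, or_false, if_true, if_false] at h4 h5 ⊢
        · exact absurd (hl.trans hr.symm) h6
        all_goals omega
    · exact absurd h1 (right_notMem_lefts e)

theorem Augmenting.backward {mark : ℤ → ℤ} {t : Fin n} {M' : Fin m → ℕ} {e : Fin m}
    (h : Augmenting G c y M mark t (G.left e) M') (hM : 0 < M e)
    (hlt : mark (G.right e : ℕ) < mark (G.left e : ℕ)) :
    0 < M' e ∧ Augmenting G c y M mark t (G.right e) (Function.update M' e (M' e - 1)) := by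
  have hpos : 0 < M' e := hM.trans_le (h.fresh e le_rfl)
  refine ⟨hpos, fun e' he' => ?_, fun e' he' => ?_, Or.inl ?_⟩
  · by_cases h' : e' = e
    · rw [h']; exact h.tight e hpos
    · rw [Function.update_of_ne h'] at he'
      exact h.tight e' he'
  · have := h.fresh e' (by omega)
    by_cases h' : e' = e
    · subst h'; omega
    · rwa [Function.update_of_ne h']
  · rcases h.side with ⟨h1, -⟩ | ⟨h1, h2, h3⟩
    · exact absurd h1 (left_notMem_rights e)
    · refine ⟨right_mem_rights e, ?_, fun w => ?_⟩
      · have := sum_update M' e (M' e - 1); omega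
      · have h4 := deg_update (G := G) M' e (M' e - 1) w
        have h5 := h3 w
        have h6 := G.left_ne_right e e
        by_cases hl : G.left e = w <;> by_cases hr : G.right e = w <;>
          simp only [hl, hr, or_true, or_false, if_true, if_false] at h4 h5 ⊢
        · exact absurd (hl.trans hr.symm) h6
        all_goals omega

theorem Augmenting.le {mark : ℤ → ℤ} {t v : Fin n} {M' : Fin m → ℕ}
    (h : Augmenting G c y M mark t v M') (hsub : ∀ v, G.deg M v ≤ β v) (e : Fin m) :
    M' e ≤ β (G.left e) + 2 := by
  have h1 := le_deg_left (G := G) M' e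
  have h2 := hsub (G.left e)
  rcases h.side with ⟨-, -, h3⟩ | ⟨-, -, h3⟩ <;> have := h3 (G.left e) <;> split_ifs at this <;>
      omega

/-- Augmentation along the parent pointers from the vertex found by the search back to a root. The
arc names tell forward arcs (at most `m`) from backward arcs. -/
def augmentLoop : Program :=
  .assign 19 (.reg 19 - .const 1) ;;
  .loop (.get 11 (.reg 19)) (.assign 22 (.get 11 (.reg 19)) ;;
    .branch ((Expr.reg 22).lt (.reg 1 + .const 1))
      (.assign 21 (.reg 22 - .const 1) ;; .store 5 (.reg 21) (.get 5 (.reg 21) + .const 1) ;;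
        .assign 19 (.get 0 (.reg 21)))
      (.assign 21 (.reg 22 - .const 1 - .reg 1) ;;
        .store 5 (.reg 21) (.get 5 (.reg 21) - .const 1) ;; .assign 19 (.get 1 (.reg 21))))

/-- The marks decrease along the parent pointers, so the loop ends. This also makes the path simple:
an edge that is about to be decreased has not been decreased before (`Augmenting.fresh`). -/
theorem augmentLoop_spec {U : ℕ} {σ : State} {e₀ : Fin m} (H : Holds G c b σ)
    (hM : HoldsM M σ) (hC : G.Compl c β y M) (hS : Searched G c β y M σ)
    (h19 : σ.reg 19 = (G.right e₀ : ℕ) + 1) (hr : G.right e₀ ∈ G.reachSet c β y M)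
    (hd : G.deg M (G.right e₀) < β (G.right e₀)) (hU : 2 * m + n ≤ U) (hβ : ∀ v, β v + 2 ≤ U) :
    HT U augmentLoop σ (3 * m * 6 + 2) fun τ => ∃ M', HoldsM M' τ ∧ G.Compl c β y M' ∧
      ∑ e, M' e = ∑ e, M e + 1 := by
  have hvU : ∀ v : Fin n, Small U ((v : ℕ) : ℤ) := fun v =>
    Small.of_nonneg (by positivity) (by have := v.2; omega)
  have first : HT U (.assign 19 (.reg 19 - .const 1)) σ 1
      fun τ => τ = σ.setReg 19 (G.right e₀ : ℕ) := HT.of_wp _ (by simp [h19, hvU])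
  refine HT.mono (first.seq fun τ₁ _ e₁ => HT.loop (s := 5) (fun k τ =>
      ∃ (v : Fin n) (M' : Fin m → ℕ),
      τ.reg 1 = m ∧ (∀ a, a ≠ 5 → τ.arr a = σ.arr a) ∧
      τ.reg 19 = (v : ℕ) ∧ Inc G v ∧ σ.arr 10 (v : ℕ) ≠ 0 ∧ σ.arr 10 (v : ℕ) ≤ k ∧
      HoldsM M' τ ∧ Augmenting G c y M (σ.arr 10) (G.right e₀) v M') ?_ (3 * m) τ₁ ?_)
      (by omega) ?_
  · rintro k τ ⟨v, M', hm, ha, hv, hinc, hmk, hk, hM', hA⟩ he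
    simp only [Expr.eval_get, Expr.eval_reg, hv, ha 11 (by norm_num)] at he
    rcases hS.parent v hinc hmk with ⟨h1, -⟩ | ⟨q, u, h1, h2, h3, h4⟩
    · exact absurd h1 he
    have hq := h2.le
    have hqU : Small U (q : ℤ) := Small.of_nonneg (by positivity) (by omega)
    have hu := h2.inc.1
    have hu0 := hS.mark_nonneg u hu
    refine HT.mono (HT.of_wp (_ ;; .branch _ _ _) ?_) (s := 5) (by simp) fun _ _ h => h
    rcases h2 with ⟨e, -, rfl, rfl, rfl, ht⟩ | ⟨e, -, rfl, rfl, rfl, hMe⟩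
    · have hA' := hA.forward ht h4
      have hsm := hA'.le hC.sub e
      have hβe := hβ (G.left e)
      rw [Function.update_self] at hsm
      have hlt : (e : ℤ) + 1 < m + 1 := by have := e.2; omega
      push_cast at h1 hqU
      have hs1 : Small U ((e : ℕ) : ℤ) := ⟨by have := hqU.1; omega, by have := hqU.2; omega⟩
      have hs2 : Small U ((M' e : ℤ) + 1) := Small.of_nonneg (by positivity) (by omega)
      simp [hv, ha, h1, hm, hqU, hM' e, H.left, hvU, hs1, hs2]
      refine ⟨(σ.arr 10 (G.left e : ℕ)).toNat, by omega, fun a h => ?_, G.left e, rfl, hu, h3,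
        by omega, Function.update M' e (M' e + 1), ?_, hA'⟩
      · funext x; simp [h, ha a h]
      · intro e'
        by_cases h' : e' = e
        · subst h'; simp
        · have : (e' : ℕ) ≠ e := fun h => h' (Fin.ext h)
          simp [this, h', hM' e']
    · obtain ⟨hpos, hA'⟩ := hA.backward hMe h4
      have hsm := hA.le hC.sub e
      have hβe := hβ (G.left e)
      push_cast at h1 hqU
      have hs1 : Small U ((e : ℕ) : ℤ) := Small.of_nonneg (by positivity)
        (by have := e.2; omega)
      have hs2 : Small U ((M' e : ℤ) - 1) := Small.of_nonneg (by omega) (by omega)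
      have hlt : ¬ ((m : ℤ) + e + 1 < m + 1) := by omega
      have heq : (m : ℤ) + e - m = e := by ring
      simp [hv, ha, h1, hm, hqU, hM' e, H.right, hvU, hs1, hs2, heq]
      refine ⟨(σ.arr 10 (G.right e : ℕ)).toNat, by omega, fun a h => ?_, G.right e, rfl, hu, h3,
        by omega, Function.update M' e (M' e - 1), ?_, hA'⟩
      · funext x; simp [h, ha a h]
      · intro e'
        by_cases h' : e' = e
        · subst h'; simp; omega
        · have : (e' : ℕ) ≠ e := fun h => h' (Fin.ext h)
          simp [this, h', hM' e']
  · rw [e₁]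
    refine ⟨G.right e₀, M, by simp [H.hm], fun _ _ => rfl, by simp, Inc.right _,
      (hS.mark_iff _ (Inc.right _)).2 hr, by exact_mod_cast hS.mark_le _ (Inc.right _), hM,
      hC.tight, fun _ _ => le_rfl, Or.inl ⟨right_mem_rights _, rfl, fun _ => rfl⟩⟩
  · rintro τ - ⟨⟨k, -, v, M', hm, ha, hv, hinc, hmk, hk, hM', hA⟩, he⟩
    simp only [Expr.eval_get, Expr.eval_reg, hv, ha 11 (by norm_num)] at he
    rcases hS.parent v hinc hmk with ⟨-, h1⟩ | ⟨q, u, h1, h2, -⟩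
    · refine ⟨M', hM', ?_⟩
      have hvl : v ∈ G.lefts := mem_lefts.2 h1.1
      rcases hA.side with ⟨h2, -⟩ | ⟨-, h3, h4⟩
      · exact absurd hvl (Finset.disjoint_right.1 lefts_disjoint_rights h2)
      · refine ⟨⟨fun w => ?_, hC.feas, hA.tight⟩, h3⟩
        rw [h4]
        have h5 := hC.sub w
        have h6 := h1.2
        by_cases hw1 : G.right e₀ = w <;> by_cases hw2 : v = w
        · exact absurd (by rw [hw1, ← hw2]; exact hvl) (right_notMem_lefts e₀)
        · subst hw1; simp [hw2]; omega
        · subst hw2; simp [hw1]; omega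
        · simp [hw1, hw2, h5]
    · rw [h1] at he
      have := h2.le
      omega

end Machine

namespace Machine

open BipartiteGraph

variable {n m : ℕ} {G : BipartiteGraph n m} {c : Fin m → ℕ} {b β : Fin n → ℕ}
  {y : Fin n → ℤ} {M : Fin m → ℕ}

/-! ### Dual steps -/

/-- Register 20 becomes the least slack of an edge that leaves the marked set, or 0 if there is
none; no such edge has slack 0. -/
def slackSweep : Program :=
  .assign 20 (.const 0) ;; forEdges (.branch
    ((Expr.const 0).lt (.get 10 eL) * (Expr.get 10 eR).eq (.const 0))
    (.assign 21 (eC - eY eL - eY eR) ;; .branch ((Expr.reg 20).eq (.const 0))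
      (.assign 20 (.reg 21)) (.branch ((Expr.reg 21).lt (.reg 20)) (.assign 20 (.reg 21)) .skip))
    .skip)

theorem slackSweep_spec {U Y : ℕ} {σ : State} (H : Holds G c b σ) (hy : HoldsY y σ)
    (hS : Searched G c β y M σ) (hC : G.Compl c β y M) (hm : m ≤ U)
    (hY : ∀ v, |y v| ≤ Y) (hU : ∀ e, c e + 3 * Y ≤ U) :
    HT U slackSweep σ (m * 7 + 3) fun τ =>
      (τ.reg 20 = 0 ∧ G.Closed (G.reachSet c β y M)) ∨
      (0 < τ.reg 20 ∧ G.IsMinSlack c y (G.reachSet c β y M) (τ.reg 20)) := by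
  set X := G.reachSet c β y M with hX
  have h0 : Small U 0 := Small.of_nonneg le_rfl (by positivity)
  have first : HT U (.assign 20 (.const 0)) σ 1 fun τ => τ = σ.setReg 20 0 :=
    HT.of_wp _ (by simp [h0])
  refine HT.mono (first.seq fun τ₁ _ e₁ => HT.forEdges (m := m) (s := 5) (fun i τ =>
      (τ.reg 20 = 0 ∧ ∀ e : Fin m, (e : ℕ) < i → G.left e ∈ X → G.right e ∈ X) ∨
      (0 < τ.reg 20 ∧ (∃ e, G.left e ∈ X ∧ G.right e ∉ X ∧
        τ.reg 20 = c e - y (G.left e) - y (G.right e)) ∧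
        ∀ e : Fin m, (e : ℕ) < i → G.left e ∈ X → G.right e ∉ X →
          τ.reg 20 ≤ c e - y (G.left e) - y (G.right e)))
    (by rw [e₁]; simp [H.hm]) hm (by simp) (by simp) ?_ ?_ ?_) (by omega) ?_
  · intro i τ z h
    simpa using h
  · left; rw [e₁]; simp
  · intro e τ hi hm1 hS' hI
    have H₁ : Holds G c b τ₁ := by
      rw [e₁]
      exact ⟨by simp [H.hm], H.left, H.right, by simpa using H.cost, by simpa using H.dem⟩
    have hy₁ : HoldsY y τ₁ := by rw [e₁]; simpa [HoldsY] using hy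
    have H' := H₁.same hS' (by constructor <;> simp [forEdges])
    have hy' := hy₁.same hS' (by simp [forEdges]) (by simp [forEdges])
    have h10 : τ.arr 10 = σ.arr 10 := by
      rw [hS'.2 10 (by simp [forEdges]), e₁]; rfl
    have hposl := hS.pos_iff (Inc.left e)
    have hposr : σ.arr 10 (G.right e : ℕ) = 0 ↔ G.right e ∉ X :=
      (not_iff_comm.1 (hS.mark_iff _ (Inc.right e))).symm
    have hfe := hC.feas e
    have hsm : Small U ((c e : ℤ) - y (G.left e) - y (G.right e)) := by
      have h1 := abs_le.1 (hY (G.left e))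
      have h2 := abs_le.1 (hY (G.right e))
      have := hU e
      exact ⟨by omega, by omega⟩
    have hlt : G.left e ∈ X → G.right e ∉ X → 0 < (c e : ℤ) - y (G.left e) - y (G.right e) := by
      intro h1 h2
      by_contra hc
      exact h2 (reach_right_of_tight h1 (by omega))
    have hstep : ∀ {P : Fin m → Prop}, (∀ e' : Fin m, (e' : ℕ) < e → P e') → P e →
        ∀ e' : Fin m, e' ≤ e → P e' := by
      intro P h1 h2 e' he'
      rcases lt_or_eq_of_le he' with hlt | heq
      exacts [h1 e' hlt, heq ▸ h2]
    refine HT.of_wp _ ?_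
    simp [hi, H'.left, H'.right, H'.cost, hy' _, h10, hsm, hposl, hposr]
    rw [← hX]
    refine ⟨fun hr hl => ?_, fun h => ?_⟩
    · have hpos := hlt hl hr
      refine ⟨fun h20 => Or.inr ⟨by omega, ⟨e, hl, hr, rfl⟩, hstep (fun e' he' h1 h2 => ?_)
        fun _ _ => by omega⟩, fun h20 => ?_⟩
      · rcases hI with ⟨-, hI⟩ | ⟨hI, -⟩
        · exact absurd (hI e' he' h1) h2
        · omega
      · rcases hI with ⟨hI, -⟩ | ⟨hI1, hI2, hI3⟩
        · exact absurd hI h20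
        · refine ⟨fun hlt' => Or.inr ⟨by omega, ⟨e, hl, hr, rfl⟩, hstep (fun e' he' h1 h2 => ?_)
            fun _ _ => by omega⟩, fun hle => Or.inr ⟨hI1, hI2, hstep hI3 fun _ _ => hle⟩⟩
          have := hI3 e' he' h1 h2
          omega
    · rcases hI with ⟨h1, h2⟩ | ⟨h1, h2, h3⟩
      · exact Or.inl ⟨h1, hstep h2 fun hl => by_contra fun hr => h hr hl⟩
      · exact Or.inr ⟨h1, h2, hstep h3 fun hl hr => absurd hl (h hr)⟩
  · rintro τ - (⟨h1, h2⟩ | ⟨h1, h2, h3⟩)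
    · exact Or.inl ⟨h1, fun e => h2 e e.2⟩
    · exact Or.inr ⟨h1, h2, fun e => h3 e e.2⟩

/-- The shifted dual vector, in array 13. An array of its own is needed because every endpoint is
visited once for each of its edges. -/
def dualSweep : Program := forEdges
  (.store 13 eL (eY eL + .reg 20 * (Expr.const 0).lt (.get 10 eL)) ;;
    .store 13 eR (eY eR - .reg 20 * (Expr.const 0).lt (.get 10 eR)))

theorem dualSweep_spec {U : ℕ} {δ : ℤ} {σ : State} (H : Holds G c b σ) (hy : HoldsY y σ)
    (hS : Searched G c β y M σ) (hδ : σ.reg 20 = δ) (hm : m ≤ U)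
    (hU : ∀ v, Small U (G.shift (G.reachSet c β y M) δ y v)) :
    HT U dualSweep σ (m * 4 + 2) fun τ => ∀ v, Inc G v →
      τ.arr 13 (v : ℕ) = G.shift (G.reachSet c β y M) δ y v := by
  refine HT.mono (HT.forEdges (s := 2) (fun i τ => Upto G i fun v =>
      τ.arr 13 (v : ℕ) = G.shift (G.reachSet c β y M) δ y v)
    H.hm hm (by simp) (by simp) (fun _ _ _ h => h) Upto.zero ?_) le_rfl
    fun τ _ h v hv => h.inc hv
  intro e τ hi _ hS' hI
  have H' := H.same hS' (by constructor <;> simp [forEdges])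
  have hy' := hy.same hS' (by simp [forEdges]) (by simp [forEdges])
  have h20 : τ.reg 20 = δ := (hS'.1 20 (by simp [forEdges])).trans hδ
  have h10 : τ.arr 10 = σ.arr 10 := hS'.2 10 (by simp [forEdges])
  have hl : y (G.left e) + (if 0 < σ.arr 10 (G.left e : ℕ) then δ else 0) =
      G.shift (G.reachSet c β y M) δ y (G.left e) := by
    simp only [hS.pos_iff (Inc.left e), shift, left_mem_lefts, if_true]
    split_ifs <;> simp
  have hr : y (G.right e) - (if 0 < σ.arr 10 (G.right e : ℕ) then δ else 0) =
      G.shift (G.reachSet c β y M) δ y (G.right e) := by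
    simp only [hS.pos_iff (Inc.right e), shift, right_mem_rights, right_notMem_lefts, if_true,
      if_false]
    split_ifs <;> simp
  refine HT.of_wp _ ?_
  simp [hi, H'.left, H'.right, hy' _, h20, h10, hl, hr, hU]
  refine hI.succ (fun v h => ?_) ?_ ?_
  all_goals grind

/-- Replacement of the dual values of all endpoints of edges by the new values in array 13. -/
def copySweep : Program := forEdges
  (.store 4 (.reg 13 + eL) (.get 13 eL) ;; .store 4 (.reg 13 + eR) (.get 13 eR))

/-- Outside the part for the current dual vector, array 4 is unchanged. -/
def Frame (n : ℕ) (σ τ : State) : Prop :=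
  ∀ x, (x < σ.reg 13 ∨ σ.reg 13 + n ≤ x) → τ.arr 4 x = σ.arr 4 x

theorem copySweep_spec {U : ℕ} {y' : Fin n → ℤ} {σ : State} (H : Holds G c b σ)
    (hy : HoldsY y σ) (h13 : ∀ v, Inc G v → σ.arr 13 (v : ℕ) = y' v)
    (hn : ∀ v, ¬ Inc G v → y' v = y v) (hm : m ≤ U) (hU : ∀ v, Small U (y' v)) :
    HT U copySweep σ (m * 4 + 2) fun τ => HoldsY y' τ ∧ Frame n σ τ := by
  refine HT.mono (HT.forEdges (s := 2) (fun i τ => (Upto G i fun v =>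
      τ.arr 4 (σ.reg 13 + (v : ℕ)) = y' v) ∧ (∀ v, ¬ Inc G v → τ.arr 4 (σ.reg 13 + (v : ℕ)) = y v) ∧
      Frame n σ τ)
    H.hm hm (by simp) (by simp) (fun _ _ _ h => h) ⟨Upto.zero, fun v _ => hy v, fun _ _ => rfl⟩ ?_)
    le_rfl ?_
  · intro e τ hi _ hS' ⟨hI, hI2, hI3⟩
    have H' := H.same hS' (by constructor <;> simp [forEdges])
    have hr13 : τ.reg 13 = σ.reg 13 := hS'.1 13 (by simp [forEdges])
    have ha : τ.arr 13 = σ.arr 13 := hS'.2 13 (by simp [forEdges])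
    refine HT.of_wp _ ?_
    simp [hi, H'.left, H'.right, hr13, ha, h13 _ (Inc.left e), h13 _ (Inc.right e), hU]
    have hl := (G.left e).2
    have hr := (G.right e).2
    refine ⟨hI.succ (fun v h => ?_) ?_ ?_, fun v hv => ?_, fun x hx => ?_⟩
    iterate 3 grind
    · have h1 : ¬ (v : ℕ) = G.left e := fun h => hv (Fin.ext h ▸ Inc.left e)
      have h2 : ¬ (v : ℕ) = G.right e := fun h => hv (Fin.ext h ▸ Inc.right e)
      simp [h1, h2, hI2 v hv]
    · have := hI3 x hx
      rw [← this, State.arr_setArr, if_neg (by omega), State.arr_setArr, if_neg (by omega)]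
  · rintro τ hS' ⟨h1, h2, h3⟩
    refine ⟨fun v => ?_, h3⟩
    rw [hS'.1 13 (by simp [copySweep, forEdges])]
    by_cases hv : Inc G v
    · exact h1.inc hv
    · rw [h2 v hv, hn v hv]

/-! ### One step of the primal-dual algorithm -/

/-- Search, followed by an augmentation, a dual step, or the end of the phase. -/
def step : Program :=
  initSweep ;; excessSweep ;; adjSweep ;; rootSweep ;; searchLoop ;; foundSweep ;;
  .branch (.reg 19) augmentLoop
    (slackSweep ;; .branch (.reg 14 + (Expr.reg 20).eq (.const 0)) (.assign 15 (.const 1))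
      (dualSweep ;; copySweep))

/-- The state after a step: either the matching has been augmented, or there is no augmenting path
and a dual step has been made, or there is no augmenting path and the phase ends, because dual
steps are forbidden or impossible. -/
def StepPost (G : BipartiteGraph n m) (c : Fin m → ℕ) (β : Fin n → ℕ) (y : Fin n → ℤ)
    (M : Fin m → ℕ) (σ τ : State) : Prop :=
  (∃ M', HoldsM M' τ ∧ HoldsY y τ ∧ G.Compl c β y M' ∧ ∑ e, M' e = ∑ e, M e + 1 ∧
    τ.reg 15 = σ.reg 15) ∨
  (HoldsM M τ ∧ HoldsY y τ ∧ G.Stuck c β y M ∧ (σ.reg 14 ≠ 0 ∨ G.Closed (G.reachSet c β y M)) ∧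
    τ.reg 15 = 1) ∨
  (∃ δ, HoldsM M τ ∧ HoldsY (G.shift (G.reachSet c β y M) δ y) τ ∧ G.Stuck c β y M ∧
    σ.reg 14 = 0 ∧ G.IsMinSlack c y (G.reachSet c β y M) δ ∧ τ.reg 15 = σ.reg 15)

theorem Frame.of_same {p : Program} {σ τ : State} (hS : Same p σ τ) (h4 : ¬ p.modArr 4) :
    Frame n σ τ := fun x _ => by rw [hS.2 4 h4]

theorem abs_shift_le {X : Finset (Fin n)} {δ : ℤ} {Y : ℕ} (hY : ∀ v, |y v| ≤ Y) (hδ : 0 ≤ δ)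
    (v : Fin n) : |G.shift X δ y v| ≤ Y + δ := by
  have := abs_le.1 (hY v)
  unfold shift
  split_ifs <;> rw [abs_le] <;> constructor <;> omega

theorem isMinSlack_le {X : Finset (Fin n)} {δ : ℤ} {Y : ℕ} (h : G.IsMinSlack c y X δ)
    (hY : ∀ v, |y v| ≤ Y) : ∃ e, δ ≤ c e + 2 * Y := by
  obtain ⟨⟨e, -, -, rfl⟩, -⟩ := h
  have h1 := abs_le.1 (hY (G.left e))
  have h2 := abs_le.1 (hY (G.right e))
  exact ⟨e, by omega⟩

theorem shift_of_not_inc {X : Finset (Fin n)} {δ : ℤ} {v : Fin n} (hv : ¬ Inc G v) :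
    G.shift X δ y v = y v := by
  have h1 : v ∉ G.lefts := fun h => hv ⟨(mem_lefts.1 h).choose, Or.inl (mem_lefts.1 h).choose_spec⟩
  have h2 : v ∉ G.rights := fun h =>
    hv ⟨(mem_rights.1 h).choose, Or.inr (mem_rights.1 h).choose_spec⟩
  simp [shift, h1, h2]

/-- A step takes time `O(m)`, since every vertex that is touched is an endpoint of an edge. -/
theorem step_spec {U D Y : ℕ} {σ : State} (H : Holds G c b σ) (hy : HoldsY y σ) (hM : HoldsM M σ)
    (hD : σ.reg 11 = D) (hβ : ∀ v, β v = b v / D) (hC : G.Compl c β y M) (hflag : 0 ≤ σ.reg 14)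
    (hm : 3 * m + n + 1 ≤ U) (hb : ∀ v, b v + 2 ≤ U) (hY : ∀ v, |y v| ≤ Y)
    (hU : ∀ e, c e + 3 * Y ≤ U) (m1 : 1 ≤ m) :
    HT U step σ (m * 150) fun τ => Frame n σ τ ∧ StepPost G c β y M σ τ := by
  have hβb : ∀ v, β v ≤ b v := fun v => hβ v ▸ Nat.div_le_self _ _
  refine HT.mono (s := (m * 8 + 2) + ((m * 4 + 2) + ((m * 10 + 2) + ((m * 8 + 5) +
    ((5 * m * 11 + 1) + ((m * 4 + 3) + (1 + (3 * m * 6 + 3 +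
    (m * 7 + 3 + (1 + (m * 4 + 2 + (m * 4 + 2))))))))))))
    (Q := fun τ => Frame n σ τ ∧ StepPost G c β y M σ τ) ?_ (by omega) fun _ _ h => h
  refine (initSweep_spec H hD (by omega) fun v => by have := hb v; omega).seq
    fun τ₁ S₁ h₁ => ?_
  have H₁ := H.same S₁ (by constructor <;> simp [initSweep, forEdges])
  have hM₁ := hM.same S₁ (by simp [initSweep, forEdges])
  have hy₁ := hy.same S₁ (by simp [initSweep, forEdges]) (by simp [initSweep, forEdges])
  refine (excessSweep_spec (β := β) H₁ hM₁ (by omega)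
    (fun v => by have := hβb v; have := hb v; omega) hC.sub
    fun v hv => by rw [hβ]; exact (h₁ v hv).1).seq fun τ₂ S₂ h₂ => ?_
  have H₂ := H₁.same S₂ (by constructor <;> simp [excessSweep, forEdges])
  have hM₂ := hM₁.same S₂ (by simp [excessSweep, forEdges])
  have hy₂ := hy₁.same S₂ (by simp [excessSweep, forEdges]) (by simp [excessSweep, forEdges])
  refine (adjSweep_spec H₂ hy₂ hM₂ (U := U) (by omega) (by omega) fun v hv => by
    rw [S₂.2 7 (by simp [excessSweep, forEdges])]; exact (h₁ v hv).2.1).seq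
    fun τ₃ S₃ ⟨adj, h₃⟩ => ?_
  have H₃ := H₂.same S₃ (by constructor <;> simp [adjSweep, forwardArc, backwardArc, forEdges])
  have hM₃ := hM₂.same S₃ (by simp [adjSweep, forwardArc, backwardArc, forEdges])
  have hy₃ := hy₂.same S₃ (by simp [adjSweep, forwardArc, backwardArc, forEdges])
    (by simp [adjSweep, forwardArc, backwardArc, forEdges])
  have h6₃ : ∀ v, Inc G v → τ₃.arr 6 (v : ℕ) = (β v : ℤ) - G.deg M v := fun v hv => by
    rw [S₃.2 6 (by simp [adjSweep, forwardArc, backwardArc, forEdges])]; exact h₂ v hv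
  refine (rootSweep_spec (β := β) (U := U) H₃ h₃ h6₃ (fun v hv => by
    rw [S₃.2 10 (by simp [adjSweep, forwardArc, backwardArc, forEdges]),
      S₂.2 10 (by simp [excessSweep, forEdges])]
    exact (h₁ v hv).2.2) (by omega)).seq fun τ₄ S₄ ⟨pend, s, k, h₄, hk, hr⟩ => ?_
  have H₄ := H₃.same S₄ (by constructor <;> simp [rootSweep, pushCode, forEdges])
  have hM₄ := hM₃.same S₄ (by simp [rootSweep, pushCode, forEdges])
  have hy₄ := hy₃.same S₄ (by simp [rootSweep, pushCode, forEdges])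
    (by simp [rootSweep, pushCode, forEdges])
  refine (searchLoop_spec (U := U) h₄ hk hr (by omega) (by omega)).seq fun τ₅ S₅ h₅ => ?_
  have H₅ := H₄.same S₅ (by constructor <;> simp [searchLoop, pushCode])
  have hM₅ := hM₄.same S₅ (by simp [searchLoop, pushCode])
  have hy₅ := hy₄.same S₅ (by simp [searchLoop, pushCode]) (by simp [searchLoop, pushCode])
  have h6₅ : ∀ v, Inc G v → τ₅.arr 6 (v : ℕ) = (β v : ℤ) - G.deg M v := fun v hv => by
    rw [S₅.2 6 (by simp [searchLoop, pushCode]), S₄.2 6 (by simp [rootSweep, pushCode, forEdges])]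
    exact h6₃ v hv
  refine (foundSweep_spec (U := U) H₅ h₅ h6₅ hC.sub (by omega) (by omega)).seq fun τ₆ S₆ h₆ => ?_
  have H₆ := H₅.same S₆ (by constructor <;> simp [foundSweep, forEdges])
  have hM₆ := hM₅.same S₆ (by simp [foundSweep, forEdges])
  have hy₆ := hy₅.same S₆ (by simp [foundSweep, forEdges]) (by simp [foundSweep, forEdges])
  have h10 : τ₆.arr 10 = τ₅.arr 10 := S₆.2 10 (by simp [foundSweep, forEdges])
  have hS₆ : Searched G c β y M τ₆ := by
    have h11 : τ₆.arr 11 = τ₅.arr 11 := S₆.2 11 (by simp [foundSweep, forEdges])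
    exact ⟨by rw [h10]; exact h₅.mark_iff, by rw [h10]; exact h₅.mark_nonneg,
      by rw [h10]; exact h₅.mark_le, by rw [h10, h11]; exact h₅.parent⟩
  have hreg : ∀ r, 13 ≤ r → r ≤ 15 → τ₆.reg r = σ.reg r := fun r h1 h2 => by
    rw [S₆.1 r (by simp [foundSweep, forEdges]; omega),
      S₅.1 r (by simp [searchLoop, pushCode]; omega),
      S₄.1 r (by simp [rootSweep, pushCode, forEdges]; omega),
      S₃.1 r (by simp [adjSweep, forwardArc, backwardArc, forEdges]; omega),
      S₂.1 r (by simp [excessSweep, forEdges]; omega),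
      S₁.1 r (by simp [initSweep, forEdges]; omega)]
  have ha4 : τ₆.arr 4 = σ.arr 4 := by
    rw [S₆.2 4 (by simp [foundSweep, forEdges]), S₅.2 4 (by simp [searchLoop, pushCode]),
      S₄.2 4 (by simp [rootSweep, pushCode, forEdges]),
      S₃.2 4 (by simp [adjSweep, forwardArc, backwardArc, forEdges]),
      S₂.2 4 (by simp [excessSweep, forEdges]), S₁.2 4 (by simp [initSweep, forEdges])]
  have hF : ∀ τ, Frame n τ₆ τ → Frame n σ τ := fun τ h x hx => by
    rw [h x (by rwa [hreg 13 (by norm_num) (by norm_num)]), ha4]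
  refine HT.branch (fun he => ?_) fun he => ?_
  · rcases h₆ with ⟨h, -⟩ | ⟨e₀, h19, hr₀, hd⟩
    · exact absurd h he
    refine (augmentLoop_spec (U := U) (β := β) H₆ hM₆ hC hS₆ h19 hr₀ hd (by omega)
      fun v => by have := hβb v; have := hb v; omega).mono (by omega) ?_
    rintro τ Sτ ⟨M', h1, h2, h3⟩
    refine ⟨hF τ (Frame.of_same Sτ (by simp [augmentLoop])), Or.inl ⟨M', h1, ?_, h2, h3, ?_⟩⟩
    · exact hy₆.same Sτ (by simp [augmentLoop]) (by simp [augmentLoop])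
    · rw [Sτ.1 15 (by simp [augmentLoop]), hreg 15 (by norm_num) (by norm_num)]
  · rcases h₆ with ⟨-, hst⟩ | ⟨e₀, h19, -⟩
    swap
    · simp only [Expr.eval_reg] at he; omega
    refine HT.mono ((slackSweep_spec (U := U) (Y := Y) H₆ hy₆ hS₆ hC (by omega) hY hU).seq
      (Q := fun τ => Frame n σ τ ∧ StepPost G c β y M σ τ)
      (s₂ := 1 + (m * 4 + 2 + (m * 4 + 2))) fun τ₇ S₇ h₇ => ?_) (by omega) fun _ _ h => h
    have H₇ := H₆.same S₇ (by constructor <;> simp [slackSweep, forEdges])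
    have hM₇ := hM₆.same S₇ (by simp [slackSweep, forEdges])
    have hy₇ := hy₆.same S₇ (by simp [slackSweep, forEdges]) (by simp [slackSweep, forEdges])
    have hreg₇ : ∀ r, 13 ≤ r → r ≤ 15 → τ₇.reg r = σ.reg r := fun r h1 h2 => by
      rw [S₇.1 r (by simp [slackSweep, forEdges]; omega), hreg r h1 h2]
    have ha4₇ : τ₇.arr 4 = σ.arr 4 := by rw [S₇.2 4 (by simp [slackSweep, forEdges]), ha4]
    have hF₇ : ∀ τ, Frame n τ₇ τ → Frame n σ τ := fun τ h x hx => by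
      rw [h x (by rwa [hreg₇ 13 (by norm_num) (by norm_num)]), ha4₇]
    have h14 := hreg₇ 14 (by norm_num) (by norm_num)
    have hS₇ : Searched G c β y M τ₇ := by
      have h10 : τ₇.arr 10 = τ₆.arr 10 := S₇.2 10 (by simp [slackSweep, forEdges])
      have h11 : τ₇.arr 11 = τ₆.arr 11 := S₇.2 11 (by simp [slackSweep, forEdges])
      exact ⟨by rw [h10]; exact hS₆.mark_iff, by rw [h10]; exact hS₆.mark_nonneg,
        by rw [h10]; exact hS₆.mark_le, by rw [h10, h11]; exact hS₆.parent⟩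
    refine HT.branch (fun he' => ?_) fun he' => ?_
    · have h1 : Small U 1 := Small.of_nonneg (by norm_num) (by omega)
      refine (HT.of_wp (.assign 15 (.const 1)) (Q := fun τ => τ = τ₇.setReg 15 1)
        (by simp [h1])).mono (by simp; omega) ?_
      rintro τ Sτ rfl
      refine ⟨hF₇ _ fun _ _ => rfl, Or.inr (Or.inl ⟨hM₇, by simpa [HoldsY] using hy₇, hst, ?_,
        by simp⟩)⟩
      rcases h₇ with ⟨-, h₇⟩ | ⟨h₇, -⟩
      · exact Or.inr h₇
      · left
        intro h0
        simp [h14, h0, h₇.ne'] at he'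
    · simp only [Expr.eval_add, Expr.eval_reg, Expr.eval_eq, Expr.eval_const, h14] at he'
      have hne : τ₇.reg 20 ≠ 0 := fun h => by omega
      rcases h₇ with ⟨h, -⟩ | ⟨hpos, hδ⟩
      · exact absurd h hne
      obtain ⟨e₁, hle⟩ := isMinSlack_le hδ hY
      have hsm : ∀ v, Small U (G.shift (G.reachSet c β y M) (τ₇.reg 20) y v) := fun v => by
        have h1 := abs_le.1 (abs_shift_le (G := G) (X := G.reachSet c β y M) hY hpos.le v)
        have := hU e₁
        exact ⟨by omega, by omega⟩
      refine (dualSweep_spec (U := U) H₇ hy₇ hS₇ rfl (by omega) hsm).seq fun τ₈ S₈ h₈ => ?_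
      have H₈ := H₇.same S₈ (by constructor <;> simp [dualSweep, forEdges])
      have hM₈ := hM₇.same S₈ (by simp [dualSweep, forEdges])
      have hy₈ := hy₇.same S₈ (by simp [dualSweep, forEdges]) (by simp [dualSweep, forEdges])
      have hreg₈ : ∀ r, 13 ≤ r → r ≤ 15 → τ₈.reg r = σ.reg r := fun r h1 h2 => by
        rw [S₈.1 r (by simp [dualSweep, forEdges]; omega), hreg₇ r h1 h2]
      refine (copySweep_spec (U := U) H₈ hy₈ h₈ (fun v hv => shift_of_not_inc hv) (by omega)
        hsm).mono le_rfl ?_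
      rintro τ Sτ ⟨h1, h2⟩
      refine ⟨hF₇ τ fun x hx => ?_, Or.inr (Or.inr ⟨τ₇.reg 20,
        hM₈.same Sτ (by simp [copySweep, forEdges]), h1, hst, by omega, hδ, ?_⟩)⟩
      · rw [h2 x (by rwa [hreg₈ 13 (by norm_num) (by norm_num),
          ← hreg₇ 13 (by norm_num) (by norm_num)]), S₈.2 4 (by simp [dualSweep, forEdges])]
      · rw [Sτ.1 15 (by simp [copySweep, forEdges]), hreg₈ 15 (by norm_num) (by norm_num)]

end Machine

namespace Machine

open BipartiteGraph

variable {n m : ℕ} {G : BipartiteGraph n m} {c : Fin m → ℕ} {b β : Fin n → ℕ}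
  {y : Fin n → ℤ} {M : Fin m → ℕ}

/-! ### Phases and demand scaling -/

/-- Steps are made until register 15 signals the end of the phase. -/
def phase : Program := .assign 15 (.const 0) ;; .loop ((Expr.reg 15).eq (.const 0)) step

theorem keeps_step : Keeps step := by
  constructor <;> simp [step, initSweep, excessSweep, adjSweep, rootSweep, searchLoop, foundSweep,
    augmentLoop, slackSweep, dualSweep, copySweep, forEdges, pushCode, forwardArc, backwardArc]

theorem step_modReg {r : ℕ} (h : r = 11 ∨ r = 14) : ¬ step.modReg r := by
  rcases h with rfl | rfl <;>
  simp [step, initSweep, excessSweep, adjSweep, rootSweep, searchLoop, foundSweep,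
    augmentLoop, slackSweep, dualSweep, copySweep, forEdges, pushCode, forwardArc, backwardArc]

theorem Frame.trans {σ τ υ : State} (h : Frame n σ τ) (h' : Frame n τ υ)
    (h13 : τ.reg 13 = σ.reg 13) : Frame n σ υ := fun x hx => by
  rw [h' x (by rwa [h13]), h x hx]

/-- The course of a phase, for an invariant `J` of the matching and the dual vector whose last
argument bounds the number of remaining augmentations and dual steps. -/
theorem phase_spec {U D Y : ℕ} {σ : State} {ψ : ℕ} {J : (Fin m → ℕ) → (Fin n → ℤ) → ℕ → Prop}
    (H : Holds G c b σ) (hy : HoldsY y σ) (hM : HoldsM M σ) (hD : σ.reg 11 = D)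
    (hβ : ∀ v, β v = b v / D) (hC : G.Compl c β y M) (hflag : 0 ≤ σ.reg 14)
    (hm : 3 * m + n + 1 ≤ U) (hb : ∀ v, b v + 2 ≤ U) (hU : ∀ e, c e + 3 * Y ≤ U) (m1 : 1 ≤ m)
    (hJ : J M y ψ) (hJY : ∀ M y ψ, J M y ψ → ∀ v, |y v| ≤ Y)
    (haug : ∀ M M' y ψ, J M y ψ → G.Compl c β y M → G.Compl c β y M' →
      ∑ e, M' e = ∑ e, M e + 1 → ∃ ψ' < ψ, J M' y ψ')
    (hdual : σ.reg 14 = 0 → ∀ M y ψ δ, J M y ψ → G.Compl c β y M → G.Stuck c β y M →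
      G.IsMinSlack c y (G.reachSet c β y M) δ →
      ∃ ψ' < ψ, J M (G.shift (G.reachSet c β y M) δ y) ψ') :
    HT U phase σ ((ψ + 2) * (m * 151)) fun τ => Frame n σ τ ∧ ∃ M y ψ', HoldsM M τ ∧ HoldsY y τ ∧
      G.Compl c β y M ∧ J M y ψ' ∧ G.Stuck c β y M ∧
      (σ.reg 14 ≠ 0 ∨ G.Closed (G.reachSet c β y M)) := by
  have h0 : Small U 0 := Small.of_nonneg le_rfl (by positivity)
  have first : HT U (.assign 15 (.const 0)) σ 1 fun τ => τ = σ.setReg 15 0 :=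
    HT.of_wp _ (by simp [h0])
  refine HT.mono (first.seq fun τ₁ _ e₁ => HT.loop (s := m * 150) (fun k τ =>
      Holds G c b τ ∧ τ.reg 11 = D ∧ τ.reg 13 = σ.reg 13 ∧ τ.reg 14 = σ.reg 14 ∧ Frame n σ τ ∧
      ∃ M y ψ', HoldsM M τ ∧ HoldsY y τ ∧ G.Compl c β y M ∧ J M y ψ' ∧
        ((τ.reg 15 = 0 ∧ ψ' + 1 ≤ k) ∨ (τ.reg 15 = 1 ∧ G.Stuck c β y M ∧
          (σ.reg 14 ≠ 0 ∨ G.Closed (G.reachSet c β y M))))) ?_ (ψ + 1) τ₁ ?_)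
      (by nlinarith) ?_
  · rintro k τ ⟨H', h11, h13, h14, hF, M', y', ψ', hM', hy', hC', hJ', hcase⟩ he
    have h15 : τ.reg 15 = 0 := by
      by_contra hc
      simp [hc] at he
    rcases hcase with ⟨-, hk⟩ | ⟨h1, -⟩
    swap
    · omega
    refine (step_spec (U := U) (Y := Y) H' hy' hM' h11 hβ hC' (by omega) hm hb
      (hJY _ _ _ hJ') hU m1).mono le_rfl ?_
    rintro τ' S ⟨hF', hpost⟩
    have key : ∀ M'' y'' ψ'', HoldsM M'' τ' → HoldsY y'' τ' → G.Compl c β y'' M'' → J M'' y'' ψ'' →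
        ((τ'.reg 15 = 0 ∧ ψ'' + 1 ≤ k - 1) ∨ (τ'.reg 15 = 1 ∧ G.Stuck c β y'' M'' ∧
          (σ.reg 14 ≠ 0 ∨ G.Closed (G.reachSet c β y'' M'')))) → _ :=
              fun M'' y'' ψ'' h1 h2 h3 h4 h5 =>
      (show ∃ k' < k, Holds G c b τ' ∧ τ'.reg 11 = D ∧ τ'.reg 13 = σ.reg 13 ∧
        τ'.reg 14 = σ.reg 14 ∧ Frame n σ τ' ∧
      ∃ M y ψ', HoldsM M τ' ∧ HoldsY y τ' ∧ G.Compl c β y M ∧ J M y ψ' ∧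
        ((τ'.reg 15 = 0 ∧ ψ' + 1 ≤ k') ∨ (τ'.reg 15 = 1 ∧ G.Stuck c β y M ∧
          (σ.reg 14 ≠ 0 ∨ G.Closed (G.reachSet c β y M)))) from
      ⟨k - 1, by omega, H'.same S keeps_step, (S.1 11 (step_modReg (Or.inl rfl))).trans h11,
        (S.1 13 keeps_step.r13).trans h13, (S.1 14 (step_modReg (Or.inr rfl))).trans h14,
        hF.trans hF' h13, M'', y'', ψ'', h1, h2, h3, h4, h5⟩)
    rcases hpost with ⟨M'', h1, h2, h3, h4, h5⟩ | ⟨h1, h2, h3, h4, h5⟩ | ⟨δ, h1, h2, h3, h4, h5, h6⟩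
    · obtain ⟨ψ'', hlt, hJ''⟩ := haug M' M'' y' ψ' hJ' hC' h3 h4
      exact key M'' y' ψ'' h1 h2 h3 hJ'' (Or.inl ⟨h5.trans h15, by omega⟩)
    · exact key M' y' ψ' h1 h2 hC' hJ' (Or.inr ⟨h5, h3, h14 ▸ h4⟩)
    · obtain ⟨ψ'', hlt, hJ''⟩ := hdual (h14 ▸ h4) M' y' ψ' δ hJ' hC' h3 h5
      exact key M' _ ψ'' h1 h2 (hC'.shift h5).2 hJ'' (Or.inl ⟨h6.trans h15, by omega⟩)
  · rw [e₁]
    refine ⟨⟨by simp [H.hm], H.left, H.right, by simpa using H.cost, by simpa using H.dem⟩,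
      by simp [hD], by simp, by simp, fun _ _ => rfl, M, y, ψ, hM, by simpa [HoldsY] using hy, hC,
          hJ,
      Or.inl ⟨by simp, le_rfl⟩⟩
  · rintro τ - ⟨⟨k, -, -, -, -, -, hF, M', y', ψ', hM', hy', hC', hJ', hcase⟩, he⟩
    rcases hcase with ⟨h1, -⟩ | ⟨-, h1, h2⟩
    · simp [h1] at he
    · exact ⟨hF, M', y', ψ', hM', hy', hC', hJ', h1, h2⟩

/-- The largest demand of an endpoint of an edge. -/
def maxDem (G : BipartiteGraph n m) (b : Fin n → ℕ) : ℕ :=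
  Finset.univ.sup fun e => max (b (G.left e)) (b (G.right e))

theorem le_maxDem {v : Fin n} (hv : Inc G v) : b v ≤ maxDem G b := by
  obtain ⟨e, rfl | rfl⟩ := hv
  · exact (le_max_left _ _).trans
      (Finset.le_sup (f := fun e => max (b (G.left e)) (b (G.right e))) (Finset.mem_univ e))
  · exact (le_max_right _ _).trans
      (Finset.le_sup (f := fun e => max (b (G.left e)) (b (G.right e))) (Finset.mem_univ e))

theorem maxDem_le {U : ℕ} (h : ∀ v, b v ≤ U) : maxDem G b ≤ U :=
  Finset.sup_le fun _ _ => max_le (h _) (h _)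

/-- The empty matching, and the least power of 2 above all demands in register 11. -/
def scaleInit : Program :=
  .assign 22 (.const 0) ;;
  forEdges (.store 5 eI (.const 0) ;;
    .branch ((Expr.reg 22).lt (eB eL)) (.assign 22 (eB eL)) .skip ;;
    .branch ((Expr.reg 22).lt (eB eR)) (.assign 22 (eB eR)) .skip) ;;
  .assign 11 (.const 1) ;;
  .loop (.const 1 - (Expr.reg 22).lt (.reg 11)) (.assign 11 (.reg 11 + .reg 11))

theorem scaleInit_spec {U : ℕ} {σ : State} (H : Holds G c b σ) (hm : m ≤ U) (hb : ∀ v, b v ≤ U)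
    (hU : 1 ≤ U) (hb2 : 2 * maxDem G b ≤ U) :
    HT U scaleInit σ (m * 7 + 5 + 2 * (maxDem G b).size) fun τ =>
      HoldsM (fun _ : Fin m => 0) τ ∧ τ.reg 11 = (2 ^ (maxDem G b).size : ℕ) := by
  set B := maxDem G b with hB
  have h0 : Small U 0 := Small.of_nonneg le_rfl (by positivity)
  have h1 : Small U 1 := Small.of_nonneg (by norm_num) (by omega)
  have hbs : ∀ v, Small U (b v : ℤ) := fun v =>
    Small.of_nonneg (by positivity) (by exact_mod_cast hb v)
  have first : HT U (.assign 22 (.const 0)) σ 1 fun τ => τ = σ.setReg 22 0 :=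
    HT.of_wp _ (by simp [h0])
  have third : ∀ σ, HT U (.assign 11 (.const 1)) σ 1 fun τ => τ = σ.setReg 11 1 :=
    fun σ => HT.of_wp _ (by simp [h1])
  refine HT.mono (s := 1 + ((m * 7 + 2) + (1 + (B.size * 2 + 1)))) (first.seq fun τ₁ _ e₁ =>
    (HT.forEdges (m := m) (s := 5) (fun i τ =>
      (∀ e : Fin m, (e : ℕ) < i → τ.arr 5 (e : ℕ) = 0) ∧ 0 ≤ τ.reg 22 ∧ τ.reg 22 ≤ B ∧
      Upto G i fun v => (b v : ℤ) ≤ τ.reg 22)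
    (by rw [e₁]; simp [H.hm]) hm (by simp) (by simp) ?_ ?_ ?_).seq
      fun τ₂ _ h₂ => (third τ₂).seq fun τ₃ _ e₃ => HT.loop (s := 1) (fun k τ =>
        HoldsM (fun _ : Fin m => 0) τ ∧ τ.reg 22 = B ∧
        ∃ j, j + k = B.size ∧ τ.reg 11 = (2 ^ j : ℕ)) ?_ B.size τ₃ ?_) (by omega) ?_
  · rintro i τ z ⟨h1, h2, h3, h4⟩
    exact ⟨h1, by simpa using h2, by simpa using h3, by simpa using h4⟩
  · rw [e₁]; exact ⟨by simp, by simp, by simp, Upto.zero⟩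
  · rintro e τ hi hm1 hS' ⟨hI1, hI2, hI3, hI4⟩
    have H₁ : Holds G c b τ₁ := by
      rw [e₁]
      exact ⟨by simp [H.hm], H.left, H.right, by simpa using H.cost, by simpa using H.dem⟩
    have H' := H₁.same hS' (by constructor <;> simp [forEdges])
    have hl : b (G.left e) ≤ B := le_maxDem (Inc.left e)
    have hr : b (G.right e) ≤ B := le_maxDem (Inc.right e)
    have hlast : ∀ e' : Fin m, e' ≤ e → ¬ (e' : ℕ) = e → τ.arr 5 (e' : ℕ) = 0 := fun e' h h' =>
      hI1 e' (lt_of_le_of_ne h h')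
    refine HT.of_wp _ ?_
    simp [hi, H'.left, H'.right, H'.dem, hbs, h0]
    refine ⟨fun h1 => ⟨fun h2 => ⟨hlast, by omega, hI4.succ (fun v hv => ?_) ?_ ?_⟩,
      fun h2 => ⟨hlast, by omega, hI4.succ (fun v hv => ?_) ?_ ?_⟩⟩,
      fun h1 => ⟨fun h2 => ⟨hlast, by omega, hI4.succ (fun v hv => ?_) ?_ ?_⟩,
      fun h2 => ⟨hlast, by omega, by omega, hI4.succ (fun v hv => ?_) ?_ ?_⟩⟩⟩
    all_goals try simp
    all_goals omega
  · rintro k τ ⟨h1, h2, j, h3, h4⟩ he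
    have hle : 2 ^ j ≤ B := by
      by_contra hc
      rw [Expr.eval_sub, Expr.eval_lt, Expr.eval_reg, Expr.eval_reg, h2, h4,
        if_pos (by exact_mod_cast (not_le.1 hc))] at he
      simp at he
    have hj : j < B.size := Nat.lt_size.2 hle
    have hsm : Small U ((2 : ℤ) ^ j + 2 ^ j) :=
      Small.of_nonneg (by positivity) (by
        have : ((2 ^ j : ℕ) : ℤ) ≤ B := by exact_mod_cast hle
        push_cast at this
        omega)
    refine HT.of_wp (.assign _ _) ?_
    simp [h4, hsm]
    refine ⟨k - 1, by omega, h1, h2, j + 1, by omega, by ring⟩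
  · obtain ⟨h1, h2, h3, h4⟩ := h₂
    rw [e₃]
    refine ⟨fun e => by simpa using h1 e e.2, ?_, 0, by omega, by simp⟩
    simp only [State.reg_setReg, if_neg (show (22 : ℕ) ≠ 11 by norm_num)]
    refine le_antisymm h3 ?_
    have : B ≤ (τ₂.reg 22).toNat := Finset.sup_le fun e _ => max_le
      (by have := (h4 e e.2).1; omega) (by have := (h4 e e.2).2; omega)
    omega
  · rintro τ - ⟨⟨k, -, h1, h2, j, h3, h4⟩, he⟩
    refine ⟨h1, ?_⟩
    have hlt : B < 2 ^ j := by
      by_contra hc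
      rw [Expr.eval_sub, Expr.eval_lt, Expr.eval_reg, Expr.eval_reg, h2, h4] at he
      rw [if_neg (by exact_mod_cast hc)] at he
      simp at he
    have hj : B.size ≤ j := Nat.size_le.2 hlt
    rw [h4, show j = B.size by omega]

/-- Doubling of all multiplicities. -/
def doubleSweep : Program := forEdges (.store 5 eI (eM + eM))

theorem doubleSweep_spec {U : ℕ} {σ : State} (H : Holds G c b σ) (hM : HoldsM M σ) (hm : m ≤ U)
    (hU : ∀ e, 2 * M e ≤ U) :
    HT U doubleSweep σ (m * 3 + 2) (HoldsM fun e => 2 * M e) := by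
  refine HT.mono (HT.forEdges (s := 1) (fun i τ => ∀ e : Fin m,
      τ.arr 5 (e : ℕ) = if (e : ℕ) < i then ((2 * M e : ℕ) : ℤ) else M e)
    H.hm hm (by simp) (by simp) (fun _ _ _ h => h) (by simpa [HoldsM] using hM) ?_) le_rfl
    fun τ _ h e => by rw [h, if_pos e.2]
  intro e τ hi _ hS' hI
  have hMe : τ.arr 5 (e : ℕ) = M e := by rw [hI, if_neg (lt_irrefl _)]
  have hsm : Small U ((M e : ℤ) + M e) := Small.of_nonneg (by positivity) (by have := hU e; omega)
  refine HT.of_wp (.store _ _ _) ?_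
  simp [hi, hMe, hsm]
  intro e'
  by_cases h : e' = e
  · subst h; simp; ring
  · have h1 : ¬ (e' : ℕ) = e := fun h' => h (Fin.ext h')
    have h2 : e' ≤ e ↔ e' < e := le_iff_lt_or_eq.trans (by simp [h])
    simp [h1, hI e', h2]

/-- Demand scaling: phases for the demands `b / 2 ^ k`, with `k` descending to 0; the multiplicities
are doubled before each phase. -/
def scaleLoop : Program := .loop (.reg 11) (doubleSweep ;; phase ;; .assign 11 (.reg 11 / .const 2))

theorem deg_two_mul (M : Fin m → ℕ) (v : Fin n) : G.deg (fun e => 2 * M e) v = 2 * G.deg M v := by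
  simp [deg, Finset.mul_sum]

theorem two_mul_div_pow_succ_le (a k : ℕ) : 2 * (a / 2 ^ (k + 1)) ≤ a / 2 ^ k := by
  rw [pow_succ, ← Nat.div_div_eq_div_mul]; omega

theorem keeps_phase : Keeps phase := by
  have := keeps_step
  constructor <;> simp [phase, this.r1, this.r12, this.r13, this.a0, this.a1, this.a2, this.a3]

theorem keeps_doubleSweep : Keeps doubleSweep := by
  constructor <;> simp [doubleSweep, forEdges]

/-- The course of demand scaling. `Q k` is the invariant after the phase for `b / 2 ^ k`, and `J k`
the invariant during that phase, whose last argument bounds the number of remaining augmentations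
and dual steps; `f` is the flag that forbids dual steps. -/
theorem scaleLoop_spec {U Y ψ₀ : ℕ} {f : ℤ} (hf : 0 ≤ f) (hm : 3 * m + n + 1 ≤ U)
    (hb : ∀ v, b v + 2 ≤ U) (hU : ∀ e, c e + 3 * Y ≤ U) (m1 : 1 ≤ m)
    (Q : ℕ → (Fin m → ℕ) → (Fin n → ℤ) → Prop) (J : ℕ → (Fin m → ℕ) → (Fin n → ℤ) → ℕ → Prop)
    (hQJ : ∀ k M y, Q (k + 1) M y → G.Compl c (fun v => b v / 2 ^ (k + 1)) y M →
      J k (fun e => 2 * M e) y ψ₀)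
    (hJQ : ∀ k M y ψ, J k M y ψ → G.Compl c (fun v => b v / 2 ^ k) y M →
      G.Stuck c (fun v => b v / 2 ^ k) y M →
      (f ≠ 0 ∨ G.Closed (G.reachSet c (fun v => b v / 2 ^ k) y M)) → Q k M y)
    (hJY : ∀ k M y ψ, J k M y ψ → ∀ v, |y v| ≤ Y)
    (haug : ∀ k M M' y ψ, J k M y ψ → G.Compl c (fun v => b v / 2 ^ k) y M →
      G.Compl c (fun v => b v / 2 ^ k) y M' → ∑ e, M' e = ∑ e, M e + 1 → ∃ ψ' < ψ, J k M' y ψ')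
    (hdual : f = 0 → ∀ k M y ψ δ, J k M y ψ → G.Compl c (fun v => b v / 2 ^ k) y M →
      G.Stuck c (fun v => b v / 2 ^ k) y M →
      G.IsMinSlack c y (G.reachSet c (fun v => b v / 2 ^ k) y M) δ →
      ∃ ψ' < ψ, J k M (G.shift (G.reachSet c (fun v => b v / 2 ^ k) y M) δ y) ψ')
    (K : ℕ) {σ : State} (hK : 2 ^ K / 2 ≤ U) (H : Holds G c b σ) (hy : HoldsY y σ)
    (hM : HoldsM M σ) (hfl : σ.reg 14 = f) (hD : σ.reg 11 = (2 ^ K / 2 : ℕ))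
    (hC : G.Compl c (fun v => b v / 2 ^ K) y M) (hQ : Q K M y) :
    HT U scaleLoop σ (K * ((ψ₀ + 3) * (m * 160)) + 1) fun τ => Frame n σ τ ∧
      ∃ M y, HoldsM M τ ∧ HoldsY y τ ∧ G.Compl c b y M ∧ Q 0 M y := by
  have hm' : ∀ ψ, (m * 3 + 2) + ((ψ + 2) * (m * 151) + 1) + 1 ≤ (ψ + 3) * (m * 160) := fun ψ => by
    have : (ψ + 3) * (m * 160) = (ψ + 2) * (m * 151) + (ψ + 2) * (m * 9) + m * 160 := by ring
    omega
  refine HT.mono (HT.loop (s := (m * 3 + 2) + ((ψ₀ + 2) * (m * 151) + 1)) (fun k τ =>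
      Holds G c b τ ∧ τ.reg 13 = σ.reg 13 ∧ τ.reg 14 = f ∧ τ.reg 11 = (2 ^ k / 2 : ℕ) ∧
      Frame n σ τ ∧ 2 ^ k / 2 ≤ U ∧ ∃ M y, HoldsM M τ ∧ HoldsY y τ ∧
        G.Compl c (fun v => b v / 2 ^ k) y M ∧ Q k M y) ?_ K σ
      ⟨H, rfl, hfl, hD, fun _ _ => rfl, hK, M, y, hM, hy, hC, hQ⟩)
    (by have := Nat.mul_le_mul_left K (hm' ψ₀); omega) ?_
  · rintro k τ ⟨H', h13, h14, h11, hF, hkU, M', y', hM', hy', hC', hQ'⟩ he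
    obtain ⟨k, rfl⟩ : ∃ j, k = j + 1 := by
      cases k with
      | zero => simp [h11] at he
      | succ k => exact ⟨k, rfl⟩
    have hpow : 2 ^ (k + 1) / 2 = 2 ^ k := by rw [pow_succ]; omega
    rw [hpow] at h11 hkU
    have hMle : ∀ e, 2 * M' e ≤ U := fun e => by
      have h1 := le_deg_left (G := G) M' e
      have h2 := hC'.sub (G.left e)
      have h3 := two_mul_div_pow_succ_le (b (G.left e)) k
      have h4 := Nat.div_le_self (b (G.left e)) (2 ^ k)
      have h5 := hb (G.left e)
      omega
    refine (doubleSweep_spec (U := U) H' hM' (by omega) hMle).seq fun τ₁ S₁ hM₁ => ?_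
    have H₁ := H'.same S₁ keeps_doubleSweep
    have hy₁ := hy'.same S₁ keeps_doubleSweep.r13 (by simp [doubleSweep, forEdges])
    have hC₁ : G.Compl c (fun v => b v / 2 ^ k) y' fun e => 2 * M' e :=
      ⟨fun v => by
        have h2 := hC'.sub v
        have h3 := two_mul_div_pow_succ_le (b v) k
        rw [deg_two_mul]
        omega, hC'.feas, fun e he => hC'.tight e (by omega)⟩
    have r11 : τ₁.reg 11 = (2 ^ k : ℕ) := by rw [S₁.1 11 (by simp [doubleSweep, forEdges]), h11]
    have r14 : τ₁.reg 14 = f := by rw [S₁.1 14 (by simp [doubleSweep, forEdges]), h14]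
    have r13 : τ₁.reg 13 = σ.reg 13 := by rw [S₁.1 13 keeps_doubleSweep.r13, h13]
    refine (phase_spec (U := U) (Y := Y) (J := J k) (ψ := ψ₀) H₁ hy₁ hM₁ r11 (fun _ => rfl) hC₁
      (by omega) hm hb hU m1 (hQJ k M' y' hQ' hC') (hJY k) (haug k)
      (fun h => hdual (r14 ▸ h) k)).seq fun τ₂ S₂ ⟨hF₂, M₂, y₂, ψ₂, hM₂, hy₂, hC₂, hJ₂, hs₂,
          hc₂⟩ => ?_
    have H₂ := H₁.same S₂ keeps_phase
    have r11₂ : τ₂.reg 11 = (2 ^ k : ℕ) := by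
      rw [S₂.1 11 (by simp [phase, step_modReg]), r11]
    have r14₂ : τ₂.reg 14 = f := by rw [S₂.1 14 (by simp [phase, step_modReg]), r14]
    have r13₂ : τ₂.reg 13 = σ.reg 13 := by rw [S₂.1 13 keeps_phase.r13, r13]
    have hsm : Small U ((2 : ℤ) ^ k / 2) := by
      have h1 : ((2 ^ k / 2 : ℕ) : ℤ) = (2 : ℤ) ^ k / 2 := by push_cast; rfl
      rw [← h1]
      exact Small.of_nonneg (by positivity) (by have := Nat.div_le_self (2 ^ k) 2; omega)
    refine HT.of_wp (.assign _ _) ?_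
    simp only [Program.wp, Expr.eval_div, Expr.eval_reg, Expr.eval_const, r11₂]
    push_cast
    refine ⟨hsm, k, by omega,
      ⟨by simp [H₂.hm], H₂.left, H₂.right, by simpa using H₂.cost, by simpa using H₂.dem⟩,
      by simpa using r13₂, by simpa using r14₂, by simp, ?_, ?_, M₂, y₂, hM₂,
      by simpa [HoldsY] using hy₂, hC₂, hJQ k M₂ y₂ ψ₂ hJ₂ hC₂ hs₂ (by rwa [r14] at hc₂)⟩
    · refine Frame.trans (Frame.trans hF (Frame.of_same S₁ (by simp [doubleSweep, forEdges])) h13)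
        (fun x hx => hF₂ x hx) r13
    · have := Nat.div_le_self (2 ^ k) 2; omega
  · rintro τ - ⟨⟨k, -, H', h13, h14, h11, hF, hkU, M', y', hM', hy', hC', hQ'⟩, he⟩
    have hk : k = 0 := by
      by_contra hc
      obtain ⟨j, rfl⟩ := Nat.exists_eq_succ_of_ne_zero hc
      rw [Expr.eval_reg, h11, Nat.succ_eq_add_one, pow_succ,
          Nat.mul_div_cancel _ (by norm_num)] at he
      exact absurd he (by positivity)
    subst hk
    exact ⟨hF, M', y', hM', hy', by simpa using hC', hQ'⟩

end Machine

namespace Machine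

open BipartiteGraph

variable {n m : ℕ} {G : BipartiteGraph n m} {c : Fin m → ℕ} {b β : Fin n → ℕ}
  {y : Fin n → ℤ} {M : Fin m → ℕ}

/-! ### Repairing a predicted dual vector -/

/-- `y'` is feasible and arises from `p` by lowering some vertices, each one exactly as far as one
of its edges requires, and only in favour of a neighbour of at least the same demand. -/
structure Repaired (G : BipartiteGraph n m) (c : Fin m → ℕ) (b : Fin n → ℕ) (p y' : Fin n → ℤ) :
    Prop where
  feas : ∀ e, y' (G.left e) + y' (G.right e) ≤ c e
  cause : ∀ v, y' v = p v ∨ ∃ u, b v ≤ b u ∧ ∃ e, y' v = c e - p u ∧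
    (G.left e = v ∧ G.right e = u ∨ G.left e = u ∧ G.right e = v)

/-- The loss by repairing is controlled by the error of the prediction: a vertex is lowered by at
most its own error plus that of a neighbour of at least the same demand. -/
theorem Repaired.sum_le {p y' z : Fin n → ℤ} (h : Repaired G c b p y')
    (hz : ∀ e, z (G.left e) + z (G.right e) ≤ c e) :
    ∑ v, (b v : ℤ) * (z v - y' v) ≤ (n + 2) * ∑ v, (b v : ℤ) * |p v - z v| := by
  set E := ∑ v, (b v : ℤ) * |p v - z v| with hE
  have hle : ∀ u, (b u : ℤ) * |p u - z u| ≤ E := fun u =>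
    Finset.single_le_sum (f := fun v => (b v : ℤ) * |p v - z v|) (fun v _ => by positivity)
      (Finset.mem_univ u)
  have hE0 : 0 ≤ E := Finset.sum_nonneg fun v _ => by positivity
  have key : ∀ v, (b v : ℤ) * (z v - y' v) ≤ (b v : ℤ) * |p v - z v| + (b v * |p v - z v| + E) := by
    intro v
    have hb0 : (0 : ℤ) ≤ b v := by positivity
    have h1 : z v - p v ≤ |p v - z v| := by rw [abs_sub_comm]; exact le_abs_self _
    have h2 : (b v : ℤ) * (p v - y' v) ≤ b v * |p v - z v| + E := by
      rcases h.cause v with h' | ⟨u, hu, e, he, huv⟩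
      · rw [h', sub_self, mul_zero]; positivity
      · have h3 : z v + z u ≤ c e := by
          rcases huv with ⟨rfl, rfl⟩ | ⟨rfl, rfl⟩
          · exact hz e
          · rw [add_comm]; exact hz e
        have h4 : p v - y' v ≤ |p v - z v| + |p u - z u| := by
          have := le_abs_self (p v - z v)
          have := le_abs_self (p u - z u)
          linarith
        have h5 : (b v : ℤ) * |p u - z u| ≤ b u * |p u - z u| :=
          mul_le_mul_of_nonneg_right (by exact_mod_cast hu) (abs_nonneg _)
        nlinarith [hle u]
    nlinarith
  calc ∑ v, (b v : ℤ) * (z v - y' v)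
      ≤ ∑ v, ((b v : ℤ) * |p v - z v| + (b v * |p v - z v| + E)) :=
        Finset.sum_le_sum fun v _ => key v
    _ = (n + 2) * E := by
        simp only [Finset.sum_add_distrib, Finset.sum_const, Finset.card_univ, Fintype.card_fin,
          nsmul_eq_mul, ← hE]; ring

/-- For every infeasible edge, the endpoint of smaller demand is lowered. -/
def repairSweep : Program :=
  forEdges (.store 13 eL (eY eL) ;; .store 13 eR (eY eR)) ;;
  forEdges (.branch ((eB eL).lt (eB eR))
    (.branch ((eC - eY eR).lt (.get 13 eL)) (.store 13 eL (eC - eY eR)) .skip)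
    (.branch ((eC - eY eL).lt (.get 13 eR)) (.store 13 eR (eC - eY eL)) .skip)) ;;
  copySweep

theorem repairSweep_spec {U Y : ℕ} {p : Fin n → ℤ} {σ : State} (H : Holds G c b σ)
    (hp : HoldsY p σ) (hm : m ≤ U) (hY : ∀ v, |p v| ≤ Y) (hU : ∀ e, c e + Y ≤ U) (hYU : Y ≤ U) :
    HT U repairSweep σ (m * 15 + 6) fun τ => ∃ y', Repaired G c b p y' ∧ HoldsY y' τ := by
  have hps : ∀ v, Small U (p v) := fun v => by
    have := abs_le.1 (hY v); exact ⟨by omega, by omega⟩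
  have hcs : ∀ e v, Small U (c e - p v) := fun e v => by
    have := abs_le.1 (hY v); have := hU e; exact ⟨by omega, by omega⟩
  refine HT.mono (s := (m * 4 + 2) + ((m * 5 + 2) + (m * 4 + 2))) ((HT.forEdges (s := 2)
    (fun i τ => Upto G i fun v => τ.arr 13 (v : ℕ) = p v)
    H.hm hm (by simp) (by simp) (fun _ _ _ h => h) Upto.zero ?_).seq fun τ₁ S₁ h₁ =>
    (HT.forEdges (s := 3) (fun i τ => (∀ v, Inc G v → τ.arr 13 (v : ℕ) ≤ p v ∧
      (τ.arr 13 (v : ℕ) = p v ∨ ∃ u, b v ≤ b u ∧ ∃ e, τ.arr 13 (v : ℕ) = c e - p u ∧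
        (G.left e = v ∧ G.right e = u ∨ G.left e = u ∧ G.right e = v))) ∧
      ∀ e : Fin m, (e : ℕ) < i → τ.arr 13 (G.left e : ℕ) ≤ c e - p (G.right e) ∨
        τ.arr 13 (G.right e : ℕ) ≤ c e - p (G.left e))
      (by rw [S₁.1 1 (by simp [forEdges])]; exact H.hm) hm (by simp) (by simp)
      (fun _ _ _ h => h) ⟨fun v hv => ⟨(h₁.inc hv).le, Or.inl (h₁.inc hv)⟩, by simp⟩ ?_).seq
      fun τ₂ S₂ h₂ => ?_) (by omega) fun _ _ h => h
  · intro e τ hi _ hS' hI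
    have H' := H.same hS' (by constructor <;> simp [forEdges])
    have hp' := hp.same hS' (by simp [forEdges]) (by simp [forEdges])
    refine HT.of_wp _ ?_
    simp [hi, H'.left, H'.right, hp' _, hps]
    refine hI.succ (fun v h => ?_) ?_ ?_
    all_goals grind
  · intro e τ hi _ hS' ⟨hI, hI2⟩
    have H' := (H.same S₁ (by constructor <;> simp [forEdges])).same hS'
      (by constructor <;> simp [forEdges])
    have hp' := (hp.same S₁ (by simp [forEdges]) (by simp [forEdges])).same hS'
      (by simp [forEdges]) (by simp [forEdges])
    have hne : ∀ e e', ¬ (G.left e : ℕ) = G.right e' := fun e e' h =>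
        G.left_ne_right e e' (Fin.ext h)
    have hne' : ∀ e e', ¬ (G.right e : ℕ) = G.left e' := fun e e' h => hne e' e h.symm
    refine HT.of_wp _ ?_
    simp [hi, H'.left, H'.right, H'.cost, H'.dem, hp' _, hcs, hne, hne']
    refine ⟨fun hb => ⟨fun hlt => ⟨fun v hv => ?_, fun e' he' => ?_⟩,
      fun hlt => ⟨hI, fun e' he' => ?_⟩⟩, fun hb => ⟨fun hlt => ⟨fun v hv => ?_, fun e' he' => ?_⟩,
      fun hlt => ⟨hI, fun e' he' => ?_⟩⟩⟩
    · split_ifs with h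
      · have hv' : v = G.left e := Fin.ext h
        subst hv'
        exact ⟨hlt.le.trans (hI _ hv).1, Or.inr ⟨_, hb.le, e, rfl, Or.inl ⟨rfl, rfl⟩⟩⟩
      · exact hI v hv
    · rcases Nat.lt_succ_iff_lt_or_eq.1 (Nat.lt_succ_of_le he') with h | h
      · rcases hI2 e' h with h' | h'
        · left
          split_ifs with h3
          · rw [h3] at h'; omega
          · exact h'
        · exact Or.inr h'
      · obtain rfl : e' = e := Fin.ext h
        simp
    · rcases Nat.lt_succ_iff_lt_or_eq.1 (Nat.lt_succ_of_le he') with h | h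
      · exact hI2 e' h
      · obtain rfl : e' = e := Fin.ext h
        left; omega
    · split_ifs with h
      · have hv' : v = G.right e := Fin.ext h
        subst hv'
        exact ⟨hlt.le.trans (hI _ hv).1, Or.inr ⟨_, hb, e, rfl, Or.inr ⟨rfl, rfl⟩⟩⟩
      · exact hI v hv
    · rcases Nat.lt_succ_iff_lt_or_eq.1 (Nat.lt_succ_of_le he') with h | h
      · rcases hI2 e' h with h' | h'
        · exact Or.inl h'
        · right
          split_ifs with h3
          · rw [h3] at h'; omega
          · exact h'
      · obtain rfl : e' = e := Fin.ext h
        simp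
    · rcases Nat.lt_succ_iff_lt_or_eq.1 (Nat.lt_succ_of_le he') with h | h
      · exact hI2 e' h
      · obtain rfl : e' = e := Fin.ext h
        right; omega
  · have H' := (H.same S₁ (by constructor <;> simp [forEdges])).same S₂
      (by constructor <;> simp [forEdges])
    have hp' := (hp.same S₁ (by simp [forEdges]) (by simp [forEdges])).same S₂
      (by simp [forEdges]) (by simp [forEdges])
    classical
    set y' : Fin n → ℤ := fun v => if Inc G v then τ₂.arr 13 (v : ℕ) else p v with hy'
    have hl : ∀ e, y' (G.left e) = τ₂.arr 13 (G.left e : ℕ) := fun e => if_pos (Inc.left e)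
    have hr : ∀ e, y' (G.right e) = τ₂.arr 13 (G.right e : ℕ) := fun e => if_pos (Inc.right e)
    have hR : Repaired G c b p y' := by
      refine ⟨fun e => ?_, fun v => ?_⟩
      · rw [hl, hr]
        have h1 := (h₂.1 _ (Inc.left e)).1
        have h2 := (h₂.1 _ (Inc.right e)).1
        rcases h₂.2 e e.2 with h | h <;> omega
      · by_cases hv : Inc G v
        · rw [hy']; dsimp only; rw [if_pos hv]; exact (h₂.1 v hv).2
        · left; rw [hy']; dsimp only; rw [if_neg hv]
    refine (copySweep_spec (y' := y') H' hp' (fun v hv => (if_pos hv).symm) (fun v hv => if_neg hv)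
      hm fun v => ?_).mono le_rfl fun τ _ h => ⟨y', hR, h.1⟩
    rcases hR.cause v with h | ⟨u, -, e, h, -⟩
    · rw [h]; exact hps v
    · rw [h]; exact hcs e u

/-! ### Minimum-weight perfect b-matchings from a prediction -/

/-- Repair of the prediction, a maximum matching of tight edges by demand scaling without dual
steps, and then augmentations and dual steps until the matching is perfect. -/
def matchProgram : Program :=
  repairSweep ;; .assign 14 (.const 1) ;; scaleInit ;; scaleLoop ;;
  .assign 14 (.const 0) ;; .assign 11 (.const 1) ;; phase

theorem keeps_repairSweep : Keeps repairSweep := by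
  constructor <;> simp [repairSweep, copySweep, forEdges]

theorem keeps_scaleInit : Keeps scaleInit := by
  constructor <;> simp [scaleInit, forEdges]

theorem keeps_scaleLoop : Keeps scaleLoop := by
  have h1 := keeps_phase
  have h2 := keeps_doubleSweep
  constructor <;> simp [scaleLoop, h1.r1, h1.r12, h1.r13, h1.a0, h1.a1, h1.a2, h1.a3,
    h2.r1, h2.r12, h2.r13, h2.a0, h2.a1, h2.a2, h2.a3]

/-- When no dual step is possible or needed, the deficiency of a matching without augmenting paths
is at most the gap to the optimal value. -/
theorem deficiency_le {M' : Fin m → ℕ} (h : G.Compl c b y M) (hs : G.Stuck c b y M)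
    (hM' : G.IsPerfectBMatching b M') :
    ((∑ v ∈ G.lefts, b v : ℕ) : ℤ) - (∑ e, M e : ℕ) ≤
      (∑ e, c e * M' e : ℕ) - ∑ v, (b v : ℤ) * y v := by
  have hw : ∀ z : Fin n → ℤ, (∀ e, z (G.left e) + z (G.right e) ≤ (c e : ℤ)) →
      ∑ v, (b v : ℤ) * z v ≤ ((∑ e, c e * M' e : ℕ) : ℤ) := fun z hz => weak_duality hM' hz
  by_cases hc : G.Closed (G.reachSet c b y M)
  · have h1 := h.perfect hs hc hM'
    rw [h1.sum_lefts, sub_self]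
    have := hw y h.feas
    omega
  · obtain ⟨e₀, he₀⟩ := not_forall.1 hc
    rw [Classical.not_imp] at he₀
    obtain ⟨e, he, hmin⟩ := Finset.exists_min_image
      (Finset.univ.filter fun e => G.left e ∈ G.reachSet c b y M ∧ G.right e ∉ G.reachSet c b y M)
      (fun e => (c e : ℤ) - y (G.left e) - y (G.right e)) ⟨e₀, by simpa using he₀⟩
    have hδ : G.IsMinSlack c y (G.reachSet c b y M) (c e - y (G.left e) - y (G.right e)) :=
      ⟨⟨e, (Finset.mem_filter.1 he).2.1, (Finset.mem_filter.1 he).2.2, rfl⟩,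
        fun e' h1 h2 => hmin e' (by simpa using ⟨h1, h2⟩)⟩
    obtain ⟨hpos, hC'⟩ := h.shift hδ
    have h1 := hw _ hC'.feas
    rw [h.sum_shift hs] at h1
    have h2 : ((∑ e, M e : ℕ) : ℤ) ≤ (∑ v ∈ G.lefts, b v : ℕ) := by
      rw [← sum_deg_lefts]
      exact_mod_cast Finset.sum_le_sum fun v _ => h.sub v
    nlinarith

end Machine

namespace Machine

open BipartiteGraph

variable {n m : ℕ} {G : BipartiteGraph n m} {c : Fin m → ℕ} {b β : Fin n → ℕ}
  {y : Fin n → ℤ} {M : Fin m → ℕ}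

theorem two_pow_size_le (B : ℕ) : 2 ^ B.size ≤ 2 * B + 1 := by
  rcases Nat.eq_zero_or_pos B.size with h | h
  · simp [h]
  · have h1 : 2 ^ (B.size - 1) ≤ B := Nat.lt_size.1 (by omega)
    have h2 : 2 ^ B.size = 2 ^ (B.size - 1) * 2 := by rw [← pow_succ]; congr 1; omega
    omega

theorem deg_zero (v : Fin n) : G.deg (fun _ => 0) v = 0 := by simp [deg]

theorem div_pow_size_eq_zero {b : Fin n → ℕ} {v : Fin n} (hv : Inc G v) :
    b v / 2 ^ ((maxDem G b).size + 1) = 0 := by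
  refine Nat.div_eq_of_lt ((le_maxDem hv).trans_lt ?_)
  exact (Nat.lt_size_self _).trans (Nat.pow_lt_pow_right (by norm_num) (Nat.lt_succ_self _))

theorem compl_zero (hy : ∀ e, y (G.left e) + y (G.right e) ≤ c e) :
    G.Compl c β y fun _ => 0 :=
  ⟨fun v => by simp [deg_zero], hy, fun e he => absurd he (lt_irrefl _)⟩

theorem stuck_zero : G.Stuck c (fun v => b v / 2 ^ ((maxDem G b).size + 1)) y fun _ => 0 :=
  fun e _ => by rw [deg_zero]; exact (div_pow_size_eq_zero (Inc.right e)).symm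

/-- While the matching is not perfect, a dual step of size `δ` raises the dual value by at least
`δ`, and never beyond the optimum. -/
theorem Compl.shift_bound {M' : Fin m → ℕ} {δ : ℤ} (h : G.Compl c b y M) (hs : G.Stuck c b y M)
    (hδ : G.IsMinSlack c y (G.reachSet c b y M) δ) (hM' : G.IsPerfectBMatching b M') :
    0 < δ ∧ ∑ v, (b v : ℤ) * y v + δ ≤
      ∑ v, (b v : ℤ) * G.shift (G.reachSet c b y M) δ y v ∧
    ∑ v, (b v : ℤ) * G.shift (G.reachSet c b y M) δ y v ≤ (∑ e, c e * M' e : ℕ) := by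
  obtain ⟨hpos, hC'⟩ := h.shift hδ
  refine ⟨hpos, ?_, weak_duality hM' hC'.feas⟩
  rw [h.sum_shift hs]
  have h2 : ∑ e, M e < ∑ v ∈ G.lefts, b v := by
    obtain ⟨⟨e, he, -⟩, -⟩ := hδ
    obtain ⟨u, ⟨⟨e', rfl⟩, hu⟩, -⟩ := mem_reachSet.1 he
    rw [← sum_deg_lefts]
    exact Finset.sum_lt_sum (fun v _ => h.sub v) ⟨_, left_mem_lefts e', hu⟩
  have h3 : (1 : ℤ) ≤ (∑ v ∈ G.lefts, b v : ℕ) - (∑ e, M e : ℕ) := by omega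
  nlinarith

theorem sum_div_pow_le (S : Finset (Fin n)) (b : Fin n → ℕ) (k : ℕ) :
    ∑ v ∈ S, b v / 2 ^ k ≤ 2 * ∑ v ∈ S, b v / 2 ^ (k + 1) + n := by
  have h1 : ∀ v, b v / 2 ^ k ≤ 2 * (b v / 2 ^ (k + 1)) + 1 := fun v => by
    rw [pow_succ, ← Nat.div_div_eq_div_mul]; omega
  calc ∑ v ∈ S, b v / 2 ^ k ≤ ∑ v ∈ S, (2 * (b v / 2 ^ (k + 1)) + 1) :=
        Finset.sum_le_sum fun v _ => h1 v
    _ = 2 * ∑ v ∈ S, b v / 2 ^ (k + 1) + S.card := by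
        rw [Finset.sum_add_distrib, Finset.mul_sum]; simp
    _ ≤ _ := by
        have := Finset.card_le_univ S
        rw [Fintype.card_fin] at this
        omega

theorem two_mul_sum (M : Fin m → ℕ) : ∑ e, 2 * M e = 2 * ∑ e, M e := (Finset.mul_sum _ _ _).symm

/-- Demand scaling without dual steps: each phase needs at most `n` augmentations, because a
vertex cover of the tight edges certifies that the previous phase ended with a maximum matching. -/
theorem scaleLoop_tight {U Y : ℕ} (hm : 3 * m + n + 1 ≤ U) (hb : ∀ v, 2 * b v + 2 ≤ U)
    (hU : ∀ e, c e + 3 * Y ≤ U) (m1 : 1 ≤ m) {σ : State} (H : Holds G c b σ) (hy : HoldsY y σ)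
    (hM : HoldsM (fun _ : Fin m => 0) σ) (hfl : σ.reg 14 = 1)
    (hD : σ.reg 11 = (2 ^ (maxDem G b).size : ℕ)) (hY : ∀ v, |y v| ≤ Y)
    (hf : ∀ e, y (G.left e) + y (G.right e) ≤ c e) :
    HT U scaleLoop σ (((maxDem G b).size + 1) * ((n + 3) * (m * 160)) + 1) fun τ =>
      ∃ M, HoldsM M τ ∧ HoldsY y τ ∧ G.Compl c b y M ∧ G.Stuck c b y M := by
  set K := (maxDem G b).size with hK
  have hpow : 2 ^ (K + 1) / 2 = 2 ^ K := by rw [pow_succ]; omega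
  have hKU : 2 ^ K ≤ U := by
    obtain ⟨e⟩ : Nonempty (Fin m) := ⟨⟨0, m1⟩⟩
    have h1 := two_pow_size_le (maxDem G b)
    have h2 : maxDem G b ≤ (U - 2) / 2 := maxDem_le fun v => by have := hb v; omega
    exact h1.trans (by omega)
  refine (scaleLoop_spec (U := U) (Y := Y) (ψ₀ := n) (f := 1) (by norm_num) hm
    (fun v => by have := hb v; omega) hU m1
    (fun k M y' => y' = y ∧ G.Stuck c (fun v => b v / 2 ^ k) y M)
    (fun k M y' ψ => y' = y ∧ ∃ S : Finset (Fin n), (∀ e, y (G.left e) + y (G.right e) = c e →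
      G.left e ∈ S ∨ G.right e ∈ S) ∧ ∑ v ∈ S, b v / 2 ^ k ≤ ∑ e, M e + ψ)
    ?_ ?_ ?_ ?_ ?_ (K + 1) (by rw [hpow]; exact hKU) H hy hM hfl (by rw [hpow]; exact hD)
    (compl_zero hf) ⟨rfl, stuck_zero⟩).mono le_rfl ?_
  · rintro k M y ⟨rfl, hs⟩ hC
    refine ⟨rfl, cover G (G.reachSet c (fun v => b v / 2 ^ (k + 1)) y M),
      fun e he => mem_cover_of_imp fun hl => reach_right_of_tight hl he, ?_⟩
    have h1 := sum_div_pow_le (cover G (G.reachSet c (fun v => b v / 2 ^ (k + 1)) y M)) b k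
    rw [hC.sum_cover_eq hs] at h1
    rwa [two_mul_sum]
  · rintro k M _ ψ ⟨rfl, -⟩ - hs -
    exact ⟨rfl, hs⟩
  · rintro k M _ ψ ⟨rfl, -⟩
    exact hY
  · rintro k M M' _ ψ ⟨rfl, S, hS, hle⟩ hC hC' hsum
    have h1 := sum_le_of_cover (β := fun v => b v / 2 ^ k) (S := S)
      (fun e he => hS e (hC'.tight e he)) fun v _ => hC'.sub v
    exact ⟨ψ - 1, by omega, rfl, S, hS, by omega⟩
  · intro h; norm_num at h
  · rintro τ - ⟨-, M, y', h1, h2, h3, rfl, h4⟩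
    exact ⟨M, h1, h2, h3, by simpa using h4⟩

/-- The program makes at most `2 * g` steps after the repair and the initial matching, where `g`
bounds the gap between the value of the repaired dual vector and the optimum: the potential is the
remaining gap plus the deficiency of the matching, and the deficiency is at most the gap to begin
with. -/
theorem matchProgram_spec {U A g : ℕ} {p : Fin n → ℤ} {M' : Fin m → ℕ} {σ : State}
    (H : Holds G c b σ) (hp : HoldsY p σ) (hM' : G.IsPerfectBMatching b M') (m1 : 1 ≤ m)
    (hc : ∀ e, c e ≤ A) (hpA : ∀ v, |p v| ≤ A)
    (hg : ∀ y', Repaired G c b p y' → (∑ e, c e * M' e : ℕ) - ∑ v, (b v : ℤ) * y' v ≤ g)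
    (hm : 3 * m + n + 1 ≤ U) (hb : ∀ v, 2 * b v + 2 ≤ U) (hU : 7 * A + 3 * g ≤ U) :
    HT U matchProgram σ ((m * 15 + 6) + (1 + ((m * 7 + 5 + 2 * (maxDem G b).size) +
      ((((maxDem G b).size + 1) * ((n + 3) * (m * 160)) + 1) +
      (1 + (1 + (2 * g + 2) * (m * 151))))))) fun τ =>
      ∃ M y, HoldsM M τ ∧ G.IsPerfectBMatching b M ∧ G.Compl c b y M := by
  have h0 : Small U 0 := Small.of_nonneg le_rfl (by positivity)
  have h1 : Small U 1 := Small.of_nonneg (by norm_num) (by omega)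
  have hassign : ∀ (r : ℕ) (z : ℤ) (σ : State), Small U z →
      HT U (.assign r (.const z)) σ 1 fun τ => τ = σ.setReg r z :=
    fun r z σ hz => HT.of_wp (.assign _ _) (by simpa using hz)
  have hset : ∀ {σ : State} (r : ℕ) (z : ℤ), r ≠ 1 → r ≠ 12 → r ≠ 13 → Holds G c b σ →
      Holds G c b (σ.setReg r z) := fun r z h1 h12 h13 H =>
    ⟨by simp [h1.symm, H.hm], H.left, H.right, by simpa [h12.symm] using H.cost,
      by simpa [h13.symm] using H.dem⟩
  have hsetY : ∀ {σ : State} (r : ℕ) (z : ℤ) (y : Fin n → ℤ), r ≠ 13 → HoldsY y σ →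
      HoldsY y (σ.setReg r z) := fun r z y h13 hy => by simpa [HoldsY, h13.symm] using hy
  refine (repairSweep_spec H hp (by omega) hpA (fun e => by have := hc e; omega)
    (by omega)).seq fun τ₁ S₁ ⟨y₀, hR, hy₁⟩ => ?_
  have H₁ := H.same S₁ keeps_repairSweep
  refine (hassign 14 1 τ₁ h1).seq fun τ₂ _ e₂ => ?_
  have H₂ : Holds G c b τ₂ := e₂ ▸ hset 14 1 (by norm_num) (by norm_num) (by norm_num) H₁
  have hy₂ : HoldsY y₀ τ₂ := e₂ ▸ hsetY 14 1 y₀ (by norm_num) hy₁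
  refine (scaleInit_spec H₂ (by omega) (fun v => by have := hb v; omega) (by omega) (by
    have h2 : maxDem G b ≤ (U - 2) / 2 := maxDem_le fun v => by have := hb v; omega
    omega)).seq fun τ₃ S₃ ⟨hM₃, h11₃⟩ => ?_
  have H₃ := H₂.same S₃ keeps_scaleInit
  have hy₃ := hy₂.same S₃ keeps_scaleInit.r13 (by simp [scaleInit, forEdges])
  have h14₃ : τ₃.reg 14 = 1 := by
    rw [S₃.1 14 (by simp [scaleInit, forEdges]), e₂]; simp
  have hy₀ : ∀ v, |y₀ v| ≤ 2 * A := fun v => by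
    have h1 := abs_le.1 (hpA v)
    rcases hR.cause v with h | ⟨u, -, e, h, -⟩
    · rw [h, abs_le]; constructor <;> omega
    · have h2 := abs_le.1 (hpA u)
      have h3 := hc e
      rw [h, abs_le]; constructor <;> omega
  refine (scaleLoop_tight (Y := 2 * A + g) hm hb (fun e => by have := hc e; omega) m1 H₃ hy₃ hM₃
    h14₃ h11₃ (fun v => (hy₀ v).trans (by push_cast; omega)) hR.feas).seq
    fun τ₄ S₄ ⟨M₄, hM₄, hy₄, hC₄, hs₄⟩ => ?_
  have H₄ := H₃.same S₄ keeps_scaleLoop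
  refine (hassign 14 0 τ₄ h0).seq fun τ₅ _ e₅ => (hassign 11 1 τ₅ h1).seq fun τ₆ _ e₆ => ?_
  have H₆ : Holds G c b τ₆ := by
    rw [e₆, e₅]
    exact hset 11 1 (by norm_num) (by norm_num) (by norm_num)
      (hset 14 0 (by norm_num) (by norm_num) (by norm_num) H₄)
  have hy₆ : HoldsY y₀ τ₆ := by
    rw [e₆, e₅]
    exact hsetY 11 1 y₀ (by norm_num) (hsetY 14 0 y₀ (by norm_num) hy₄)
  have hM₆ : HoldsM M₄ τ₆ := by rw [e₆, e₅]; exact hM₄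
  have h14₆ : τ₆.reg 14 = 0 := by rw [e₆, e₅]; simp
  have h11₆ : τ₆.reg 11 = (1 : ℕ) := by rw [e₆]; simp
  set V := ∑ v ∈ G.lefts, b v with hV
  set W := ∑ e, c e * M' e with hW
  have hg₀ := hg y₀ hR
  have hdef := deficiency_le hC₄ hs₄ hM'
  have hweak : ∀ {y M}, G.Compl c b y M → ∑ v, (b v : ℤ) * y v ≤ W :=
    fun h => weak_duality hM' h.feas
  have hcard : ∀ {y M}, G.Compl c b y M → ∑ e, M e ≤ V := fun {y M} h => by
    rw [hV, ← sum_deg_lefts]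
    exact Finset.sum_le_sum fun v _ => h.sub v
  -- a dual step of size `δ` gains at least `δ`, so the dual vector moves by at most the gain
  refine (phase_spec (U := U) (D := 1) (β := b) (Y := 2 * A + g) (ψ := 2 * g)
    (J := fun M y ψ => (∀ v, |y v - y₀ v| ≤ ∑ v, (b v : ℤ) * y v - ∑ v, (b v : ℤ) * y₀ v) ∧
      ∑ v, (b v : ℤ) * y v ≤ W ∧
      (W : ℤ) - ∑ v, (b v : ℤ) * y v + (V - (∑ e, M e : ℕ)) ≤ ψ)
    H₆ hy₆ hM₆ h11₆ (by simp) hC₄ h14₆.ge hm (fun v => by have := hb v; omega)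
    (fun e => by have := hc e; omega) m1 ?_ ?_ ?_ ?_).mono le_rfl ?_
  · refine ⟨by simp, hweak hC₄, ?_⟩
    omega
  · rintro M y ψ ⟨h1, h2, -⟩ v
    have h3 := abs_le.1 (h1 v)
    have h4 := abs_le.1 (hy₀ v)
    rw [abs_le]
    push_cast
    constructor <;> omega
  · rintro M M'' y ψ ⟨h1, h2, h3⟩ hC hC'' hsum
    have h4 := hcard hC''
    have h5 := hweak hC''
    refine ⟨ψ - 1, by omega, h1, h2, by omega⟩
  · rintro - M y ψ δ ⟨h1, h2, h3⟩ hC hs hδ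
    obtain ⟨h4, h5, h6⟩ := Compl.shift_bound hC hs hδ hM'
    have h7 := hcard hC
    refine ⟨ψ - 1, by omega, fun v => ?_, h6, by omega⟩
    have h8 : |G.shift (G.reachSet c b y M) δ y v - y v| ≤ δ := by
      unfold shift
      split_ifs <;> simp [abs_of_pos h4, h4.le]
    have h9 := abs_le.1 (h1 v)
    have h10 := abs_le.1 h8
    rw [abs_le]
    constructor <;> omega
  · rintro τ - ⟨-, M, y, ψ, hM, -, hC, -, hs, hc⟩
    exact ⟨M, y, hM, hC.perfect hs (hc.resolve_left (by simp [h14₆])) hM', hC⟩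

end Machine

namespace Machine

open BipartiteGraph

variable {n m : ℕ} {G : BipartiteGraph n m} {c : Fin m → ℕ} {b β : Fin n → ℕ}
  {y : Fin n → ℤ} {M : Fin m → ℕ}

theorem vec_apply {k : ℕ} (f : Fin k → ℤ) (i : Fin k) : vec f (i : ℕ) = f i := by
  simp [vec]

theorem natAbs_vec_le {k U : ℕ} {f : Fin k → ℤ} (h : ∀ i, |f i| ≤ U) (z : ℤ) :
    (vec f z).natAbs ≤ U := by
  unfold vec
  split_ifs with hz
  · have := abs_le.1 (h ⟨z.toNat, hz.2⟩); omega
  · simp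

theorem edges_le (G : BipartiteGraph n m) : m ≤ n * n := by
  simpa using Fintype.card_le_of_injective _ G.simple

/-- Rounding at most doubles the distance to an integer. -/
theorem abs_round_sub_le (x : ℝ) (z : ℤ) : |((round x : ℤ) : ℝ) - z| ≤ 2 * |x - z| := by
  have h1 := round_le x z
  have h2 := abs_sub_le (round x : ℝ) x z
  rw [abs_sub_comm (round x : ℝ) x] at h2
  linarith

theorem abs_round_le {x : ℝ} {N : ℕ} (h : |x| ≤ N) : |round x| ≤ (N : ℤ) := by
  have h1 := abs_sub_round x
  have h2 := abs_sub_abs_le_abs_sub (round x : ℝ) x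
  rw [abs_sub_comm (round x : ℝ) x] at h2
  have h3 : |(round x : ℝ)| < N + 1 := by linarith
  have h4 : |round x| < (N : ℤ) + 1 := by exact_mod_cast h3
  omega

theorem size_le_log {N : ℕ} (hN : 3 ≤ N) : (N.size : ℝ) ≤ 3 * Real.log N := by
  have hN' : (3 : ℝ) ≤ N := by exact_mod_cast hN
  have h1 : 1 ≤ Real.log N := by
    rw [Real.le_log_iff_exp_le (by linarith)]
    exact (Real.exp_one_lt_d9.le.trans (by norm_num)).trans hN'
  have h2 : 0 < N.size := Nat.size_pos.2 (by omega)
  have h3 : 2 ^ (N.size - 1) ≤ N := Nat.lt_size.1 (by omega)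
  have h4 : ((N.size - 1 : ℕ) : ℝ) * Real.log 2 ≤ Real.log N := by
    rw [← Real.log_pow]
    exact Real.log_le_log (by positivity) (by exact_mod_cast h3)
  rw [Nat.cast_sub h2, Nat.cast_one] at h4
  have h5 := Real.log_two_gt_d9
  have h6 : (1 : ℝ) ≤ N.size := by exact_mod_cast h2
  nlinarith

theorem sum_cast_le {N : ℕ} (h : ∀ v, b v ≤ N) {z : Fin n → ℤ} {A : ℕ} (hz : ∀ v, |z v| ≤ A) :
    |∑ v, (b v : ℤ) * z v| ≤ (n * (N * A) : ℕ) := by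
  calc |∑ v, (b v : ℤ) * z v| ≤ ∑ v, |(b v : ℤ) * z v| := Finset.abs_sum_le_sum_abs _ _
    _ ≤ ∑ _v : Fin n, ((N * A : ℕ) : ℤ) := Finset.sum_le_sum fun v _ => by
        rw [abs_mul, Nat.abs_cast]
        push_cast
        exact mul_le_mul (by exact_mod_cast h v) (hz v) (abs_nonneg _) (by positivity)
    _ = _ := by simp

theorem weight_le {N : ℕ} (hM : G.IsPerfectBMatching b M) (hc : ∀ e, c e ≤ N) (hb : ∀ v, b v ≤ N) :
    ∑ e, c e * M e ≤ N * (n * N) := by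
  calc ∑ e, c e * M e ≤ ∑ e, N * M e := Finset.sum_le_sum fun e _ => Nat.mul_le_mul_right _ (hc e)
    _ = N * ∑ v ∈ G.lefts, b v := by rw [hM.sum_lefts, Finset.mul_sum]
    _ ≤ N * ∑ v : Fin n, b v := Nat.mul_le_mul_left _
        (Finset.sum_le_sum_of_subset (Finset.subset_univ _))
    _ ≤ N * (n * N) := Nat.mul_le_mul_left _ (by
        simpa using Finset.sum_le_sum fun v (_ : v ∈ Finset.univ) => hb v)

theorem holds_matchingInput (x : Fin n → ℝ) : Holds G c b (matchingInput G c b x) where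
  hm := rfl
  left e := by simp only [matchingInput]; rw [vec_apply]
  right e := by simp only [matchingInput]; rw [vec_apply]
  cost e := by simp only [matchingInput, zero_add]; rw [vec_apply]
  dem v := by simp only [matchingInput, zero_add]; rw [vec_apply]

theorem holdsY_matchingInput (x : Fin n → ℝ) :
    HoldsY (fun v => round (x v)) (matchingInput G c b x) := fun v => by
  simp only [matchingInput, zero_add]; rw [vec_apply]

theorem bounded_matchingInput {U : ℕ} {x : Fin n → ℝ} (hn : n ≤ U) (hm : m ≤ U)
    (hc : ∀ e, c e ≤ U) (hb : ∀ v, b v ≤ U) (hx : ∀ v, |round (x v)| ≤ (U : ℤ)) :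
    Bounded U (matchingInput G c b x) := by
  have hfin : ∀ v : Fin n, |((v : ℕ) : ℤ)| ≤ U := fun v => by
    rw [Nat.abs_cast]; exact_mod_cast v.2.le.trans hn
  constructor
  · intro r
    unfold matchingInput
    dsimp only
    split
    · simpa using hn
    · simpa using hm
    · simp
  · intro a i
    unfold matchingInput
    dsimp only
    split
    · exact natAbs_vec_le (fun e => hfin _) _
    · exact natAbs_vec_le (fun e => hfin _) _
    · exact natAbs_vec_le (fun e => by rw [Nat.abs_cast]; exact_mod_cast hc e) _
    · exact natAbs_vec_le (fun v => by rw [Nat.abs_cast]; exact_mod_cast hb v) _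
    · exact natAbs_vec_le hx _
    · simp

/-- The step count of the matching algorithm, in terms of the bit length `L` of the input and of the
gap `g` between the repaired prediction and the optimal dual value. -/
theorem steps_le {n m L g s : ℕ} (hn : 3 ≤ n) (hm : 1 ≤ m) (hL : 2 ≤ L) (hs : s ≤ L) :
    (m * 15 + 6) + (1 + ((m * 7 + 5 + 2 * s) + (((s + 1) * ((n + 3) * (m * 160)) + 1) +
      (1 + (1 + (2 * g + 2) * (m * 151)))))) ≤ 1100 * (m * L * (n + g)) := by
  have h1 : (s + 1) * ((n + 3) * (m * 160)) ≤ (2 * L) * ((2 * n) * (m * 160)) :=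
    Nat.mul_le_mul (by omega) (Nat.mul_le_mul_right _ (by omega))
  have h2 : (2 * L) * ((2 * n) * (m * 160)) = 640 * (m * L * n) := by ring
  have h3 : (2 * g + 2) * (m * 151) = 302 * (m * 1 * g) + 302 * m := by ring
  have h4 : m * 1 * g ≤ m * L * g := Nat.mul_le_mul_right _ (Nat.mul_le_mul_left _ (by omega))
  have h5 : m * (2 * 3) ≤ m * (L * n) := Nat.mul_le_mul_left _ (Nat.mul_le_mul hL hn)
  have h6 : 1 * (L * 3) ≤ m * (L * n) := Nat.mul_le_mul hm (Nat.mul_le_mul_left _ hn)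
  have h7 : m * L * (n + g) = m * L * n + m * L * g := by ring
  have h8 : m * (L * n) = m * L * n := by ring
  rw [h8] at h5 h6
  rw [h7, h3]
  rw [h2] at h1
  have h9 := h4
  generalize m * L * n = a at *
  generalize m * L * g = a' at *
  generalize m * 1 * g = a'' at *
  omega

/-- The matching algorithm with a predicted dual vector. -/
theorem exists_matching_algorithm :
    ∃ (P : Program) (K : ℝ) (k : ℕ), ∀ (n m : ℕ), 3 ≤ n → 1 ≤ m →
      ∀ (G : BipartiteGraph n m) (c : Fin m → ℕ) (b : Fin n → ℕ) (x : Fin n → ℝ),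
      (∃ M, G.IsPerfectBMatching b M) →
      ∃ (t : ℕ) (σ : State) (M : Fin m → ℕ),
        Runs P (matchingInput G c b x) t σ ∧ OutputsMatching σ M ∧
        G.IsMinWeightPerfectBMatching c b M ∧
        ∀ xstar : Fin n → ℤ, G.IsOptimalDual c b (fun v => (xstar v : ℝ)) →
        ∀ N : ℕ, n ≤ N → (∀ e, c e ≤ N) → (∀ v, b v ≤ N) → (∀ v, |x v| ≤ N) →
          (t : ℝ) ≤ K * (m * n * (1 + bSeminorm b fun v => x v - xstar v)) * Real.log N ^ k := by
  refine ⟨matchProgram, 1100 * (matchProgram.weight * 6) * 4 * 9, 2, ?_⟩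
  intro n m hn hm G c b x hM
  -- a matching of minimum weight
  obtain ⟨M', hM', hmin⟩ : ∃ M', G.IsPerfectBMatching b M' ∧ ∀ M, G.IsPerfectBMatching b M →
      ∑ e, c e * M' e ≤ ∑ e, c e * M e := by
    have hex : ∃ w M, G.IsPerfectBMatching b M ∧ ∑ e, c e * M e = w :=
      ⟨_, hM.choose, hM.choose_spec, rfl⟩
    classical
    obtain ⟨M', h1, h2⟩ := Nat.find_spec hex
    exact ⟨M', h1, fun M h => h2 ▸ Nat.find_min' hex ⟨M, h, rfl⟩⟩
  -- the least admissible bound for the numbers in the input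
  obtain ⟨N, ⟨hnN, hcN, hbN, hxN⟩, hNmin⟩ : ∃ N : ℕ, (n ≤ N ∧ (∀ e, c e ≤ N) ∧ (∀ v, b v ≤ N) ∧
      ∀ v, |x v| ≤ N) ∧ ∀ N' : ℕ, n ≤ N' → (∀ e, c e ≤ N') → (∀ v, b v ≤ N') →
      (∀ v, |x v| ≤ N') → N ≤ N' := by
    have hex : ∃ N : ℕ, n ≤ N ∧ (∀ e, c e ≤ N) ∧ (∀ v, b v ≤ N) ∧ ∀ v, |x v| ≤ N := by
      have h1 := fun e => Finset.single_le_sum (f := c) (fun _ _ => Nat.zero_le _)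
        (Finset.mem_univ e)
      have h2 := fun v => Finset.single_le_sum (f := b) (fun _ _ => Nat.zero_le _)
        (Finset.mem_univ v)
      have h3 := fun v => Finset.single_le_sum (f := fun v => ⌈|x v|⌉₊) (fun _ _ => Nat.zero_le _)
        (Finset.mem_univ v)
      refine ⟨n + ∑ e, c e + ∑ v, b v + ∑ v, ⌈|x v|⌉₊, by omega, fun e => by have := h1 e; omega,
        fun v => by have := h2 v; omega, fun v => (Nat.le_ceil _).trans ?_⟩
      have := h3 v
      exact_mod_cast (by omega : ⌈|x v|⌉₊ ≤ n + ∑ e, c e + ∑ v, b v + ∑ v, ⌈|x v|⌉₊)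
    classical
    exact ⟨Nat.find hex, Nat.find_spec hex, fun N' h1 h2 h3 h4 =>
      Nat.find_min' hex ⟨h1, h2, h3, h4⟩⟩
  have hpN : ∀ v, |round (x v)| ≤ (N : ℤ) := fun v => abs_round_le (hxN v)
  -- the least upper bound for the gap after the repair
  have hcrude : ∀ y', Repaired G c b (fun v => round (x v)) y' →
      (∑ e, c e * M' e : ℕ) - ∑ v, (b v : ℤ) * y' v ≤ (3 * N ^ 3 : ℕ) := by
    intro y' hy'
    have h1 := weight_le hM' hcN hbN
    have h2 : ∀ v, |y' v| ≤ (2 * N : ℕ) := fun v => by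
      have h1 := abs_le.1 (hpN v)
      rcases hy'.cause v with h | ⟨u, -, e, h, -⟩
      · rw [h, abs_le]; constructor <;> push_cast <;> omega
      · have h2 := abs_le.1 (hpN u)
        have h3 := hcN e
        rw [h, abs_le]; constructor <;> push_cast <;> omega
    have h3 := neg_le_of_abs_le (sum_cast_le hbN h2)
    have h4 : N * (n * N) + n * (N * (2 * N)) ≤ 3 * N ^ 3 := by nlinarith [Nat.zero_le (N ^ 2)]
    omega
  obtain ⟨g, hg, hgmin⟩ : ∃ g : ℕ, (∀ y', Repaired G c b (fun v => round (x v)) y' →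
      (∑ e, c e * M' e : ℕ) - ∑ v, (b v : ℤ) * y' v ≤ g) ∧
      ∀ g' : ℕ, (∀ y', Repaired G c b (fun v => round (x v)) y' →
        (∑ e, c e * M' e : ℕ) - ∑ v, (b v : ℤ) * y' v ≤ g') → g ≤ g' := by
    have hex : ∃ g : ℕ, ∀ y', Repaired G c b (fun v => round (x v)) y' →
        (∑ e, c e * M' e : ℕ) - ∑ v, (b v : ℤ) * y' v ≤ g := ⟨_, hcrude⟩
    classical
    exact ⟨Nat.find hex, Nat.find_spec hex, fun g' h => Nat.find_min' hex h⟩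
  have hg3 := hgmin _ hcrude
  have hN3 : 3 ≤ N := hn.trans hnN
  have hmN : m ≤ N * N := (edges_le G).trans (Nat.mul_le_mul hnN hnN)
  have hN2 : 3 * N ≤ N * N := Nat.mul_le_mul_right _ hN3
  have hN33 : 3 * (N * N) ≤ N ^ 3 := by
    rw [show N ^ 3 = N * (N * N) by ring]; exact Nat.mul_le_mul_right _ hN3
  set L := N.size with hL
  have hLN : N < 2 ^ L := Nat.lt_size_self N
  have hL2 : 2 ≤ L := Nat.lt_size.2 (by omega)
  set U := 16 * N ^ 3 with hU
  have hUsize : U.size + 1 ≤ 6 * L := by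
    have : U < 2 ^ (3 * L + 4) := by
      have h1 : N ^ 3 < (2 ^ L) ^ 3 := Nat.pow_lt_pow_left hLN (by norm_num)
      rw [← pow_mul, mul_comm L] at h1
      rw [pow_add]
      omega
    have := Nat.size_le.2 this
    omega
  have hs : (maxDem G b).size ≤ L := Nat.size_le_size (maxDem_le hbN)
  obtain ⟨t, τ, hrun, ht, M, y, hHM, hperf, hC⟩ := (matchProgram_spec (U := U) (A := N) (g := g)
    (holds_matchingInput x) (holdsY_matchingInput x) hM' hm hcN hpN hg (by omega)
    (fun v => by have := hbN v; omega) (by omega)).runs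
    (bounded_matchingInput (by omega) (by omega) (fun e => (hcN e).trans (by omega))
      (fun v => (hbN v).trans (by omega)) fun v => (hpN v).trans (by omega))
  refine ⟨t, τ, M, hrun, hHM, hC.isMinWeight hperf, ?_⟩
  intro xstar hopt N' h1 h2 h3 h4
  have hNN' := hNmin N' h1 h2 h3 h4
  -- strong duality: the value of `xstar` is the minimum weight
  have hfeas : ∀ e, xstar (G.left e) + xstar (G.right e) ≤ (c e : ℤ) := fun e => by
    have := hopt.1 e
    dsimp only at this
    exact_mod_cast this
  have hdual : ((∑ e, c e * M' e : ℕ) : ℤ) ≤ ∑ v, (b v : ℤ) * xstar v := by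
    have h5 : ((∑ e, c e * M' e : ℕ) : ℤ) ≤ ∑ v, (b v : ℤ) * y v := by
      rw [hC.sum_eq hperf]; exact_mod_cast hmin M hperf
    have h6 := hopt.2 (fun v => (y v : ℝ)) fun e => by
      have := hC.feas e
      dsimp only
      exact_mod_cast this
    dsimp only at h6
    exact h5.trans (by exact_mod_cast h6)
  have hgap : (g : ℤ) ≤ (n + 2) * ∑ v, (b v : ℤ) * |round (x v) - xstar v| := by
    have h0 : (0 : ℤ) ≤ (n + 2) * ∑ v, (b v : ℤ) * |round (x v) - xstar v| := by positivity
    obtain ⟨g', hg'⟩ := Int.eq_ofNat_of_zero_le h0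
    rw [hg']
    exact_mod_cast hgmin g' fun y' hy' => by
      have h5 := hy'.sum_le hfeas
      simp only [mul_sub, Finset.sum_sub_distrib] at h5
      rw [hg'] at h5
      have h6 : ((Int.ofNat g' : ℤ)) = g' := rfl
      omega
  set err := bSeminorm b fun v => x v - xstar v with herr
  have herr0 : 0 ≤ err := Finset.sum_nonneg fun v _ => by positivity
  have hgR : (g : ℝ) ≤ (n + 2) * (2 * err) := by
    have h5 : (g : ℝ) ≤ (n + 2) * ∑ v, (b v : ℝ) * |(round (x v) : ℝ) - xstar v| := by
      exact_mod_cast hgap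
    refine h5.trans (mul_le_mul_of_nonneg_left ?_ (by positivity))
    rw [herr, bSeminorm, Finset.mul_sum]
    refine Finset.sum_le_sum fun v _ => ?_
    have := mul_le_mul_of_nonneg_left (abs_round_sub_le (x v) (xstar v))
      (Nat.cast_nonneg (α := ℝ) (b v))
    linarith
  have htR : (t : ℝ) ≤ 1100 * (m * L * (n + g)) * (matchProgram.weight * (6 * L)) := by
    have h5 := ht.trans (Nat.mul_le_mul (steps_le (g := g) hn hm hL2 hs)
      (Nat.mul_le_mul_left _ hUsize))
    exact_mod_cast h5
  have hn3 : (3 : ℝ) ≤ n := by exact_mod_cast hn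
  have hlog : (L : ℝ) ≤ 3 * Real.log N' := (size_le_log hN3).trans (by
    have : Real.log N ≤ Real.log N' := Real.log_le_log (by positivity) (by exact_mod_cast hNN')
    linarith)
  have hL2' : (L : ℝ) ^ 2 ≤ 9 * Real.log N' ^ 2 := by
    have := pow_le_pow_left₀ (Nat.cast_nonneg L) hlog 2
    rw [mul_pow] at this
    linarith
  have hng : (n : ℝ) + g ≤ 4 * (n * (1 + err)) := by nlinarith
  calc (t : ℝ) ≤ 1100 * (m * L * (n + g)) * (matchProgram.weight * (6 * L)) := htR
    _ = 1100 * (matchProgram.weight * 6) * m * (n + g) * (L : ℝ) ^ 2 := by ring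
    _ ≤ 1100 * (matchProgram.weight * 6) * m * (4 * (n * (1 + err))) * (9 * Real.log N' ^ 2) := by
        gcongr
    _ = _ := by ring

end Machine

/-! ### Regret of projected online subgradient descent -/

section OGD

variable {n m : ℕ}

theorem bSeminorm_eq_zero {x : Fin n → ℝ} {b : Fin n → ℕ} (h : ∀ v, b v = 0) :
    bSeminorm b x = 0 := by simp [bSeminorm, h]

/-- The coordinatewise subgradient of the `b`-seminorm distance to `z`. -/
theorem bSeminorm_subgradient (b : Fin n → ℕ) (x u z : Fin n → ℝ) :
    (bSeminorm b fun v => x v - z v) - (bSeminorm b fun v => u v - z v) ≤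
      ∑ v, (b v * SignType.sign (x v - z v) : ℝ) * (x v - u v) := by
  unfold bSeminorm
  rw [← Finset.sum_sub_distrib]
  refine Finset.sum_le_sum fun v _ => ?_
  rw [← mul_sub, mul_assoc]
  refine mul_le_mul_of_nonneg_left ?_ (Nat.cast_nonneg _)
  rcases lt_trichotomy (x v - z v) 0 with h | h | h
  · have := neg_le_abs (u v - z v)
    rw [sign_neg h, abs_of_neg h]; simp; linarith
  · simp [h]
  · have := le_abs_self (u v - z v)
    rw [sign_pos h, abs_of_pos h]; simp; linarith

/-- The loss is Lipschitz in coordinate `v` with constant `b v`, which bounds the subgradients. -/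
theorem IsSubgradient.abs_le {xstar : BInstance n m → Fin n → ℤ} {I : BInstance n m}
    {x g : EuclideanSpace ℝ (Fin n)}
    (h : IsSubgradient (fun z : EuclideanSpace ℝ (Fin n) => dualLoss xstar I z) x g) (v : Fin n) :
    |g v| ≤ I.2 v := by
  have key : ∀ s : ℝ, |s| = 1 → s * g v ≤ I.2 v := by
    intro s hs
    have h1 := h (x + EuclideanSpace.single v s)
    rw [add_sub_cancel_left] at h1
    have h2 : inner ℝ g (EuclideanSpace.single v s) = s * g v := by
      simp [EuclideanSpace.inner_single_right]
    rw [h2] at h1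
    have h3 : dualLoss xstar I (x + EuclideanSpace.single v s : EuclideanSpace ℝ (Fin n)) ≤
        dualLoss xstar I x + I.2 v := by
      have h4 : ∀ w, (I.2 w : ℝ) * |(x + EuclideanSpace.single v s : EuclideanSpace ℝ (Fin n)) w -
          xstar I w| ≤ I.2 w * |x w - xstar I w| + if w = v then (I.2 w : ℝ) else 0 := by
        intro w
        by_cases hw : w = v
        · subst hw
          have h5 := abs_add_le (x w - xstar I w) s
          rw [hs] at h5
          have h6 : (0 : ℝ) ≤ I.2 w := Nat.cast_nonneg _
          simp only [PiLp.add_apply, PiLp.single_apply, if_true]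
          rw [show x w + s - xstar I w = x w - xstar I w + s by ring]
          nlinarith
        · simp [hw]
      unfold dualLoss bSeminorm
      refine (Finset.sum_le_sum fun w _ => h4 w).trans ?_
      rw [Finset.sum_add_distrib, Finset.sum_ite_eq']
      simp
    linarith
  rw [_root_.abs_le]
  have h1 := key 1 (by simp)
  have h2 := key (-1) (by simp)
  constructor <;> linarith

/-- Euclidean projections to convex sets do not increase distances to points of the set. -/
theorem IsProjection.norm_sub_le {X : Set (EuclideanSpace ℝ (Fin n))} (hX : Convex ℝ X)
    {z p u : EuclideanSpace ℝ (Fin n)} (h : IsProjection X z p) (hu : u ∈ X) :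
    ‖p - u‖ ^ 2 ≤ ‖z - u‖ ^ 2 := by
  have hbdd : BddBelow (Set.range fun w : X => ‖z - w‖) :=
    ⟨0, by rintro _ ⟨w, rfl⟩; exact norm_nonneg _⟩
  have : Nonempty X := ⟨⟨p, h.1⟩⟩
  have h1 : ‖z - p‖ = ⨅ w : X, ‖z - w‖ :=
    le_antisymm (le_ciInf fun w => h.2 w w.2) (ciInf_le hbdd ⟨p, h.1⟩)
  have h2 := (norm_eq_iInf_iff_real_inner_le_zero hX h.1).1 h1 u hu
  have h3 : z - u = (z - p) - (u - p) := by abel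
  rw [h3, norm_sub_sq_real (z - p), norm_sub_rev p u]
  nlinarith [sq_nonneg ‖z - p‖]

theorem convex_box (C : ℝ) : Convex ℝ {z : EuclideanSpace ℝ (Fin n) | ∀ v, |z v| ≤ C} := by
  have : {z : EuclideanSpace ℝ (Fin n) | ∀ v, |z v| ≤ C} =
      ⋂ v, {z : EuclideanSpace ℝ (Fin n) | |z v| ≤ C} := by ext; simp
  rw [this]
  refine convex_iInter fun v x hx y hy a b ha hb hab => ?_
  simp only [Set.mem_ofPred_eq, PiLp.add_apply, PiLp.smul_apply, smul_eq_mul] at *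
  calc |a * x v + b * y v| ≤ |a * x v| + |b * y v| := abs_add_le _ _
    _ = a * |x v| + b * |y v| := by rw [abs_mul, abs_mul, abs_of_nonneg ha, abs_of_nonneg hb]
    _ ≤ a * C + b * C := by gcongr
    _ = C := by rw [← add_mul, hab, one_mul]

theorem norm_sq_le {z : EuclideanSpace ℝ (Fin n)} {A : ℝ} (h : ∀ v, |z v| ≤ A) :
    ‖z‖ ^ 2 ≤ n * A ^ 2 := by
  rw [EuclideanSpace.real_norm_sq_eq]
  calc ∑ v, z v ^ 2 ≤ ∑ _v : Fin n, A ^ 2 := Finset.sum_le_sum fun v _ => by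
        rw [← sq_abs]; exact pow_le_pow_left₀ (abs_nonneg _) (h v) 2
    _ = n * A ^ 2 := by simp

/-- One step of subgradient descent. -/
theorem inner_le_of_step {x g u : EuclideanSpace ℝ (Fin n)} {α : ℝ} (hα : 0 < α) :
    inner ℝ g (x - u) = (‖x - u‖ ^ 2 - ‖x - α • g - u‖ ^ 2) / (2 * α) + α / 2 * ‖g‖ ^ 2 := by
  have h : x - α • g - u = (x - u) - α • g := by abel
  rw [h, norm_sub_sq_real (x - u), norm_smul, Real.norm_of_nonneg hα.le, inner_smul_right,
    real_inner_comm g (x - u)]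
  field_simp
  ring

/-- The regret of projected subgradient descent with step size `α`. -/
theorem regret_ogd_le {C B α : ℝ} {T : ℕ} (hα : 0 < α)
    {xstar : BInstance n m → Fin n → ℤ} {I : ℕ → BInstance n m}
    (hB : ∀ t < T, ∀ v, ((I t).2 v : ℝ) ≤ B) {x : ℕ → EuclideanSpace ℝ (Fin n)}
    (hx : IsOGDRun {z | ∀ v, |z v| ≤ C} α T (fun t z => dualLoss xstar (I t) z) x)
    {u : EuclideanSpace ℝ (Fin n)} (hu : ∀ v, |u v| ≤ C) :
    ∑ t ∈ Finset.range T, (dualLoss xstar (I t) (x t) - dualLoss xstar (I t) u) ≤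
      n * C ^ 2 / (2 * α) + T * (α / 2 * (n * B ^ 2)) := by
  have step : ∀ t < T, ∀ g, IsSubgradient (fun z : EuclideanSpace ℝ (Fin n) =>
      dualLoss xstar (I t) z) (x t) g → dualLoss xstar (I t) (x t) - dualLoss xstar (I t) u ≤
      (‖x t - u‖ ^ 2 - ‖x t - α • g - u‖ ^ 2) / (2 * α) + α / 2 * (n * B ^ 2) := by
    intro t ht g hg
    have h1 := hg u
    have h2 : ‖g‖ ^ 2 ≤ n * B ^ 2 := norm_sq_le fun v => (hg.abs_le v).trans (hB t ht v)
    have h3 : inner ℝ g (u - x t) = -inner ℝ g (x t - u) := by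
      rw [← neg_sub, inner_neg_right]
    rw [h3, inner_le_of_step hα] at h1
    have h4 := mul_le_mul_of_nonneg_left h2 (half_pos hα).le
    linarith
  have hsum : ∀ k, k + 1 ≤ T →
      ∑ t ∈ Finset.range k, (dualLoss xstar (I t) (x t) - dualLoss xstar (I t) u) ≤
        (‖x 0 - u‖ ^ 2 - ‖x k - u‖ ^ 2) / (2 * α) + k * (α / 2 * (n * B ^ 2)) := by
    intro k
    induction k with
    | zero => simp
    | succ k ih =>
      intro hk
      obtain ⟨g, hg, hp⟩ := hx.2 k (by omega)
      have h1 := step k (by omega) g hg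
      have h2 := hp.norm_sub_le (convex_box C) hu
      have h3 : (‖x k - u‖ ^ 2 - ‖x k - α • g - u‖ ^ 2) / (2 * α) ≤
          (‖x k - u‖ ^ 2 - ‖x (k + 1) - u‖ ^ 2) / (2 * α) := by gcongr
      rw [Finset.sum_range_succ, Nat.cast_succ, add_mul, one_mul]
      have h4 := ih (by omega)
      have h5 : (‖x 0 - u‖ ^ 2 - ‖x (k + 1) - u‖ ^ 2) / (2 * α) =
        (‖x 0 - u‖ ^ 2 - ‖x k - u‖ ^ 2) / (2 * α) +
          (‖x k - u‖ ^ 2 - ‖x (k + 1) - u‖ ^ 2) / (2 * α) := by ring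
      linarith
  rcases T with _ | T
  · simp; positivity
  · have h1 := hsum T le_rfl
    -- an explicit subgradient for the last action, from which no step is made
    have hsub : IsSubgradient (fun z : EuclideanSpace ℝ (Fin n) => dualLoss xstar (I T) z) (x T)
        (WithLp.toLp 2 fun v => ((I T).2 v * SignType.sign (x T v - xstar (I T) v) : ℝ)) := by
      intro z
      have h2 := bSeminorm_subgradient (I T).2 (x T) z fun v => (xstar (I T) v : ℝ)
      have h3 : inner ℝ (WithLp.toLp 2 fun v =>
          ((I T).2 v * SignType.sign (x T v - xstar (I T) v) : ℝ))
          (z - x T) = - ∑ v,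
              ((I T).2 v * SignType.sign (x T v - xstar (I T) v) : ℝ) * (x T v - z v) := by
        rw [PiLp.inner_apply, ← Finset.sum_neg_distrib]
        refine Finset.sum_congr rfl fun v _ => ?_
        simp; ring
      rw [h3]
      unfold dualLoss
      linarith
    have h2 := step T (Nat.lt_succ_self _) _ hsub
    have h3 : ‖x 0 - u‖ ^ 2 ≤ n * C ^ 2 := by
      rw [hx.1, zero_sub, norm_neg]; exact norm_sq_le hu
    have h4 : ∀ {a b c : ℝ}, 0 ≤ b → c ≤ n * C ^ 2 → (c - a) / (2 * α) + (a - b) / (2 * α) ≤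
        n * C ^ 2 / (2 * α) := fun {a b c} hb hc => by
      rw [← add_div]; gcongr; linarith
    have h5 := h4 (sq_nonneg ‖x T - α • (WithLp.toLp 2 fun v => ((I T).2 v *
      SignType.sign (x T v - xstar (I T) v) : ℝ)) - u‖) h3 (a := ‖x T - u‖ ^ 2)
    rw [Finset.sum_range_succ, Nat.cast_succ, add_mul, one_mul]
    linarith

/-- The step size `C / (B * √T)` balances the two terms of the regret bound. -/
theorem exists_ogd_step_size : ∀ (C B : ℝ) (T : ℕ), 0 ≤ C → 0 ≤ B → ∃ α : ℝ, 0 < α ∧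
      ∀ (n m : ℕ), 3 ≤ n → 1 ≤ m →
      ∀ (G : BipartiteGraph n m) (xstar : BInstance n m → Fin n → ℤ), G.IsDualSelection xstar →
      ∀ I : ℕ → BInstance n m, (∀ t < T, G.IsAdmissible C B (I t)) →
      ∀ x : ℕ → EuclideanSpace ℝ (Fin n),
        IsOGDRun {z | ∀ v, |z v| ≤ C} α T (fun t z => dualLoss xstar (I t) z) x →
      ∀ u : EuclideanSpace ℝ (Fin n), (∀ v, |u v| ≤ C) →
        ∑ t ∈ Finset.range T, (dualLoss xstar (I t) (x t) - dualLoss xstar (I t) u) ≤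
          C * B * n * √(2 * T) := by
  intro C B T hC hB
  -- for `C = 0` or `B = 0` the formula for the step size is not positive, but the regret vanishes
  rcases hC.eq_or_lt with rfl | hC'
  · refine ⟨1, one_pos, fun n m _ _ G xstar _ I _ x hx u hu => ?_⟩
    have hu0 : u = 0 := by ext v; simpa using hu v
    have hx0 : ∀ t < T, x t = 0 := fun t ht => by
      cases t with
      | zero => exact hx.1
      | succ t =>
        obtain ⟨g, -, hp⟩ := hx.2 t ht
        ext v; simpa using hp.1 v
    rw [Finset.sum_eq_zero fun t ht => by rw [hx0 t (Finset.mem_range.1 ht), hu0, sub_self]]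
    simp
  rcases hB.eq_or_lt with rfl | hB'
  · refine ⟨1, one_pos, fun n m _ _ G xstar _ I hI x hx u hu => ?_⟩
    have hb : ∀ t < T, ∀ v, (I t).2 v = 0 := fun t ht v => by
      have := (hI t ht).2.1 v
      exact_mod_cast le_antisymm this (Nat.cast_nonneg _)
    rw [Finset.sum_eq_zero fun t ht => by
      have h1 := hb t (Finset.mem_range.1 ht)
      rw [dualLoss, dualLoss, bSeminorm_eq_zero h1, bSeminorm_eq_zero h1, sub_self]]
    simp
  rcases Nat.eq_zero_or_pos T with rfl | hT
  · exact ⟨1, one_pos, fun n m _ _ G xstar _ I hI x hx u hu => by simp⟩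
  have hT' : (0 : ℝ) < T := by exact_mod_cast hT
  have hsq : 0 < √(T : ℝ) := Real.sqrt_pos.2 hT'
  have hα : 0 < C / (B * √T) := by positivity
  refine ⟨C / (B * √T), hα, fun n m _ _ G xstar _ I hI x hx u hu => ?_⟩
  refine (regret_ogd_le hα (fun t ht v => (hI t ht).2.1 v) hx hu).trans ?_
  have h1 : √(T : ℝ) ≤ √(2 * T) := Real.sqrt_le_sqrt (by linarith)
  have h2 : (n : ℝ) * C ^ 2 / (2 * (C / (B * √T))) + T * (C / (B * √T) / 2 * (n * B ^ 2)) =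
      C * B * n * √T := by
    have h3 : (T : ℝ) = √T * √T := (Real.mul_self_sqrt hT'.le).symm
    have h4 : (T : ℝ) * (C / (B * √T) / 2 * (n * B ^ 2)) = √T * C * B * n / 2 := by
      nth_rewrite 1 [h3]; field_simp
    rw [h4]; field_simp; ring
  rw [h2]
  gcongr

end OGD

/-! ### An exponential moment bound for adapted sequences -/

section Adapted

variable {α : Type*} [Inhabited α]

/-- A finite sequence, continued by a default value. -/
def seqOf {T : ℕ} (S : Fin T → α) (t : ℕ) : α := if h : t < T then S ⟨t, h⟩ else default

theorem seqOf_of_lt {T t : ℕ} (S : Fin T → α) (h : t < T) : seqOf S t = S ⟨t, h⟩ := dif_pos h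

theorem seqOf_insertNth_last {T t : ℕ} (S : Fin T → α) (a : α) (h : t < T) :
    seqOf ((Fin.last T).insertNth (α := fun _ => α) a S) t = seqOf S t := by
  rw [seqOf_of_lt _ (Nat.lt_succ_of_lt h), seqOf_of_lt _ h, Fin.insertNth_last']
  exact Fin.snoc_castSucc (α := fun _ => α) a S ⟨t, h⟩

theorem seqOf_insertNth_last_self {T : ℕ} (S : Fin T → α) (a : α) :
    seqOf ((Fin.last T).insertNth (α := fun _ => α) a S) T = a := by
  rw [seqOf_of_lt _ (Nat.lt_succ_self T), Fin.insertNth_last']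
  exact Fin.snoc_last (α := fun _ => α) a S

/-- The expectation of a product of factors `Ψ I t (I t)`, where the function `Ψ I t` depends only
on the terms of `I` before `t`. -/
theorem lintegral_prod_adapted_le [MeasurableSpace α] [Countable α] [MeasurableSingletonClass α]
    (D : Measure α) [IsProbabilityMeasure D] (Ψ : (ℕ → α) → ℕ → α → ENNReal)
    (hΨ : ∀ I J t, (∀ i < t, I i = J i) → Ψ I t = Ψ J t) {κ : ENNReal}
    (hκ : ∀ I t, ∫⁻ a, Ψ I t a ∂D ≤ κ) (T : ℕ) :
    ∫⁻ S : Fin T → α, ∏ t ∈ Finset.range T, Ψ (seqOf S) t (seqOf S t) ∂Measure.pi (fun _ => D) ≤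
      κ ^ T := by
  induction T with
  | zero => simp
  | succ T ih =>
    have hmp := (measurePreserving_piFinSuccAbove (fun _ : Fin (T + 1) => D) (Fin.last T)).symm
    rw [← hmp.lintegral_comp (Measurable.of_discrete), lintegral_prod_symm _
      (Measurable.of_discrete).aemeasurable]
    refine le_trans (b := ∫⁻ S : Fin T → α, (∏ t ∈ Finset.range T, Ψ (seqOf S) t (seqOf S t)) * κ
      ∂Measure.pi fun _ => D) (lintegral_mono fun S => ?_) ?_
    · have h1 : ∀ a, ∏ t ∈ Finset.range (T + 1), Ψ (seqOf ((MeasurableEquiv.piFinSuccAbove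
          (fun _ : Fin (T + 1) => α) (Fin.last T)).symm (a, S))) t
          (seqOf ((MeasurableEquiv.piFinSuccAbove
          (fun _ : Fin (T + 1) => α) (Fin.last T)).symm (a, S)) t) =
          (∏ t ∈ Finset.range T, Ψ (seqOf S) t (seqOf S t)) * Ψ (seqOf S) T a := by
        intro a
        rw [show (MeasurableEquiv.piFinSuccAbove (fun _ : Fin (T + 1) => α) (Fin.last T)).symm
            (a, S)
          = (Fin.last T).insertNth (α := fun _ => α) a S from rfl, Finset.prod_range_succ,
          seqOf_insertNth_last_self]
        congr 1
        · refine Finset.prod_congr rfl fun t ht => ?_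
          rw [Finset.mem_range] at ht
          rw [seqOf_insertNth_last S a ht, hΨ _ (seqOf S) t fun i hi =>
            seqOf_insertNth_last S a (hi.trans ht)]
        · rw [hΨ _ (seqOf S) T fun i hi => seqOf_insertNth_last S a hi]
      simp only [h1]
      rw [lintegral_const_mul _ Measurable.of_discrete]
      gcongr
      exact hκ _ _
    · rw [lintegral_mul_const _ Measurable.of_discrete, pow_succ]
      gcongr

end Adapted

/-! ### Integer subgradient descent in one coordinate -/

section Coord

/-- The sign of an integer. -/
def sgn (z : ℤ) : ℤ := (if 0 < z then 1 else 0) - if z < 0 then 1 else 0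

/-- The projection of `z` to `[-R, R]`. -/
def clamp (R z : ℤ) : ℤ := max (-R) (min R z)

/-- Projected subgradient descent on the functions `b t * |X - q * d t|`, over `[-C * q, C * q]`,
with step size `C`. -/
def ogdCoord (C q : ℕ) (b : ℕ → ℕ) (d : ℕ → ℤ) : ℕ → ℤ
  | 0 => 0
  | t + 1 => clamp (C * q) (ogdCoord C q b d t - C * b t * sgn (ogdCoord C q b d t - q * d t))

variable {C q B : ℕ} {b b' : ℕ → ℕ} {d d' : ℕ → ℤ}

theorem ogdCoord_congr {t : ℕ} (hb : ∀ i < t, b i = b' i) (hd : ∀ i < t, d i = d' i) :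
    ogdCoord C q b d t = ogdCoord C q b' d' t := by
  induction t with
  | zero => rfl
  | succ t ih =>
    rw [ogdCoord, ogdCoord, ih (fun i hi => hb i (by omega)) fun i hi => hd i (by omega),
      hb t (by omega), hd t (by omega)]

theorem abs_clamp_le {R : ℤ} (hR : 0 ≤ R) (z : ℤ) : |clamp R z| ≤ R := by
  unfold clamp; rw [abs_le]; constructor <;> omega

theorem abs_ogdCoord_le (t : ℕ) : |ogdCoord C q b d t| ≤ (C * q : ℕ) := by
  cases t with
  | zero => simp [ogdCoord]; positivity
  | succ t => rw [ogdCoord]; push_cast; exact abs_clamp_le (by positivity) _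

theorem clamp_sub_sq_le {R : ℤ} {U : ℝ} (hU : |U| ≤ R) (z : ℤ) :
    ((clamp R z : ℤ) - U) ^ 2 ≤ ((z : ℝ) - U) ^ 2 := by
  obtain ⟨h1, h2⟩ := abs_le.1 hU
  have hR : -R ≤ R := by
    have : -(R : ℝ) ≤ R := h1.trans h2
    exact_mod_cast this
  unfold clamp
  rw [sq_le_sq]
  rcases le_total z (-R) with h | h
  · have h3 : (z : ℝ) ≤ -R := by exact_mod_cast h
    rw [max_eq_left (by omega)]
    push_cast
    rw [abs_of_nonpos (by linarith), abs_of_nonpos (by linarith)]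
    linarith
  · rcases le_total R z with h' | h'
    · have h3 : (R : ℝ) ≤ z := by exact_mod_cast h'
      rw [min_eq_left h', max_eq_right hR]
      rw [abs_of_nonneg (by linarith), abs_of_nonneg (by linarith)]
      linarith
    · rw [min_eq_right h', max_eq_right h]

theorem sgn_subgradient (X z : ℤ) (U : ℝ) :
    |(X : ℝ) - z| - |U - z| ≤ sgn (X - z) * (X - U) := by
  unfold sgn
  rcases lt_trichotomy (X - z) 0 with h | h | h
  · have h' : (X : ℝ) - z < 0 := by exact_mod_cast h
    have := neg_le_abs (U - z)
    rw [if_neg h.not_gt, if_pos h, abs_of_neg h']; push_cast; linarith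
  · have h' : (X : ℝ) - z = 0 := by exact_mod_cast h
    simp [h, h']
  · have h' : 0 < (X : ℝ) - z := by exact_mod_cast h
    have := le_abs_self (U - z)
    rw [if_pos h, if_neg h.not_gt, abs_of_pos h']; push_cast; linarith

theorem sgn_sq_le (z : ℤ) : (sgn z : ℝ) ^ 2 ≤ 1 := by
  unfold sgn; split_ifs <;> norm_num

theorem ogdCoord_regret {T : ℕ} {U : ℝ} (hU : |U| ≤ (C * q : ℕ)) (hb : ∀ t < T, b t ≤ B) :
    2 * C * ∑ t ∈ Finset.range T, (b t : ℝ) * (|(ogdCoord C q b d t : ℝ) - q * d t| - |U - q * d t|)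
      ≤ U ^ 2 - (ogdCoord C q b d T - U) ^ 2 + T * (C * B) ^ 2 := by
  induction T with
  | zero => simp [ogdCoord]
  | succ T ih =>
    set X := ogdCoord C q b d T with hX
    have h1 := ih fun t ht => hb t (by omega)
    have h2 := clamp_sub_sq_le (R := C * q) (by exact_mod_cast hU)
      (X - C * b T * sgn (X - q * d T))
    have h3 := sgn_subgradient X (q * d T) U
    have h4 := sgn_sq_le (X - q * d T)
    have h5 : (b T : ℝ) ≤ B := by exact_mod_cast hb T (Nat.lt_succ_self T)
    rw [Finset.sum_range_succ, ogdCoord, ← hX]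
    push_cast at h2 h3 ⊢
    set s : ℝ := ((sgn (X - q * d T) : ℤ) : ℝ) with hs
    have h6 : (C : ℝ) * b T * (|(X : ℝ) - q * d T| - |U - q * d T|) ≤ C * b T * (s * (X - U)) :=
      mul_le_mul_of_nonneg_left h3 (by positivity)
    have h7 : ((C : ℝ) * b T) ^ 2 * s ^ 2 ≤ (C * B) ^ 2 * 1 := by gcongr
    nlinarith

end Coord

/-! ### From regret to a guarantee for independent samples -/

section Learning

variable {n m : ℕ} {G : BipartiteGraph n m} {xstar : BInstance n m → Fin n → ℤ} {C B T : ℕ}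

/-- The common denominator of the actions of subgradient descent. The step `C / q` is of the order
of the optimal step size `C / (B * √T)`. -/
def ogdScale (B T : ℕ) : ℕ := (B + 1) * (Nat.sqrt T + 1)

theorem ogdScale_pos : 0 < ogdScale B T := Nat.mul_pos (Nat.succ_pos _) (Nat.succ_pos _)

/-- The numerator of coordinate `v` of the action at time `t`. -/
def ogdNum (C q : ℕ) (xstar : BInstance n m → Fin n → ℤ) (I : ℕ → BInstance n m) (v : Fin n)
    (t : ℕ) : ℤ :=
  ogdCoord C q (fun s => (I s).2 v) (fun s => xstar (I s) v) t

/-- The action of subgradient descent at time `t`. -/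
noncomputable def ogdPoint (C q : ℕ) (xstar : BInstance n m → Fin n → ℤ) (I : ℕ → BInstance n m)
    (t : ℕ) (v : Fin n) : ℝ :=
  (ogdNum C q xstar I v t : ℝ) / q

/-- The denominator of the output; the summand 1 for `T = 0` makes it positive. -/
def ogdDen (B T : ℕ) : ℕ := ogdScale B T * T + if T = 0 then 1 else 0

theorem ogdDen_pos : 0 < ogdDen B T := by
  unfold ogdDen
  split_ifs with h
  · exact Nat.succ_pos _
  · exact Nat.mul_pos ogdScale_pos (Nat.pos_of_ne_zero h)

/-- The average of the actions of subgradient descent on the samples. -/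
noncomputable def ogdAverage (C B : ℕ) (xstar : BInstance n m → Fin n → ℤ)
    (S : Fin T → BInstance n m) (v : Fin n) : ℝ :=
  ((∑ t ∈ Finset.range T, ogdNum C (ogdScale B T) xstar (seqOf S) v t : ℤ) : ℝ) / (ogdDen B T : ℝ)

theorem ogdPoint_congr {q : ℕ} {I J : ℕ → BInstance n m} {t : ℕ} (h : ∀ i < t, I i = J i) :
    ogdPoint C q xstar I t = ogdPoint C q xstar J t := by
  funext v
  rw [ogdPoint, ogdPoint, ogdNum, ogdNum, ogdCoord_congr (fun i hi => by rw [h i hi])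
    fun i hi => by rw [h i hi]]

theorem abs_ogdPoint_le {q : ℕ} (hq : 0 < q) (I : ℕ → BInstance n m) (t : ℕ) (v : Fin n) :
    |ogdPoint C q xstar I t v| ≤ C := by
  have hq' : (0 : ℝ) < q := by exact_mod_cast hq
  rw [ogdPoint, abs_div, Nat.abs_cast, div_le_iff₀ hq']
  exact_mod_cast abs_ogdCoord_le (C := C) (q := q) t

theorem dualLoss_sub_le {I : BInstance n m} (hB : ∀ v, I.2 v ≤ B) (x u : Fin n → ℝ) :
    |dualLoss xstar I x - dualLoss xstar I u| ≤ B * ∑ v, |x v - u v| := by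
  unfold dualLoss bSeminorm
  rw [← Finset.sum_sub_distrib, Finset.mul_sum]
  refine (Finset.abs_sum_le_sum_abs _ _).trans (Finset.sum_le_sum fun v _ => ?_)
  rw [← mul_sub, abs_mul, Nat.abs_cast]
  have h1 := abs_abs_sub_abs_le_abs_sub (x v - xstar I v) (u v - xstar I v)
  rw [sub_sub_sub_cancel_right] at h1
  have h2 : (I.2 v : ℝ) ≤ B := by exact_mod_cast hB v
  exact mul_le_mul h2 h1 (abs_nonneg _) (by positivity)

theorem sum_abs_sub_le {x u : Fin n → ℝ} (hx : ∀ v, |x v| ≤ C) (hu : ∀ v, |u v| ≤ C) :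
    ∑ v, |x v - u v| ≤ 2 * (C * n) := by
  calc ∑ v, |x v - u v| ≤ ∑ _v : Fin n, (2 * C : ℝ) := Finset.sum_le_sum fun v _ => by
        have := abs_sub (x v) (u v)
        linarith [hx v, hu v]
    _ = _ := by simp; ring

/-- The regret of subgradient descent on the samples. -/
theorem ogdPoint_regret (hC : 1 ≤ C) (hB : 1 ≤ B) (hT : 1 ≤ T) {I : ℕ → BInstance n m}
    (hI : ∀ t < T, ∀ v, (I t).2 v ≤ B) {u : Fin n → ℝ} (hu : ∀ v, |u v| ≤ C) :
    ∑ t ∈ Finset.range T, (dualLoss xstar (I t) (ogdPoint C (ogdScale B T) xstar I t) -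
      dualLoss xstar (I t) u) ≤ 5 / 2 * (C * B * n) * √T := by
  set q := ogdScale B T with hq
  have hq0 : (0 : ℝ) < q := by exact_mod_cast (ogdScale_pos : 0 < ogdScale B T)
  have hC0 : (0 : ℝ) < C := by exact_mod_cast hC
  have hB1 : (1 : ℝ) ≤ B := by exact_mod_cast hB
  have hT1 : (1 : ℝ) ≤ T := by exact_mod_cast hT
  have coord : ∀ v, 2 * C * (q * ∑ t ∈ Finset.range T, ((I t).2 v : ℝ) *
      (|ogdPoint C q xstar I t v - xstar (I t) v| - |u v - xstar (I t) v|)) ≤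
      C ^ 2 * (q ^ 2 + T * B ^ 2) := by
    intro v
    have hU : |(q : ℝ) * u v| ≤ (C * q : ℕ) := by
      rw [abs_mul, Nat.abs_cast]; push_cast; nlinarith [hu v]
    have h1 := ogdCoord_regret (d := fun s => xstar (I s) v) hU (fun t ht => hI t ht v)
    have h2 : ∀ t, ((I t).2 v : ℝ) * (|(ogdCoord C q (fun s => (I s).2 v)
        (fun s => xstar (I s) v) t : ℝ)
        - q * xstar (I t) v| - |q * u v - q * xstar (I t) v|) = q * (((I t).2 v : ℝ) *
        (|ogdPoint C q xstar I t v - xstar (I t) v| - |u v - xstar (I t) v|)) := by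
      intro t
      have h3 : (ogdCoord C q (fun s => (I s).2 v) (fun s => xstar (I s) v) t : ℝ) =
          q * ogdPoint C q xstar I t v := by
        rw [ogdPoint, ogdNum]; field_simp
      rw [h3, ← mul_sub, ← mul_sub, abs_mul, abs_mul, abs_of_pos hq0]
      ring
    simp only [h2, ← Finset.mul_sum] at h1
    have h4 : (q * u v) ^ 2 ≤ ((C * q : ℕ) : ℝ) ^ 2 := by
      rw [← sq_abs]; exact pow_le_pow_left₀ (abs_nonneg _) hU 2
    push_cast at h4
    nlinarith [sq_nonneg ((ogdCoord C q (fun s => (I s).2 v)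
        (fun s => xstar (I s) v) T : ℝ) - q * u v)]
  have hsum : 2 * C * (q * ∑ t ∈ Finset.range T, (dualLoss xstar (I t) (ogdPoint C q xstar I t) -
      dualLoss xstar (I t) u)) ≤ n * (C ^ 2 * (q ^ 2 + T * B ^ 2)) := by
    have h1 : ∑ t ∈ Finset.range T, (dualLoss xstar (I t) (ogdPoint C q xstar I t) -
        dualLoss xstar (I t) u) = ∑ v, ∑ t ∈ Finset.range T, ((I t).2 v : ℝ) *
        (|ogdPoint C q xstar I t v - xstar (I t) v| - |u v - xstar (I t) v|) := by
      rw [Finset.sum_comm]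
      simp only [dualLoss, bSeminorm, ← Finset.sum_sub_distrib, mul_sub]
    rw [h1, Finset.mul_sum, Finset.mul_sum]
    refine (Finset.sum_le_sum fun v _ => coord v).trans ?_
    simp
  set s := √(T : ℝ) with hs
  have hs1 : 1 ≤ s := Real.one_le_sqrt.2 hT1
  have hss : s * s = T := Real.mul_self_sqrt (by linarith)
  have hq1 : B * s ≤ q := by
    have h1 : T ≤ (Nat.sqrt T + 1) ^ 2 := (Nat.lt_succ_sqrt' T).le
    have h2 : s ≤ Nat.sqrt T + 1 := by
      rw [hs, Real.sqrt_le_left (by positivity)]; exact_mod_cast h1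
    rw [hq, ogdScale]; push_cast
    exact mul_le_mul (by linarith) h2 (by positivity) (by positivity)
  have hq2 : q ≤ 4 * B * s := by
    have h1 : (Nat.sqrt T : ℝ) ≤ s := Real.nat_sqrt_le_real_sqrt
    rw [hq, ogdScale]; push_cast
    calc ((B : ℝ) + 1) * (Nat.sqrt T + 1) ≤ (2 * B) * (2 * s) := by gcongr <;> linarith
      _ = _ := by ring
  have h5 : (n : ℝ) * (C ^ 2 * (q ^ 2 + T * B ^ 2)) ≤ 2 * C * (q * (5 / 2 * (C * B * n) * s)) := by
    have h6 : (q : ℝ) ^ 2 ≤ q * (4 * B * s) := by rw [sq]; gcongr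
    have h7 : (T : ℝ) * B ^ 2 ≤ q * (B * s) := by
      rw [← hss]
      calc s * s * (B : ℝ) ^ 2 = (B * s) * (B * s) := by ring
        _ ≤ _ := by gcongr
    calc (n : ℝ) * (C ^ 2 * (q ^ 2 + T * B ^ 2)) ≤
        n * (C ^ 2 * (q * (4 * B * s) + q * (B * s))) := by
          gcongr
      _ = _ := by ring
  have h8 := hsum.trans h5
  rw [← mul_assoc, ← mul_assoc] at h8
  exact le_of_mul_le_mul_left h8 (by positivity)

variable {D : Measure (BInstance n m)} [IsProbabilityMeasure D]

/-- There are only finitely many admissible instances, so every function is integrable. -/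
theorem integrable_of_admissible (hD : ∀ᵐ I ∂D, G.IsAdmissible C B I) (f : BInstance n m → ℝ) :
    Integrable f D := by
  have hfin := (Set.finite_Icc (0 : Fin m → ℕ) fun _ => C).prod
    (Set.finite_Icc (0 : Fin n → ℕ) fun _ => B)
  refine Integrable.of_bound (C := ∑ I ∈ hfin.toFinset, |f I|)
    Measurable.of_discrete.aestronglyMeasurable ?_
  filter_upwards [hD] with I hI
  rw [Real.norm_eq_abs]
  refine Finset.single_le_sum (f := fun I => |f I|) (fun _ _ => abs_nonneg _) ?_
  rw [Set.Finite.mem_toFinset]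
  exact ⟨⟨fun _ => Nat.zero_le _, fun e => by exact_mod_cast hI.1 e⟩,
    fun _ => Nat.zero_le _, fun v => by exact_mod_cast hI.2.1 v⟩

/-- The expected loss. -/
noncomputable def meanLoss (D : Measure (BInstance n m)) (xstar : BInstance n m → Fin n → ℤ)
    (x : Fin n → ℝ) : ℝ := ∫ I, dualLoss xstar I x ∂D

theorem meanLoss_sub (hD : ∀ᵐ I ∂D, G.IsAdmissible C B I) (x u : Fin n → ℝ) :
    meanLoss D xstar x - meanLoss D xstar u =
      ∫ I, (dualLoss xstar I x - dualLoss xstar I u) ∂D :=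
  (integral_sub (integrable_of_admissible hD _) (integrable_of_admissible hD _)).symm

/-- The expected loss is continuous, so it has a minimizer in the box. -/
theorem exists_meanLoss_min (hD : ∀ᵐ I ∂D, G.IsAdmissible C B I) :
    ∃ u : Fin n → ℝ, (∀ v, |u v| ≤ C) ∧ ∀ x : Fin n → ℝ, (∀ v, |x v| ≤ C) →
      meanLoss D xstar u ≤ meanLoss D xstar x := by
  have hlip : LipschitzWith ((B * n : ℕ) : NNReal) (meanLoss D xstar) := by
    refine LipschitzWith.of_dist_le_mul fun x y => ?_
    rw [Real.dist_eq, meanLoss_sub hD]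
    have h1 : ∀ᵐ I ∂D, ‖dualLoss xstar I x - dualLoss xstar I y‖ ≤ B * ∑ v, |x v - y v| := by
      filter_upwards [hD] with I hI
      exact dualLoss_sub_le (fun v => by exact_mod_cast hI.2.1 v) x y
    have h2 := norm_integral_le_of_norm_le_const h1
    rw [Real.norm_eq_abs, probReal_univ, mul_one] at h2
    refine h2.trans ?_
    have h3 : ∑ v, |x v - y v| ≤ n * dist x y := by
      calc ∑ v, |x v - y v| ≤ ∑ _v : Fin n, dist x y :=
            Finset.sum_le_sum fun v _ => by rw [← Real.dist_eq]; exact dist_le_pi_dist x y v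
        _ = _ := by simp
    push_cast
    rw [mul_assoc]
    gcongr
  have hcpt : IsCompact (Set.Icc (fun _ : Fin n => -(C : ℝ)) fun _ => (C : ℝ)) := isCompact_Icc
  obtain ⟨u, hu, hmin⟩ := hcpt.exists_isMinOn
    ⟨0, fun _ => by simp, fun _ => by simp⟩ hlip.continuous.continuousOn
  exact ⟨u, fun v => abs_le.2 ⟨hu.1 v, hu.2 v⟩, fun x hx =>
    hmin ⟨fun v => (abs_le.1 (hx v)).1, fun v => (abs_le.1 (hx v)).2⟩⟩

/-- The expected loss is convex. -/
theorem meanLoss_average_le (hD : ∀ᵐ I ∂D, G.IsAdmissible C B I) (hT : 1 ≤ T)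
    (S : Fin T → BInstance n m) :
    T * meanLoss D xstar (ogdAverage C B xstar S) ≤
      ∑ t ∈ Finset.range T, meanLoss D xstar (ogdPoint C (ogdScale B T) xstar (seqOf S) t) := by
  have hq0 : (0 : ℝ) < ogdScale B T := by exact_mod_cast (ogdScale_pos : 0 < ogdScale B T)
  have hT0 : (0 : ℝ) < T := by exact_mod_cast hT
  unfold meanLoss
  rw [← integral_const_mul, ← integral_finsetSum _ fun t _ => integrable_of_admissible hD _]
  refine integral_mono (integrable_of_admissible hD _) (integrable_of_admissible hD _) fun I => ?_
  simp only [dualLoss, bSeminorm]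
  rw [Finset.mul_sum, Finset.sum_comm]
  refine Finset.sum_le_sum fun v _ => ?_
  rw [← Finset.mul_sum, mul_left_comm]
  refine mul_le_mul_of_nonneg_left ?_ (Nat.cast_nonneg _)
  have h1 : (T : ℝ) * (ogdAverage C B xstar S v - xstar I v) =
      ∑ t ∈ Finset.range T, (ogdPoint C (ogdScale B T) xstar (seqOf S) t v - xstar I v) := by
    rw [Finset.sum_sub_distrib, Finset.sum_const, Finset.card_range, nsmul_eq_mul, mul_sub]
    congr 1
    simp only [ogdPoint, ← Finset.sum_div]
    rw [ogdAverage, ogdDen, if_neg (by omega)]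
    push_cast
    field_simp
    ring
  calc (T : ℝ) * |ogdAverage C B xstar S v - xstar I v|
      = |(T : ℝ) * (ogdAverage C B xstar S v - xstar I v)| := by rw [abs_mul, abs_of_pos hT0]
    _ ≤ _ := by rw [h1]; exact Finset.abs_sum_le_sum_abs _ _

/-- Hoeffding's lemma for the deviation of the loss difference from its mean. -/
theorem lintegral_exp_deviation_le (hD : ∀ᵐ I ∂D, G.IsAdmissible C B I) {x u : Fin n → ℝ}
    (hx : ∀ v, |x v| ≤ C) (hu : ∀ v, |u v| ≤ C) (r : ℝ) :
    ∫⁻ I, ENNReal.ofReal (Real.exp (r * (meanLoss D xstar x - meanLoss D xstar u -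
      (dualLoss xstar I x - dualLoss xstar I u)))) ∂D ≤
      ENNReal.ofReal (Real.exp (2 * (C * B * n : ℝ) ^ 2 * r ^ 2)) := by
  set A : ℝ := C * B * n with hA
  have hA0 : 0 ≤ A := by positivity
  have hb : ∀ᵐ I ∂D, -(dualLoss xstar I x - dualLoss xstar I u) ∈ Set.Icc (-(2 * A)) (2 * A) := by
    filter_upwards [hD] with I hI
    have h1 := dualLoss_sub_le (xstar := xstar) (B := B) (I := I)
      (fun v => by exact_mod_cast hI.2.1 v) x u
    have h2 := mul_le_mul_of_nonneg_left (sum_abs_sub_le hx hu) (Nat.cast_nonneg (α := ℝ) B)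
    have h3 := abs_le.1 (h1.trans h2)
    constructor <;> rw [hA] <;> linarith
  have h := ProbabilityTheory.hasSubgaussianMGF_of_mem_Icc
    Measurable.of_discrete.aemeasurable hb
  have heq : ∀ I, -(dualLoss xstar I x - dualLoss xstar I u) -
      ∫ I, -(dualLoss xstar I x - dualLoss xstar I u) ∂D = meanLoss D xstar x - meanLoss D xstar u -
      (dualLoss xstar I x - dualLoss xstar I u) := fun I => by
    rw [integral_neg, meanLoss_sub hD]; ring
  simp only [heq] at h
  rw [← ofReal_integral_eq_lintegral_ofReal (h.integrable_exp_mul r)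
    (Filter.Eventually.of_forall fun _ => (Real.exp_pos _).le)]
  refine ENNReal.ofReal_le_ofReal ((h.mgf_le r).trans (Real.exp_le_exp.2 (le_of_eq ?_)))
  have h4 : ((‖2 * A - -(2 * A)‖₊ / 2 : NNReal) : ℝ) = 2 * A := by
    push_cast
    rw [Real.norm_of_nonneg (by linarith)]; ring
  rw [NNReal.coe_pow, h4]
  ring

/-- Azuma's inequality for the actions of subgradient descent. -/
theorem measure_deviation_le (hD : ∀ᵐ I ∂D, G.IsAdmissible C B I) (hA : 0 < (C * B * n : ℝ))
    {u : Fin n → ℝ} (hu : ∀ v, |u v| ≤ C) {η : ℝ} (hη : 0 < η) (q : ℕ) (hq : 0 < q) :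
    (Measure.pi fun _ : Fin T => D).real {S | T * η ≤ ∑ t ∈ Finset.range T,
      (meanLoss D xstar (ogdPoint C q xstar (seqOf S) t) - meanLoss D xstar u -
        (dualLoss xstar (seqOf S t) (ogdPoint C q xstar (seqOf S) t) -
          dualLoss xstar (seqOf S t) u))} ≤
              Real.exp (-(T * (η ^ 2 / (8 * (C * B * n : ℝ) ^ 2)))) := by
  set A : ℝ := C * B * n with hA'
  -- the minimizer of `2 * A ^ 2 * r ^ 2 - r * η`
  set r := η / (4 * A ^ 2) with hr
  have hr0 : 0 < r := by positivity
  set φ : (Fin n → ℝ) → BInstance n m → ℝ := fun x I => meanLoss D xstar x - meanLoss D xstar u -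
    (dualLoss xstar I x - dualLoss xstar I u) with hφ
  have h1 := lintegral_prod_adapted_le D
    (fun I t a => ENNReal.ofReal (Real.exp (r * φ (ogdPoint C q xstar I t) a)))
    (fun I J t h => by rw [ogdPoint_congr h])
    (fun I t => lintegral_exp_deviation_le hD (fun v => abs_ogdPoint_le hq I t v) hu r) T
  have h2 : ∀ S : Fin T → BInstance n m, ∏ t ∈ Finset.range T,
      ENNReal.ofReal (Real.exp (r * φ (ogdPoint C q xstar (seqOf S) t) (seqOf S t))) =
      ENNReal.ofReal (Real.exp (r * ∑ t ∈ Finset.range T,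
        φ (ogdPoint C q xstar (seqOf S) t) (seqOf S t))) := fun S => by
    rw [Finset.mul_sum, Real.exp_sum, ENNReal.ofReal_prod_of_nonneg fun _ _ => (Real.exp_pos _).le]
  simp only [h2] at h1
  have h3 := mul_meas_ge_le_lintegral (μ := Measure.pi fun _ : Fin T => D)
    (f := fun S => ENNReal.ofReal (Real.exp (r * ∑ t ∈ Finset.range T,
        φ (ogdPoint C q xstar (seqOf S) t) (seqOf S t)))) Measurable.of_discrete
    (ENNReal.ofReal (Real.exp (r * (T * η))))
  have h4 : {S : Fin T → BInstance n m | ENNReal.ofReal (Real.exp (r * (T * η))) ≤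
      ENNReal.ofReal (Real.exp (r * ∑ t ∈ Finset.range T,
        φ (ogdPoint C q xstar (seqOf S) t) (seqOf S t)))} = {S | T * η ≤ ∑ t ∈ Finset.range T,
        φ (ogdPoint C q xstar (seqOf S) t) (seqOf S t)} := by
    ext S
    simp only [Set.mem_ofPred_eq]
    rw [ENNReal.ofReal_le_ofReal_iff (Real.exp_pos _).le, Real.exp_le_exp,
      mul_le_mul_iff_right₀ hr0]
  rw [h4] at h3
  have h5 := ENNReal.toReal_mono (by simp [← ENNReal.ofReal_pow, (Real.exp_pos _).le]) (h3.trans h1)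
  rw [ENNReal.toReal_mul, ENNReal.toReal_pow, ENNReal.toReal_ofReal (Real.exp_pos _).le,
    ENNReal.toReal_ofReal (Real.exp_pos _).le, ← Real.exp_nat_mul, mul_comm,
    ← le_div_iff₀ (Real.exp_pos _), ← Real.exp_sub] at h5
  refine h5.trans (Real.exp_le_exp.2 (le_of_eq ?_))
  rw [hr]
  field_simp
  ring

/-- Online-to-batch conversion: the average action inherits the average regret, up to the deviation
of the sampled losses from their means, which Azuma's inequality controls. -/
theorem learnsDuals_ogdAverage (hn : 0 < n) :
    LearnsDuals G xstar C B 64 T (ogdAverage C B xstar) := by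
  intro D _ hD ε δ hε hδ hT
  -- the degenerate cases, in which every point of the box is optimal
  have htriv : (∀ S : Fin T → BInstance n m, ∀ x : Fin n → ℝ, (∀ v, |x v| ≤ C) →
      meanLoss D xstar (ogdAverage C B xstar S) ≤ meanLoss D xstar x + ε) →
      1 - δ ≤ (Measure.pi fun _ : Fin T => D).real {S | ∀ x : Fin n → ℝ, (∀ v, |x v| ≤ C) →
          ∫ I, dualLoss xstar I (ogdAverage C B xstar S) ∂D ≤ ∫ I, dualLoss xstar I x ∂D + ε} := by
    intro h
    unfold meanLoss at h
    rw [Set.eq_univ_of_forall (s := {S | _}) h, probReal_univ]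
    linarith
  rcases Nat.eq_zero_or_pos C with rfl | hC
  · refine htriv fun S x hx => ?_
    have h1 : x = ogdAverage 0 B xstar S := by
      funext v
      have h2 : ∀ t, ogdNum 0 (ogdScale B T) xstar (seqOf S) v t = 0 := fun t => by
        have := abs_ogdCoord_le (C := 0) (q := ogdScale B T) (b := fun s => (seqOf S s).2 v)
          (d := fun s => xstar (seqOf S s) v) t
        unfold ogdNum
        simpa using this
      have h3 := hx v
      simp only [Nat.cast_zero, abs_nonpos_iff] at h3
      simp [ogdAverage, h2, h3]
    rw [h1]; linarith
  rcases Nat.eq_zero_or_pos B with rfl | hB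
  · refine htriv fun S x hx => ?_
    have h1 : ∀ z, meanLoss D xstar z = 0 := fun z => integral_eq_zero_of_ae (by
      filter_upwards [hD] with I hI
      exact bSeminorm_eq_zero fun v => by
        have := hI.2.1 v
        exact_mod_cast le_antisymm this (by simp))
    rw [h1, h1]; linarith
  rcases le_or_gt 1 δ with hδ1 | hδ1
  · exact (by linarith : 1 - δ ≤ 0).trans measureReal_nonneg
  set A : ℝ := C * B * n with hA
  have hA0 : 0 < A := by positivity
  set l := Real.log (2 / δ) with hl
  have hl2 : 0.69 ≤ l := by
    have h1 : Real.log 2 ≤ l := Real.log_le_log (by norm_num) (by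
      rw [le_div_iff₀ hδ]; linarith)
    have := Real.log_two_gt_d9
    linarith
  have hT' : 64 * A ^ 2 * l ≤ T * ε ^ 2 := by
    have h1 : 64 * (A / ε) ^ 2 * l * ε ^ 2 = 64 * A ^ 2 * l := by field_simp
    rw [← h1]; gcongr
  have hT1 : 1 ≤ T := by
    by_contra hc
    have h0 : T = 0 := by omega
    rw [h0, Nat.cast_zero, zero_mul] at hT'
    have : 0 < 64 * A ^ 2 * l := by positivity
    linarith
  have hT0 : (0 : ℝ) < T := by exact_mod_cast hT1
  obtain ⟨u, hu, hmin⟩ := exists_meanLoss_min (xstar := xstar) hD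
  have hbad := measure_deviation_le (T := T) (xstar := xstar) hD hA0 hu (half_pos hε) (ogdScale B T)
    ogdScale_pos
  set bad := {S : Fin T → BInstance n m | T * (ε / 2) ≤ ∑ t ∈ Finset.range T,
      (meanLoss D xstar (ogdPoint C (ogdScale B T) xstar (seqOf S) t) - meanLoss D xstar u -
        (dualLoss xstar (seqOf S t) (ogdPoint C (ogdScale B T) xstar (seqOf S) t) -
          dualLoss xstar (seqOf S t) u))} with hbad'
  have hbadδ : (Measure.pi fun _ : Fin T => D).real bad ≤ δ := by
    refine hbad.trans ?_
    have h1 : l ≤ T * ((ε / 2) ^ 2 / (8 * A ^ 2)) := by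
      have h2 : T * ((ε / 2) ^ 2 / (8 * A ^ 2)) = T * ε ^ 2 / (32 * A ^ 2) := by
        field_simp; ring
      rw [h2, le_div_iff₀ (by positivity)]
      have : 0 ≤ A ^ 2 * l := by positivity
      linarith
    calc Real.exp (-(T * ((ε / 2) ^ 2 / (8 * A ^ 2)))) ≤ Real.exp (-l) :=
          Real.exp_le_exp.2 (by linarith)
      _ = δ / 2 := by rw [Real.exp_neg, hl, Real.exp_log (by positivity), inv_div]
      _ ≤ δ := by linarith
  have hcompl : 1 - δ ≤ (Measure.pi fun _ : Fin T => D).real badᶜ := by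
    rw [probReal_compl_eq_one_sub (Set.to_countable _).measurableSet]; linarith
  refine hcompl.trans ?_
  have hadm : ∀ᵐ S ∂(Measure.pi fun _ : Fin T => D), ∀ t, G.IsAdmissible C B (S t) :=
    ae_all_iff.2 fun t => (Measure.tendsto_eval_ae_ae (μ := fun _ : Fin T => D)
        (i := t)).eventually hD
  refine ENNReal.toReal_mono (measure_ne_top _ _) (measure_mono_ae ?_)
  filter_upwards [hadm] with S hS hgood x hx
  have hlt : ∑ t ∈ Finset.range T,
      (meanLoss D xstar (ogdPoint C (ogdScale B T) xstar (seqOf S) t) - meanLoss D xstar u -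
        (dualLoss xstar (seqOf S t) (ogdPoint C (ogdScale B T) xstar (seqOf S) t) -
          dualLoss xstar (seqOf S t) u)) < T * (ε / 2) := not_le.1 hgood
  have hreg := ogdPoint_regret (xstar := xstar) hC hB hT1 (I := seqOf S) (fun t ht v => by
    rw [seqOf_of_lt S ht]
    exact_mod_cast (hS ⟨t, ht⟩).2.1 v) hu
  have havg := meanLoss_average_le (xstar := xstar) hD hT1 S
  have hsqrt : 5 / 2 * A * √(T : ℝ) ≤ T * (ε / 2) := by
    have h1 : 5 * A ≤ √(T : ℝ) * ε := by
      refine le_of_sq_le_sq ?_ (by positivity)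
      rw [mul_pow √(T : ℝ), Real.sq_sqrt hT0.le]
      nlinarith [sq_nonneg A]
    have h2 : (T : ℝ) = √T * √T := (Real.mul_self_sqrt hT0.le).symm
    calc 5 / 2 * A * √(T : ℝ) = √T * (5 * A) / 2 := by ring
      _ ≤ √T * (√T * ε) / 2 := by gcongr
      _ = √T * √T * (ε / 2) := by ring
      _ = T * (ε / 2) := by rw [← h2]
  rw [Finset.sum_sub_distrib, Finset.sum_sub_distrib, Finset.sum_const, Finset.card_range,
    nsmul_eq_mul] at hlt
  have h9 : T * meanLoss D xstar (ogdAverage C B xstar S) ≤ T * (meanLoss D xstar u + ε) := by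
    rw [mul_add]; linarith
  have h10 := le_of_mul_le_mul_left h9 hT0
  exact h10.trans (by have := hmin x hx; unfold meanLoss at this ⊢; linarith)

end Learning

namespace Machine

open BipartiteGraph

/-! ### A program for subgradient descent -/

/-- One step of subgradient descent for the vertex in register 10. Register 26 holds the address of
its demand and feedback, register 24 the action, register 25 the sum of the previous actions;
registers 21 and 22 hold the denominator `q` and the bound `C * q`. -/
def ogdBody : Program :=
  .assign 25 (.reg 25 + .reg 24) ;;
  .assign 28 (.reg 24 - .reg 21 * .get 4 (.reg 26)) ;;
  .assign 24 (.reg 24 - .reg 3 * .get 3 (.reg 26) *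
    ((Expr.const 0).lt (.reg 28) - (Expr.reg 28).lt (.const 0))) ;;
  .assign 24 (.reg 24 + (.reg 22 - .reg 24) * (Expr.reg 22).lt (.reg 24)) ;;
  .assign 24 (.reg 24 - (.reg 22 + .reg 24) * (Expr.reg 24).lt (.const 0 - .reg 22)) ;;
  .assign 26 (.reg 26 + .reg 0) ;;
  .assign 23 (.reg 23 + .const 1)

/-- Subgradient descent for the vertex in register 10; the sum of its actions goes to array 5. -/
def ogdVertex : Program :=
  (.assign 23 (.const 0) ;; .assign 24 (.const 0) ;; .assign 25 (.const 0) ;;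
    .assign 26 (.reg 10)) ;;
  .loop ((Expr.reg 23).lt (.reg 2)) ogdBody ;;
  .store 5 (.reg 10) (.reg 25) ;; .assign 10 (.reg 10 + .const 1)

/-- Register 20 becomes the least integer whose square exceeds `T`. -/
def sqrtLoop : Program :=
  .loop (.const 1 - (Expr.reg 2).lt (.reg 20 * .reg 20)) (.assign 20 (.reg 20 + .const 1))

/-- Subgradient descent, vertex by vertex, and its average action. -/
def ogdProgram : Program :=
  .assign 20 (.const 1) ;; sqrtLoop ;;
  (.assign 21 ((.reg 4 + .const 1) * .reg 20) ;; .assign 22 (.reg 3 * .reg 21) ;;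
    .assign 10 (.const 0)) ;;
  .loop ((Expr.reg 10).lt (.reg 0)) ogdVertex ;;
  .assign 5 (.reg 21 * .reg 2 + (Expr.reg 2).eq (.const 0))

/-- The data that subgradient descent works with. -/
structure OgdEnv (n T C q : ℕ) (b : ℕ → Fin n → ℕ) (d : ℕ → Fin n → ℤ) (σ : State) : Prop where
  r0 : σ.reg 0 = n
  r2 : σ.reg 2 = T
  r3 : σ.reg 3 = C
  r21 : σ.reg 21 = q
  r22 : σ.reg 22 = (C * q : ℕ)
  dem : ∀ t < T, ∀ v : Fin n, σ.arr 3 ((t * n + v : ℕ) : ℤ) = b t v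
  fb : ∀ t < T, ∀ v : Fin n, σ.arr 4 ((t * n + v : ℕ) : ℤ) = d t v

theorem OgdEnv.same {n T C q : ℕ} {b : ℕ → Fin n → ℕ} {d : ℕ → Fin n → ℤ} {p : Program}
    {σ τ : State} (h : OgdEnv n T C q b d σ) (hS : Same p σ τ) (h0 : ¬ p.modReg 0)
    (h2 : ¬ p.modReg 2) (h3 : ¬ p.modReg 3) (h21 : ¬ p.modReg 21) (h22 : ¬ p.modReg 22)
    (a3 : ¬ p.modArr 3) (a4 : ¬ p.modArr 4) : OgdEnv n T C q b d τ where
  r0 := (hS.1 0 h0).trans h.r0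
  r2 := (hS.1 2 h2).trans h.r2
  r3 := (hS.1 3 h3).trans h.r3
  r21 := (hS.1 21 h21).trans h.r21
  r22 := (hS.1 22 h22).trans h.r22
  dem := by rw [hS.2 3 a3]; exact h.dem
  fb := by rw [hS.2 4 a4]; exact h.fb

/-- The branch-free computation of the projection in `ogdBody`. -/
theorem clamp_eq (R z : ℤ) (hR : 0 ≤ R) :
    (z + (R - z) * if R < z then 1 else 0) - (R + (z + (R - z) * if R < z then 1 else 0)) *
      (if (z + (R - z) * if R < z then 1 else 0) < -R then 1 else 0) = clamp R z := by
  unfold clamp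
  by_cases h : R < z
  · simp only [h, if_true, mul_one, add_sub_cancel]
    rw [if_neg (by omega)]; omega
  · simp only [h, if_false, mul_zero, add_zero]
    split_ifs <;> omega

theorem Small.of_abs {U k : ℕ} {z : ℤ} (h : |z| ≤ (k : ℤ)) (hk : k ≤ U) : Small U z := by
  have := abs_le.1 h
  exact ⟨by omega, by omega⟩

section
variable {n T C B q U Y : ℕ} {b : ℕ → Fin n → ℕ} {d : ℕ → Fin n → ℤ} {σ : State}

theorem ogdBody_spec (H : OgdEnv n T C q b d σ) {t : ℕ} (ht : t < T) (v : Fin n)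
    (h23 : σ.reg 23 = t) (h26 : σ.reg 26 = (t * n + v : ℕ))
    (h24 : σ.reg 24 = ogdCoord C q (b · v) (d · v) t)
    (h25 : σ.reg 25 = ∑ s ∈ Finset.range t, ogdCoord C q (b · v) (d · v) s)
    (hb : b t v ≤ B) (hd : |d t v| ≤ Y) (h1 : T * (C * q) ≤ U) (h2 : C * q + q * Y ≤ U)
    (h3 : C * q + C * B ≤ U) (h4 : T * n + n ≤ U) (h5 : T ≤ U) :
    HT U ogdBody σ 7 fun τ => OgdEnv n T C q b d τ ∧ τ.reg 10 = σ.reg 10 ∧ τ.arr 5 = σ.arr 5 ∧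
      τ.reg 23 = (t + 1 : ℕ) ∧ τ.reg 26 = ((t + 1) * n + v : ℕ) ∧
      τ.reg 24 = ogdCoord C q (b · v) (d · v) (t + 1) ∧
      τ.reg 25 = ∑ s ∈ Finset.range (t + 1), ogdCoord C q (b · v) (d · v) s := by
  set X := ogdCoord C q (b · v) (d · v) t with hX
  have hXle : |X| ≤ (C * q : ℕ) := abs_ogdCoord_le t
  set Z := X - C * b t v * sgn (X - q * d t v) with hZ
  have hnext : ogdCoord C q (b · v) (d · v) (t + 1) = clamp (C * q : ℕ) Z := by
    rw [ogdCoord]; push_cast; rfl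
  have s25 : Small U ((∑ s ∈ Finset.range t, ogdCoord C q (b · v) (d · v) s) + X) := by
    rw [hX, ← Finset.sum_range_succ]
    have h6 : |∑ s ∈ Finset.range (t + 1), ogdCoord C q (b · v) (d · v) s| ≤ (T * (C * q) : ℕ) := by
      calc |∑ s ∈ Finset.range (t + 1), ogdCoord C q (b · v) (d · v) s|
          ≤ ∑ s ∈ Finset.range (t + 1), |ogdCoord C q (b · v) (d · v) s| :=
            Finset.abs_sum_le_sum_abs _ _
        _ ≤ ∑ _s ∈ Finset.range (t + 1), ((C * q : ℕ) : ℤ) :=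
            Finset.sum_le_sum fun s _ => abs_ogdCoord_le s
        _ = ((t + 1 : ℕ) : ℤ) * (C * q : ℕ) := by simp
        _ ≤ (T : ℤ) * (C * q : ℕ) := by gcongr; exact_mod_cast ht
        _ = _ := by push_cast; ring
    exact .of_abs h6 h1
  have s28 : Small U (X - q * d t v) := by
    have h6 : |(q : ℤ) * d t v| ≤ (q * Y : ℕ) := by
      rw [abs_mul, Nat.abs_cast]; push_cast; gcongr
    refine .of_abs (k := C * q + q * Y) ((abs_sub _ _).trans ?_) h2
    push_cast at hXle h6 ⊢
    linarith
  have sZ : Small U Z := by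
    have h6 : |(C : ℤ) * b t v * sgn (X - q * d t v)| ≤ (C * B : ℕ) := by
      have h7 : |sgn (X - q * d t v)| ≤ 1 := by unfold sgn; split_ifs <;> simp
      rw [abs_mul, abs_mul, Nat.abs_cast, Nat.abs_cast]
      calc (C : ℤ) * b t v * |sgn (X - q * d t v)| ≤ C * B * 1 := by gcongr
        _ = _ := by push_cast; ring
    refine .of_abs (k := C * q + C * B) ((abs_sub _ _).trans ?_) h3
    push_cast at hXle h6 ⊢
    linarith
  have sClamp : Small U (clamp (C * q : ℕ) Z) :=
    .of_abs (abs_clamp_le (Nat.cast_nonneg (C * q)) Z) (by omega)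
  have sMin : Small U (Z + ((C * q : ℕ) - Z) * if ((C * q : ℕ) : ℤ) < Z then 1 else 0) := by
    rw [small_iff] at sZ ⊢
    split_ifs <;> simp only [mul_one, mul_zero, add_zero] <;> omega
  have hadd : (t * n + v : ℕ) + n = (t + 1) * n + v := by ring
  have hle : (t + 1) * n ≤ T * n := Nat.mul_le_mul_right _ ht
  have s26 : Small U (((t * n + v : ℕ) : ℤ) + n) := by
    have hv := v.2
    rw [small_iff]; omega
  have s23 : Small U ((t : ℤ) + 1) := by rw [small_iff]; omega
  have hsgn : ∀ z : ℤ, ((if 0 < z then 1 else 0) - if z < 0 then 1 else 0 : ℤ) = sgn z :=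
    fun _ => rfl
  have hdem := H.dem t ht v
  have hfb := H.fb t ht v
  refine HT.of_wp _ ?_
  have hcl := clamp_eq (C * q : ℕ) Z (Nat.cast_nonneg _)
  simp only [ogdBody, Program.wp, Expr.eval_add, Expr.eval_sub, Expr.eval_mul, Expr.eval_lt,
      Expr.eval_reg,
    Expr.eval_const, Expr.eval_get, State.reg_setReg, State.arr_setReg, h24, h25, h26, h23,
    H.r0, H.r3, H.r21, H.r22, hdem, hfb, if_true, Nat.reduceEqDiff, if_false, hsgn, ← hZ,
    zero_sub, hcl]
  refine ⟨s25, s28, sZ, sMin, sClamp, s26, s23, ⟨?_, ?_, ?_, ?_, ?_, H.dem, H.fb⟩, ?_, trivial, ?_,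
      ?_, ?_, ?_⟩
  all_goals simp [H.r0, H.r2, H.r3, H.r21, H.r22, hnext, Finset.sum_range_succ]
  all_goals ring

/-- The numbers that occur in subgradient descent are at most `U`. -/
structure OgdBound (n T C B q Y U : ℕ) (b : ℕ → Fin n → ℕ) (d : ℕ → Fin n → ℤ) : Prop where
  dem : ∀ t < T, ∀ v, b t v ≤ B
  fb : ∀ t < T, ∀ v, |d t v| ≤ Y
  sum_le : T * (C * q) ≤ U
  residual_le : C * q + q * Y ≤ U
  step_le : C * q + C * B ≤ U
  address_le : T * n + n ≤ U
  count_le : T ≤ U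

theorem ogdVertex_spec (H : OgdEnv n T C q b d σ) (v : Fin n) (h10 : σ.reg 10 = (v : ℕ))
    (hU : OgdBound n T C B q Y U b d) :
    HT U ogdVertex σ (T * 8 + 7) fun τ => OgdEnv n T C q b d τ ∧ τ.reg 10 = (v + 1 : ℕ) ∧
      (∀ x, x ≠ ((v : ℕ) : ℤ) → τ.arr 5 x = σ.arr 5 x) ∧
      τ.arr 5 (v : ℕ) = ∑ s ∈ Finset.range T, ogdCoord C q (b · v) (d · v) s := by
  have hv := v.2
  have hn := hU.address_le
  have h0 : Small U 0 := by rw [small_iff]; simp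
  have hvs : Small U (v : ℕ) := by rw [small_iff]; omega
  have hvs' : Small U ((v : ℕ) + 1) := by rw [small_iff]; omega
  refine HT.mono (s := 4 + ((T * (7 + 1) + 1) + 2)) (HT.seq (R := fun τ =>
      τ = (((σ.setReg 23 0).setReg 24 0).setReg 25 0).setReg 26 (v : ℕ))
      (HT.of_wp _ (by simp [h0, hvs, h10])) fun τ₁ S₁ e₁ => (HT.loop (s := 7)
    (fun k τ => ∃ t, t + k = T ∧ OgdEnv n T C q b d τ ∧ τ.reg 10 = σ.reg 10 ∧ τ.arr 5 = σ.arr 5 ∧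
      τ.reg 23 = t ∧ τ.reg 26 = (t * n + v : ℕ) ∧
      τ.reg 24 = ogdCoord C q (b · v) (d · v) t ∧
      τ.reg 25 = ∑ s ∈ Finset.range t, ogdCoord C q (b · v) (d · v) s) ?_ T τ₁ ?_).seq
    fun τ₂ _ h₂ => ?_) (by omega) fun _ _ h => h
  · rintro k τ ⟨t, htk, H', e10, e5, e23, e26, e24, e25⟩ he
    have ht : t < T := by
      simp only [Expr.eval_lt, Expr.eval_reg, e23, H'.r2] at he
      by_contra hc
      exact he (if_neg (by omega))
    refine (ogdBody_spec H' ht v e23 e26 e24 e25 (hU.dem t ht v) (hU.fb t ht v)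
      hU.sum_le hU.residual_le hU.step_le hU.address_le hU.count_le).mono le_rfl ?_
    rintro τ' - ⟨H'', f10, f5, f23, f26, f24, f25⟩
    exact ⟨k - 1, by omega, t + 1, by omega, H'', f10.trans e10, f5.trans e5, f23, f26, f24, f25⟩
  · refine ⟨0, by omega, H.same S₁ (by simp) (by simp) (by simp) (by simp) (by simp) (by simp)
      (by simp), ?_⟩
    rw [e₁]
    simp [ogdCoord]
  · obtain ⟨⟨k, -, t, htk, H', e10, e5, e23, e26, e24, e25⟩, he⟩ := h₂
    obtain rfl : t = T := by
      simp only [Expr.eval_lt, Expr.eval_reg, e23, H'.r2] at he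
      by_contra hc
      rw [if_pos (by omega)] at he
      exact one_ne_zero he
    have hS : Small U (∑ s ∈ Finset.range t, ogdCoord C q (b · v) (d · v) s) := by
      refine .of_abs (k := t * (C * q)) ?_ hU.sum_le
      calc |∑ s ∈ Finset.range t, ogdCoord C q (b · v) (d · v) s|
          ≤ ∑ s ∈ Finset.range t, |ogdCoord C q (b · v) (d · v) s| := Finset.abs_sum_le_sum_abs _ _
        _ ≤ ∑ _s ∈ Finset.range t, ((C * q : ℕ) : ℤ) :=
            Finset.sum_le_sum fun s _ => abs_ogdCoord_le s
        _ = _ := by simp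
    rw [h10] at e10
    refine HT.of_wp _ ?_
    simp only [Program.wp, Expr.eval_add, Expr.eval_reg, Expr.eval_const, State.reg_setArr, e10,
        e25]
    refine ⟨hS, hvs', ⟨?_, ?_, ?_, ?_, ?_, ?_, ?_⟩, by simp, fun x hx => ?_, by simp⟩
    · simpa using H'.r0
    · simpa using H'.r2
    · simpa using H'.r3
    · simpa using H'.r21
    · simpa using H'.r22
    · simpa using H'.dem
    · simpa using H'.fb
    · simp [hx, e5]

theorem sqrtLoop_spec (h2 : σ.reg 2 = T) (h20 : σ.reg 20 = 1) (hU : Nat.sqrt T + 1 ≤ U) :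
    HT U sqrtLoop σ (Nat.sqrt T * 2 + 1) fun τ => τ.reg 20 = (Nat.sqrt T + 1 : ℕ) := by
  refine HT.mono (HT.loop (s := 1) (fun k τ => ∃ j, j + k = Nat.sqrt T + 1 ∧ τ.reg 20 = (j : ℕ) ∧
    τ.reg 2 = T) ?_ (Nat.sqrt T) σ ⟨1, by omega, by simpa using h20, h2⟩) le_rfl ?_
  · rintro k τ ⟨j, hjk, e20, e2⟩ he
    have hj : j * j ≤ T := by
      by_contra hc
      simp only [Expr.eval_sub, Expr.eval_lt, Expr.eval_reg, Expr.eval_const, Expr.eval_mul, e20,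
        e2] at he
      rw [if_pos (by exact_mod_cast not_le.1 hc)] at he
      simp at he
    have hj' := Nat.le_sqrt.2 hj
    have hs : Small U ((j : ℤ) + 1) := by rw [small_iff]; omega
    refine HT.of_wp (.assign _ _) ?_
    simp only [Program.wp, Expr.eval_add, Expr.eval_reg, Expr.eval_const, e20]
    exact ⟨hs, k - 1, by omega, j + 1, by omega, by simp, by simpa using e2⟩
  · rintro τ - ⟨⟨k, -, j, hjk, e20, e2⟩, he⟩
    have hj : T < j * j := by
      by_contra hc
      simp only [Expr.eval_sub, Expr.eval_lt, Expr.eval_reg, Expr.eval_const, Expr.eval_mul, e20,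
        e2] at he
      rw [if_neg (by exact_mod_cast hc)] at he
      simp at he
    have hj' := Nat.sqrt_lt.2 hj
    rw [e20, show j = Nat.sqrt T + 1 by omega]

theorem ogdProgram_spec (h0 : σ.reg 0 = n) (h2 : σ.reg 2 = T) (h3 : σ.reg 3 = C) (h4 : σ.reg 4 = B)
    (hdem : ∀ t < T, ∀ v : Fin n, σ.arr 3 ((t * n + v : ℕ) : ℤ) = b t v)
    (hfb : ∀ t < T, ∀ v : Fin n, σ.arr 4 ((t * n + v : ℕ) : ℤ) = d t v)
    (hU : OgdBound n T C B (ogdScale B T) Y U b d) (hU' : ogdDen B T ≤ U)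
    (hU'' : C * ogdScale B T + ogdScale B T ≤ U) :
    HT U ogdProgram σ (T * 2 + 7 + n * (T * 8 + 8)) fun τ => τ.reg 5 = ogdDen B T ∧
      ∀ v : Fin n, τ.arr 5 (v : ℕ) =
        ∑ t ∈ Finset.range T, ogdCoord C (ogdScale B T) (b · v) (d · v) t := by
  set q := ogdScale B T with hq
  have hqs : Nat.sqrt T + 1 ≤ q := Nat.le_mul_of_pos_left _ (Nat.succ_pos B)
  have hsT := Nat.sqrt_le_self T
  have hs0 : Small U 0 := by rw [small_iff]; simp
  have hs1 : Small U 1 := by rw [small_iff]; simp; omega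
  have hsq : Small U (q : ℕ) := by rw [small_iff]; simp; omega
  have hsCq : Small U ((C * q : ℕ) : ℤ) := by rw [small_iff]; simp only [Int.natAbs_natCast]; omega
  have hsden : Small U (ogdDen B T : ℕ) := by
    rw [small_iff]; simp only [Int.natAbs_natCast]; omega
  refine HT.mono (s := 1 + ((Nat.sqrt T * 2 + 1) + (3 + ((n * (T * 8 + 7 + 1) + 1) + 1))))
    (HT.seq (R := fun τ => τ = σ.setReg 20 1) (HT.of_wp (.assign _ _) (by simp [hs1]))
    fun τ₁ S₁ e₁ => (sqrtLoop_spec (T := T) (by rw [e₁]; simpa using h2) (by rw [e₁]; simp)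
      (by omega)).seq fun τ₂ S₂ e₂ => HT.seq (R := fun τ =>
        τ = ((τ₂.setReg 21 (q : ℕ)).setReg 22 ((C * q : ℕ) : ℤ)).setReg 10 0) ?_
      fun τ₃ S₃ e₃ => (HT.loop (s := T * 8 + 7) (fun k τ => ∃ i, i + k = n ∧ OgdEnv n T C q b d τ ∧
        τ.reg 10 = (i : ℕ) ∧ ∀ v : Fin n, (v : ℕ) < i → τ.arr 5 (v : ℕ) =
          ∑ t ∈ Finset.range T, ogdCoord C q (b · v) (d · v) t) ?_ n τ₃ ?_).seq fun τ₄ S₄ h₄ => ?_)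
    (by rw [show T * 8 + 7 + 1 = T * 8 + 8 from rfl]; omega) fun _ _ h => h
  · have f2 : ∀ r, r ≠ 20 → τ₂.reg r = σ.reg r := fun r hr => by
      rw [S₂.1 r (by simpa [sqrtLoop] using hr), e₁]; simp [hr]
    have hq' : ((B : ℤ) + 1) * (Nat.sqrt T + 1 : ℕ) = (q : ℕ) := by
      rw [hq, ogdScale]; push_cast; ring
    refine HT.of_wp _ ?_
    simp only [Program.wp, Expr.eval_add, Expr.eval_mul, Expr.eval_reg, Expr.eval_const,
      State.reg_setReg, f2 4 (by norm_num), f2 3 (by norm_num), e₂, h4, h3, hq', if_true,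
      Nat.reduceEqDiff, if_false]
    refine ⟨hsq, by exact_mod_cast hsCq, hs0, ?_⟩
    push_cast
    rfl
  · rintro k τ ⟨i, hik, H', e10, e5⟩ he
    have hi : i < n := by
      simp only [Expr.eval_lt, Expr.eval_reg, e10, H'.r0] at he
      by_contra hc
      exact he (if_neg (by omega))
    refine (ogdVertex_spec H' ⟨i, hi⟩ e10 hU).mono le_rfl ?_
    rintro τ' - ⟨H'', f10, f5, f5'⟩
    refine ⟨k - 1, by omega, i + 1, by omega, H'', f10, fun v hv => ?_⟩
    rcases Nat.lt_succ_iff_lt_or_eq.1 hv with h | h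
    · rw [f5 _ (by simp; omega), e5 v h]
    · obtain rfl : v = ⟨i, hi⟩ := Fin.ext h
      exact f5'
  · have f3 : ∀ r, r ≠ 20 → r ≠ 21 → r ≠ 22 → r ≠ 10 → τ₃.reg r = σ.reg r := fun r a1 a2 a3 a4 => by
      rw [e₃]
      simp only [State.reg_setReg, a2, a3, a4, if_false]
      rw [S₂.1 r (by simpa [sqrtLoop] using a1), e₁]; simp [a1]
    have g3 : ∀ a, τ₃.arr a = σ.arr a := fun a => by
      rw [e₃]
      simp only [State.arr_setReg]
      rw [S₂.2 a (by simp [sqrtLoop]), e₁]; rfl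
    refine ⟨0, by omega, ⟨?_, ?_, ?_, ?_, ?_, ?_, ?_⟩, by rw [e₃]; simp, by simp⟩
    · rw [f3 0 (by norm_num) (by norm_num) (by norm_num) (by norm_num), h0]
    · rw [f3 2 (by norm_num) (by norm_num) (by norm_num) (by norm_num), h2]
    · rw [f3 3 (by norm_num) (by norm_num) (by norm_num) (by norm_num), h3]
    · rw [e₃]; simp
    · rw [e₃]; simp
    · rw [g3]; exact hdem
    · rw [g3]; exact hfb
  · obtain ⟨⟨k, -, i, hik, H', e10, e5⟩, he⟩ := h₄
    obtain rfl : i = n := by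
      simp only [Expr.eval_lt, Expr.eval_reg, e10, H'.r0] at he
      by_contra hc
      rw [if_pos (by omega)] at he
      exact one_ne_zero he
    have hden : (q : ℤ) * T + (if (T : ℤ) = 0 then 1 else 0) = (ogdDen B T : ℕ) := by
      rw [ogdDen, ← hq]; push_cast; simp
    refine HT.of_wp (.assign _ _) ?_
    simp only [Program.wp, Expr.eval_add, Expr.eval_mul, Expr.eval_eq, Expr.eval_reg,
      Expr.eval_const, H'.r21, H'.r2, hden]
    exact ⟨hsden, by simp, fun v => by simpa using e5 v v.2⟩

end

end Machine

namespace Machine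

open BipartiteGraph

variable {n m T C B : ℕ} {G : BipartiteGraph n m}

/-! ### Learning with feedback -/

theorem table_apply {T k : ℕ} (f : Fin T → Fin k → ℤ) (t : Fin T) (i : Fin k) :
    table f ((t * k + i : ℕ) : ℤ) = f t i := by
  have hlt : (t : ℕ) * k + i < T * k := by
    have h1 : ((t : ℕ) + 1) * k ≤ T * k := Nat.mul_le_mul_right _ t.2
    have h2 := i.2
    rw [add_mul, one_mul] at h1
    omega
  have h := vec_apply (fun j : Fin (T * k) => f j.divNat j.modNat) ⟨t * k + i, hlt⟩
  have hk : 0 < k := by have := i.2; omega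
  have h1 : (⟨t * k + i, hlt⟩ : Fin (T * k)).divNat = t := Fin.ext (by
    simp [Fin.divNat, Nat.mul_comm (t : ℕ) k, Nat.mul_add_div hk, Nat.div_eq_of_lt i.2])
  have h2 : (⟨t * k + i, hlt⟩ : Fin (T * k)).modNat = i := Fin.ext (by
    simp [Fin.modNat, Nat.mul_comm (t : ℕ) k, Nat.mod_eq_of_lt i.2])
  rw [h1, h2] at h
  exact h

theorem natAbs_table_le {T k U : ℕ} {f : Fin T → Fin k → ℤ} (h : ∀ t i, |f t i| ≤ U) (z : ℤ) :
    (table f z).natAbs ≤ U := natAbs_vec_le (fun _ => h _ _) z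

theorem bounded_learningInput {U : ℕ} {S : Fin T → BInstance n m} {y : Fin T → Fin n → ℤ}
    (hn : n ≤ U) (hm : m ≤ U) (hT : T ≤ U) (hC : C ≤ U) (hB : B ≤ U)
    (hc : ∀ t e, (S t).1 e ≤ U) (hb : ∀ t v, (S t).2 v ≤ U) (hy : ∀ t v, |y t v| ≤ (U : ℤ)) :
    Bounded U (learningInput G C B S y) := by
  have hfin : ∀ v : Fin n, |((v : ℕ) : ℤ)| ≤ U := fun v => by
    rw [Nat.abs_cast]; exact_mod_cast v.2.le.trans hn
  constructor
  · intro r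
    unfold learningInput
    dsimp only
    split <;> simp <;> assumption
  · intro a i
    unfold learningInput
    dsimp only
    split
    · exact natAbs_vec_le (fun e => hfin _) _
    · exact natAbs_vec_le (fun e => hfin _) _
    · exact natAbs_table_le (fun t e => by rw [Nat.abs_cast]; exact_mod_cast hc t e) _
    · exact natAbs_table_le (fun t v => by rw [Nat.abs_cast]; exact_mod_cast hb t v) _
    · exact natAbs_table_le hy _
    · simp

theorem outputsVector_ogdAverage {xstar : BInstance n m → Fin n → ℤ} {S : Fin T → BInstance n m}
    {τ : State} (h5 : τ.reg 5 = ogdDen B T) (h : ∀ v : Fin n, τ.arr 5 (v : ℕ) =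
      ∑ t ∈ Finset.range T, ogdNum C (ogdScale B T) xstar (seqOf S) v t) :
    OutputsVector τ (ogdAverage C B xstar S) :=
  ⟨by rw [h5]; exact_mod_cast ogdDen_pos, fun v => by rw [h5, h v, ogdAverage]; simp⟩

theorem size_mul_le (a b : ℕ) : (a * b).size ≤ a.size + b.size := by
  rw [Nat.size_le, pow_add]
  exact Nat.mul_lt_mul'' (Nat.lt_size_self a) (Nat.lt_size_self b)

theorem size_le_self (a : ℕ) : a.size ≤ a := Nat.size_le.2 Nat.lt_two_pow_self

theorem size_succ_le (a : ℕ) : (a + 1).size ≤ a.size + 1 := by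
  rw [Nat.size_le, pow_succ]
  have := Nat.lt_size_self a
  omega

/-- A bound for the numbers that occur in subgradient descent. -/
def ogdMax (n m T C B Y : ℕ) : ℕ :=
  2 * ((n + m + 1) * ((T + 1) * (T + 1)) * (C + 1) * (B + 1) * (Y + 1))

theorem ogdScale_le : ogdScale B T ≤ (B + 1) * (T + 1) :=
  Nat.mul_le_mul_left _ (Nat.succ_le_succ (Nat.sqrt_le_self T))

theorem ogdBound_ogdMax {Y : ℕ} {b : ℕ → Fin n → ℕ} {d : ℕ → Fin n → ℤ}
    (hb : ∀ t < T, ∀ v, b t v ≤ B) (hd : ∀ t < T, ∀ v, |d t v| ≤ Y) :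
    OgdBound n T C B (ogdScale B T) Y (ogdMax n m T C B Y) b d ∧
      ogdDen B T ≤ ogdMax n m T C B Y ∧
      C * ogdScale B T + ogdScale B T ≤ ogdMax n m T C B Y ∧ n ≤ ogdMax n m T C B Y ∧
      m ≤ ogdMax n m T C B Y ∧ T ≤ ogdMax n m T C B Y ∧ C ≤ ogdMax n m T C B Y ∧
      B ≤ ogdMax n m T C B Y ∧ Y ≤ ogdMax n m T C B Y := by
  have hq := ogdScale_le (B := B) (T := T)
  unfold ogdMax
  set V := (n + m + 1) * ((T + 1) * (T + 1)) * (C + 1) * (B + 1) * (Y + 1) with hV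
  have key : ∀ {a₁ a₂ a₃ a₄ a₅ : ℕ}, a₁ ≤ n + m + 1 → a₂ ≤ (T + 1) * (T + 1) → a₃ ≤ C + 1 →
      a₄ ≤ B + 1 → a₅ ≤ Y + 1 → a₁ * a₂ * a₃ * a₄ * a₅ ≤ V := fun h1 h2 h3 h4 h5 => by
    rw [hV]; gcongr
  have hTT : T + 1 ≤ (T + 1) * (T + 1) := Nat.le_mul_of_pos_left _ (Nat.succ_pos T)
  have hCq : C * ogdScale B T + ogdScale B T ≤ V := by
    calc C * ogdScale B T + ogdScale B T = (C + 1) * ogdScale B T := by ring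
      _ ≤ (C + 1) * ((B + 1) * (T + 1)) := Nat.mul_le_mul_left _ hq
      _ = 1 * (T + 1) * (C + 1) * (B + 1) * 1 := by ring
      _ ≤ V := key (by omega) hTT le_rfl le_rfl (by omega)
  have hqY : ogdScale B T * Y ≤ V := by
    calc ogdScale B T * Y ≤ (B + 1) * (T + 1) * Y := Nat.mul_le_mul_right _ hq
      _ = 1 * (T + 1) * 1 * (B + 1) * Y := by ring
      _ ≤ V := key (by omega) hTT (by omega) le_rfl (by omega)
  have hTCq : T * (C * ogdScale B T) ≤ V := by
    calc T * (C * ogdScale B T) ≤ T * (C * ((B + 1) * (T + 1))) := by gcongr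
      _ = 1 * (T * (T + 1)) * C * (B + 1) * 1 := by ring
      _ ≤ V := key (by omega) (Nat.mul_le_mul_right _ (by omega)) (by omega) le_rfl (by omega)
  have hCB : C * B ≤ V := by
    calc C * B = 1 * 1 * C * B * 1 := by ring
      _ ≤ V := key (by omega) (by omega) (by omega) (by omega) (by omega)
  have hTn : T * n + n ≤ V := by
    calc T * n + n = n * (T + 1) * 1 * 1 * 1 := by ring
      _ ≤ V := key (by omega) hTT (by omega) (by omega) (by omega)
  have hqT : ogdDen B T ≤ V := by
    have h1 : ogdDen B T ≤ ogdScale B T * (T + 1) := by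
      have := ogdScale_pos (B := B) (T := T)
      unfold ogdDen; rw [mul_add, mul_one]; split_ifs <;> omega
    calc ogdDen B T ≤ (B + 1) * (T + 1) * (T + 1) := h1.trans (Nat.mul_le_mul_right _ hq)
      _ = 1 * ((T + 1) * (T + 1)) * 1 * (B + 1) * 1 := by ring
      _ ≤ V := key (by omega) le_rfl (by omega) le_rfl (by omega)
  have hT : T ≤ V := by
    calc T = 1 * T * 1 * 1 * 1 := by ring
      _ ≤ V := key (by omega) (by omega) (by omega) (by omega) (by omega)
  have hm : n + m ≤ V := by
    calc n + m = (n + m) * 1 * 1 * 1 * 1 := by ring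
      _ ≤ V := key (by omega) (by omega) (by omega) (by omega) (by omega)
  have hC : C ≤ V := by
    calc C = 1 * 1 * C * 1 * 1 := by ring
      _ ≤ V := key (by omega) (by omega) (by omega) (by omega) (by omega)
  have hB : B ≤ V := by
    calc B = 1 * 1 * 1 * B * 1 := by ring
      _ ≤ V := key (by omega) (by omega) (by omega) (by omega) (by omega)
  have hY : Y ≤ V := by
    calc Y = 1 * 1 * 1 * 1 * Y := by ring
      _ ≤ V := key (by omega) (by omega) (by omega) (by omega) (by omega)
  exact ⟨⟨hb, hd, by omega, by omega, by omega, by omega, by omega⟩, by omega, by omega, by omega,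
    by omega, by omega, by omega, by omega, by omega⟩

theorem size_ogdMax_le {Y : ℕ} : (ogdMax n m T C B Y).size ≤
    2 * (n + m + T + C.size + B.size + Y.size) + 8 := by
  unfold ogdMax
  have h1 := size_mul_le 2 ((n + m + 1) * ((T + 1) * (T + 1)) * (C + 1) * (B + 1) * (Y + 1))
  have h2 := size_mul_le ((n + m + 1) * ((T + 1) * (T + 1)) * (C + 1) * (B + 1)) (Y + 1)
  have h3 := size_mul_le ((n + m + 1) * ((T + 1) * (T + 1)) * (C + 1)) (B + 1)
  have h4 := size_mul_le ((n + m + 1) * ((T + 1) * (T + 1))) (C + 1)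
  have h5 := size_mul_le (n + m + 1) ((T + 1) * (T + 1))
  have h6 := size_mul_le (T + 1) (T + 1)
  have h7 := size_le_self (n + m + 1)
  have h8 := size_le_self (T + 1)
  have h9 := size_succ_le C
  have h10 := size_succ_le B
  have h11 := size_succ_le Y
  have h12 := size_le_self 2
  omega

theorem learnsDuals_mono {xstar : BInstance n m → Fin n → ℤ} {K K' : ℝ} (hK : K ≤ K') (hK0 : 0 ≤ K)
    {xhat : (Fin T → BInstance n m) → Fin n → ℝ} (h : LearnsDuals G xstar C B K T xhat) :
    LearnsDuals G xstar C B K' T xhat := by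
  intro D _ hD ε δ hε hδ hT
  refine h D hD ε δ hε hδ ?_
  rcases le_total 0 (Real.log (2 / δ)) with hl | hl
  · refine le_trans ?_ hT
    gcongr
  · exact (mul_nonpos_of_nonneg_of_nonpos (by positivity) hl).trans (Nat.cast_nonneg T)

/-- Subgradient descent on the samples, for an arbitrary choice of optimal dual vectors. -/
theorem exists_learning_algorithm_with_feedback :
    ∃ (P : Program) (K : ℝ) (k : ℕ), ∀ (n m : ℕ), 3 ≤ n → 1 ≤ m →
      ∀ (G : BipartiteGraph n m) (xstar : BInstance n m → Fin n → ℤ), G.IsDualSelection xstar →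
      ∀ C B T : ℕ, ∃ xhat : (Fin T → BInstance n m) → Fin n → ℝ,
        LearnsDuals G xstar C B K T xhat ∧
        ∀ S : Fin T → BInstance n m, (∀ s, G.IsAdmissible C B (S s)) →
          ∃ (t : ℕ) (σ : State), Runs P (learningInput G C B S fun s => xstar (S s)) t σ ∧
            OutputsVector σ (xhat S) ∧
            ∀ Y : ℕ, (∀ s v, |xstar (S s) v| ≤ Y) →
              (t : ℝ) ≤ K * ((n + m + T + Nat.size C + Nat.size B + Nat.size Y : ℕ) : ℝ) ^ k := by
  refine ⟨ogdProgram, 64 + 55 * ogdProgram.weight, 3, ?_⟩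
  intro n m hn hm G xstar _ C B T
  refine ⟨ogdAverage C B xstar, learnsDuals_mono
    (by have : (0 : ℝ) ≤ 55 * ogdProgram.weight := by positivity
        linarith) (by norm_num) (learnsDuals_ogdAverage (by omega)), ?_⟩
  intro S hS
  -- the least bound for the feedback: the run does not depend on the bound in the claim
  obtain ⟨Y, hY, hYmin⟩ : ∃ Y : ℕ, (∀ s v, |xstar (S s) v| ≤ Y) ∧
      ∀ Y' : ℕ, (∀ s v, |xstar (S s) v| ≤ Y') → Y ≤ Y' := by
    have hex : ∃ Y : ℕ, ∀ s v, |xstar (S s) v| ≤ Y := by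
      refine ⟨∑ s, ∑ v, (xstar (S s) v).natAbs, fun s v => ?_⟩
      have h1 := Finset.single_le_sum (f := fun v => (xstar (S s) v).natAbs)
        (fun _ _ => Nat.zero_le _) (Finset.mem_univ v)
      have h2 := Finset.single_le_sum (f := fun s => ∑ v, (xstar (S s) v).natAbs)
        (fun _ _ => Nat.zero_le _) (Finset.mem_univ s)
      rw [Int.abs_eq_natAbs]
      exact_mod_cast h1.trans h2
    classical
    exact ⟨Nat.find hex, Nat.find_spec hex, fun Y' h => Nat.find_min' hex h⟩
  have hb : ∀ t < T, ∀ v, (seqOf S t).2 v ≤ B := fun t ht v => by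
    rw [seqOf_of_lt S ht]; exact_mod_cast (hS ⟨t, ht⟩).2.1 v
  have hd : ∀ t < T, ∀ v, |xstar (seqOf S t) v| ≤ Y := fun t ht v => by
    rw [seqOf_of_lt S ht]; exact hY _ v
  obtain ⟨hU, h1, h2, h3, h4, h5, h6, h7, h8⟩ := ogdBound_ogdMax (m := m) (C := C) hb hd
  obtain ⟨t, τ, hrun, ht, e5, e5'⟩ := (ogdProgram_spec
    (σ := learningInput G C B S fun s => xstar (S s)) rfl rfl rfl rfl
    (fun t ht v => by
      rw [seqOf_of_lt S ht]
      exact table_apply (fun t v => ((S t).2 v : ℤ)) ⟨t, ht⟩ v)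
    (fun t ht v => by
      rw [seqOf_of_lt S ht]
      exact table_apply (fun t => xstar (S t)) ⟨t, ht⟩ v) hU h1 h2).runs
    (bounded_learningInput h3 h4 h5 h6 h7
      (fun t e => le_trans (by exact_mod_cast (hS t).1 e) h6)
      (fun t v => le_trans (by exact_mod_cast (hS t).2.1 v) h7)
      fun t v => (hY t v).trans (by exact_mod_cast h8))
  refine ⟨t, τ, hrun, outputsVector_ogdAverage e5 e5', fun Y' hY' => ?_⟩
  set W := n + m + T + C.size + B.size + Y'.size with hW
  have hsize : (ogdMax n m T C B Y).size + 1 ≤ 5 * W := by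
    have h9 := size_ogdMax_le (n := n) (m := m) (T := T) (C := C) (B := B) (Y := Y)
    have h10 := Nat.size_le_size (hYmin Y' hY')
    omega
  have hsteps : T * 2 + 7 + n * (T * 8 + 8) ≤ 11 * W ^ 2 := by
    have h9 : n * (T * 8 + 8) ≤ W * (W * 8 + 8) := Nat.mul_le_mul (by omega) (by omega)
    have h10 : 4 ≤ W := by omega
    nlinarith
  have h11 : t ≤ 55 * ogdProgram.weight * W ^ 3 := by
    calc t ≤ _ := ht
      _ ≤ 11 * W ^ 2 * (ogdProgram.weight * (5 * W)) := by gcongr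
      _ = _ := by ring
  have h12 : (t : ℝ) ≤ 55 * ogdProgram.weight * (W : ℝ) ^ 3 := by exact_mod_cast h11
  refine h12.trans ?_
  gcongr
  linarith

end Machine

namespace Machine

open BipartiteGraph

variable {n m T C B : ℕ} {G : BipartiteGraph n m} {c : Fin m → ℕ} {b : Fin n → ℕ}

/-! ### The dual vector found by demand scaling -/

/-- The transitions of demand scaling with dual steps, on pairs `(k, y)` of a phase (demands
`b / 2 ^ k`) and a dual vector. They do not depend on the choice of the matching `M`. -/
inductive HStep (G : BipartiteGraph n m) (c : Fin m → ℕ) (b : Fin n → ℕ) :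
    ℕ × (Fin n → ℤ) → ℕ × (Fin n → ℤ) → Prop
  | dual {k : ℕ} {y : Fin n → ℤ} {M : Fin m → ℕ} {δ : ℤ} :
      G.Compl c (fun v => b v / 2 ^ k) y M → G.Stuck c (fun v => b v / 2 ^ k) y M →
      G.IsMinSlack c y (G.reachSet c (fun v => b v / 2 ^ k) y M) δ →
      HStep G c b (k, y) (k, G.shift (G.reachSet c (fun v => b v / 2 ^ k) y M) δ y)
  | next {k : ℕ} {y : Fin n → ℤ} {M : Fin m → ℕ} :
      G.Compl c (fun v => b v / 2 ^ (k + 1)) y M → G.Stuck c (fun v => b v / 2 ^ (k + 1)) y M →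
      G.Closed (G.reachSet c (fun v => b v / 2 ^ (k + 1)) y M) → HStep G c b (k + 1, y) (k, y)

/-- The dual vector `y` is the result of demand scaling, started with `y = 0`. -/
def HFinal (G : BipartiteGraph n m) (c : Fin m → ℕ) (b : Fin n → ℕ) (y : Fin n → ℤ) : Prop :=
  Relation.ReflTransGen (HStep G c b) ((maxDem G b).size + 1, 0) (0, y) ∧
    ∃ M, G.Compl c b y M ∧ G.Stuck c b y M ∧ G.Closed (G.reachSet c b y M)

theorem isMinSlack_unique {y : Fin n → ℤ} {X : Finset (Fin n)} {δ δ' : ℤ}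
    (h : G.IsMinSlack c y X δ) (h' : G.IsMinSlack c y X δ') : δ = δ' := by
  obtain ⟨⟨e, h1, h2, h3⟩, h4⟩ := h
  obtain ⟨⟨e', h1', h2', h3'⟩, h4'⟩ := h'
  have := h4 e' h1' h2'
  have := h4' e h1 h2
  omega

theorem not_closed_of_isMinSlack {y : Fin n → ℤ} {X : Finset (Fin n)} {δ : ℤ}
    (h : G.IsMinSlack c y X δ) : ¬ G.Closed X := by
  obtain ⟨⟨e, h1, h2, -⟩, -⟩ := h
  exact fun hc => h2 (hc e h1)

/-- Each step depends on the matching only through the reachable set, which is the same for all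
matchings without augmenting paths. -/
theorem hStep_rightUnique : Relator.RightUnique (HStep G c b) := by
  intro s s₁ s₂ h h'
  cases h with
  | @dual k y M δ hC hs hδ =>
    cases h' with
    | dual hC' hs' hδ' =>
      rw [hC'.reachSet_eq hs' hC hs] at hδ' ⊢
      rw [isMinSlack_unique hδ hδ']
    | next hC' hs' hc' =>
      rw [hC'.reachSet_eq hs' hC hs] at hc'
      exact absurd hc' (not_closed_of_isMinSlack hδ)
  | next hC hs hc =>
    cases h' with
    | dual hC' hs' hδ' =>
      rw [hC.reachSet_eq hs hC' hs'] at hc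
      exact absurd hc (not_closed_of_isMinSlack hδ')
    | next hC' hs' hc' => rfl

/-- The result of demand scaling is unique, although the matchings that occur are not. -/
theorem HFinal.unique {y y' : Fin n → ℤ} (h : HFinal G c b y) (h' : HFinal G c b y') : y = y' := by
  have term : ∀ {y : Fin n → ℤ}, HFinal G c b y → ∀ s, ¬ HStep G c b (0, y) s := by
    rintro y ⟨-, M, hC, hs, hc⟩ s hst
    have hb : (fun v => b v / 2 ^ 0) = b := by simp
    generalize hk : ((0, y) : ℕ × (Fin n → ℤ)) = s₀ at hst
    cases hst with
    | dual hC' hs' hδ' =>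
      obtain ⟨rfl, rfl⟩ := Prod.mk.inj hk
      rw [hb] at hC' hs' hδ'
      rw [hC.reachSet_eq hs hC' hs'] at hc
      exact not_closed_of_isMinSlack hδ' hc
    | next => simp at hk
  rcases Relation.ReflTransGen.total_of_right_unique hStep_rightUnique h.1 h'.1 with h1 | h1
  · rcases Relation.ReflTransGen.cases_head h1 with h2 | ⟨s, h2, -⟩
    · exact (Prod.mk.inj h2).2
    · exact absurd h2 (term h s)
  · rcases Relation.ReflTransGen.cases_head h1 with h2 | ⟨s, h2, -⟩
    · exact (Prod.mk.inj h2).2.symm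
    · exact absurd h2 (term h' s)

theorem closed_zero {y : Fin n → ℤ} :
    G.Closed (G.reachSet c (fun v => b v / 2 ^ ((maxDem G b).size + 1)) y fun _ => 0) := by
  intro e he
  obtain ⟨u, ⟨⟨e', rfl⟩, hu⟩, -⟩ := mem_reachSet.1 he
  dsimp only at hu
  rw [div_pow_size_eq_zero (Inc.left e')] at hu
  exact absurd hu (Nat.not_lt_zero _)

/-- A bound for the number of augmentations and dual steps of a phase: `n + 1` for each of at most
`n` augmentations, and `n` dual steps after the last one. -/
def phaseBound (n : ℕ) : ℕ := (n + 1) * n + n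

/-- The growth of the dual vector: a dual step at most triples `|y| + A`. -/
theorem shift_growth {y : Fin n → ℤ} {X : Finset (Fin n)} {δ : ℤ} {A E Z : ℕ}
    (hc : ∀ e, c e ≤ A) (hδ : G.IsMinSlack c y X δ) (h0 : 0 < δ)
    (h : ∀ v, ((y v).natAbs + A) * 3 ^ (E + 1) ≤ Z) (v : Fin n) :
    ((G.shift X δ y v).natAbs + A) * 3 ^ E ≤ Z := by
  obtain ⟨⟨e, -, -, h3⟩, -⟩ := hδ
  have h4 := hc e
  have h5 : (G.shift X δ y v).natAbs + A ≤
      ((y v).natAbs + A) + ((y (G.left e)).natAbs + A) + ((y (G.right e)).natAbs + A) := by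
    have h6 : (G.shift X δ y v).natAbs ≤ (y v).natAbs + δ.natAbs := by
      unfold shift; split_ifs <;> omega
    omega
  have h6 := h v
  have h7 := h (G.left e)
  have h8 := h (G.right e)
  have h9 := Nat.mul_le_mul_right (3 ^ E) h5
  rw [pow_succ] at h6 h7 h8
  refine h9.trans ?_
  generalize (y v).natAbs + A = p₁ at *
  generalize (y (G.left e)).natAbs + A = p₂ at *
  generalize (y (G.right e)).natAbs + A = p₃ at *
  rw [add_mul, add_mul]
  rw [← mul_assoc] at h6 h7 h8
  omega

/-- Demand scaling with dual steps: the potential of a phase is `n + 1` times the deficiency with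
respect to a vertex cover, plus the number of unreached vertices. -/
theorem scaleLoop_hungarian {U A Z : ℕ} (hm : 3 * m + n + 1 ≤ U) (hb : ∀ v, 2 * b v + 2 ≤ U)
    (hc : ∀ e, c e ≤ A) (hZ : A * 3 ^ (((maxDem G b).size + 1) * phaseBound n) ≤ Z)
    (hU : A + 3 * Z ≤ U) (m1 : 1 ≤ m)
    {σ : State} (H : Holds G c b σ) (hy : HoldsY (0 : Fin n → ℤ) σ)
    (hM : HoldsM (fun _ : Fin m => 0) σ) (hfl : σ.reg 14 = 0)
    (hD : σ.reg 11 = (2 ^ (maxDem G b).size : ℕ)) :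
    HT U scaleLoop σ (((maxDem G b).size + 1) * ((phaseBound n + 3) * (m * 160)) + 1) fun τ =>
      Frame n σ τ ∧ ∃ y, HoldsY y τ ∧ HFinal G c b y ∧ ∀ v, |y v| ≤ Z := by
  set K := (maxDem G b).size with hK
  have hpow : 2 ^ (K + 1) / 2 = 2 ^ K := by rw [pow_succ]; omega
  have hKU : 2 ^ K ≤ U := by
    obtain ⟨e⟩ : Nonempty (Fin m) := ⟨⟨0, m1⟩⟩
    have h1 := two_pow_size_le (maxDem G b)
    have h2 : maxDem G b ≤ (U - 2) / 2 := maxDem_le fun v => by have := hb v; omega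
    exact h1.trans (by omega)
  have hcard : ∀ X : Finset (Fin n), X.card ≤ n := fun X => by
    simpa using Finset.card_le_univ X
  refine (scaleLoop_spec (U := U) (Y := Z) (ψ₀ := phaseBound n) (f := 0) le_rfl hm
    (fun v => by have := hb v; omega) (fun e => by have := hc e; omega) m1
    (fun k M y => Relation.ReflTransGen (HStep G c b) (K + 1, 0) (k, y) ∧
      G.Stuck c (fun v => b v / 2 ^ k) y M ∧ G.Closed (G.reachSet c (fun v => b v / 2 ^ k) y M) ∧
      ∀ v, ((y v).natAbs + A) * 3 ^ (k * phaseBound n) ≤ Z)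
    (fun k M y ψ => Relation.ReflTransGen (HStep G c b) (K + 1, 0) (k, y) ∧
      (∃ S : Finset (Fin n), (∀ e, G.left e ∈ S ∨ G.right e ∈ S) ∧
        (n + 1) * ∑ v ∈ S, b v / 2 ^ k + n ≤ (n + 1) * ∑ e, M e + ψ +
          (G.reachSet c (fun v => b v / 2 ^ k) y M).card) ∧
      ∀ v, ((y v).natAbs + A) * 3 ^ (k * phaseBound n + ψ) ≤ Z)
    ?_ ?_ ?_ ?_ ?_ (K + 1) (by rw [hpow]; exact hKU) H hy hM hfl (by rw [hpow]; exact hD)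
    (compl_zero fun e => by simp) ⟨.refl, stuck_zero, closed_zero, fun v => by simpa using hZ⟩).mono
    le_rfl ?_
  · rintro k M y ⟨htr, hs, hcl, hsz⟩ hC
    refine ⟨htr.tail (.next hC hs hcl), ⟨cover G (G.reachSet c (fun v => b v / 2 ^ (k + 1)) y M),
      fun e => mem_cover_of_imp (hcl e), ?_⟩, fun v => ?_⟩
    · have h1 := sum_div_pow_le (cover G (G.reachSet c (fun v => b v / 2 ^ (k + 1)) y M)) b k
      rw [hC.sum_cover_eq hs] at h1
      have h2 := Nat.mul_le_mul_left (n + 1) h1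
      rw [two_mul_sum, phaseBound]
      rw [mul_add] at h2
      omega
    · have := hsz v
      rwa [show (k + 1) * phaseBound n = k * phaseBound n + phaseBound n by ring] at this
  · rintro k M y ψ ⟨htr, -, hsz⟩ - hs hcl
    refine ⟨htr, hs, hcl.resolve_left (by simp), fun v => le_trans ?_ (hsz v)⟩
    exact Nat.mul_le_mul_left _ (Nat.pow_le_pow_right (by norm_num) (Nat.le_add_right _ _))
  · rintro k M y ψ ⟨-, -, hsz⟩ v
    have h1 := hsz v
    have h2 := Nat.le_mul_of_pos_right ((y v).natAbs + A)
      (Nat.pow_pos (n := k * phaseBound n + ψ) (show 0 < 3 by norm_num))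
    rw [Int.abs_eq_natAbs]
    omega
  · rintro k M M' y ψ ⟨htr, ⟨S, hS, hle⟩, hsz⟩ hC hC' hsum
    have h1 := sum_le_of_cover (β := fun v => b v / 2 ^ k) (S := S) (fun e _ => hS e)
      fun v _ => hC'.sub v
    have h2 := hcard (G.reachSet c (fun v => b v / 2 ^ k) y M)
    have h3 := Nat.mul_le_mul_left (n + 1) h1
    rw [hsum] at h3
    rw [mul_add, mul_one] at h3
    refine ⟨ψ - 1, by omega, htr, ⟨S, hS, ?_⟩, fun v => le_trans ?_ (hsz v)⟩
    · rw [hsum, mul_add, mul_one]; omega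
    · exact Nat.mul_le_mul_left _ (Nat.pow_le_pow_right (by norm_num) (by omega))
  · rintro - k M y ψ δ ⟨htr, ⟨S, hS, hle⟩, hsz⟩ hC hs hδ
    have h1 := sum_le_of_cover (β := fun v => b v / 2 ^ k) (S := S) (fun e _ => hS e)
      fun v _ => hC.sub v
    have h2 := Finset.card_lt_card (reachSet_ssubset_shift hδ)
    have h3 := Nat.mul_le_mul_left (n + 1) h1
    have h4 := hcard (G.reachSet c (fun v => b v / 2 ^ k)
      (G.shift (G.reachSet c (fun v => b v / 2 ^ k) y M) δ y) M)
    refine ⟨ψ - 1, by omega, htr.tail (.dual hC hs hδ), ⟨S, hS, by omega⟩,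
      shift_growth hc hδ (hC.shift hδ).1 fun v => ?_⟩
    have h5 : k * phaseBound n + (ψ - 1) + 1 = k * phaseBound n + ψ := by omega
    rw [h5]
    exact hsz v
  · rintro τ - ⟨hF, M, y, h1, h2, h3, h4, h5, h6, h7⟩
    refine ⟨hF, y, h2, ⟨h4, M, h3, by simpa using h5, by simpa using h6⟩, fun v => ?_⟩
    have := h7 v
    rw [Int.abs_eq_natAbs]
    simp only [zero_mul, pow_zero, mul_one] at this
    omega

/-- Computation of an optimal dual vector for one instance. -/
def sampleProgram : Program := scaleInit ;; scaleLoop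

/-- The result is the dual vector characterized by `HFinal`, of absolute value at most `Z`. -/
theorem sampleProgram_spec {U A L Z : ℕ} (hm : 3 * m + n + 1 ≤ U) (hb : ∀ v, 2 * b v + 2 ≤ U)
    (hc : ∀ e, c e ≤ A) (hL : (maxDem G b).size ≤ L) (hZ : A * 3 ^ ((L + 1) * phaseBound n) ≤ Z)
    (hU : A + 3 * Z ≤ U) (m1 : 1 ≤ m)
    {σ : State} (H : Holds G c b σ) (hy : HoldsY (0 : Fin n → ℤ) σ)
    (hfl : σ.reg 14 = 0) :
    HT U sampleProgram σ ((m * 7 + 5 + 2 * L) + ((L + 1) * ((phaseBound n + 3) * (m * 160)) + 1))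
      fun τ => Frame n σ τ ∧ ∃ y, HoldsY y τ ∧ HFinal G c b y ∧ ∀ v, |y v| ≤ Z := by
  have hZ' : A * 3 ^ (((maxDem G b).size + 1) * phaseBound n) ≤ Z :=
    le_trans (Nat.mul_le_mul_left _ (Nat.pow_le_pow_right (by norm_num)
      (Nat.mul_le_mul_right _ (by omega)))) hZ
  refine HT.mono ((scaleInit_spec H (by omega) (fun v => by have := hb v; omega) (by omega) (by
    have h2 : maxDem G b ≤ (U - 2) / 2 := maxDem_le fun v => by have := hb v; omega
    omega)).seq fun τ₁ S₁ ⟨hM₁, h11₁⟩ => (scaleLoop_hungarian hm hb hc hZ' hU m1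
      (H.same S₁ keeps_scaleInit) (hy.same S₁ keeps_scaleInit.r13 (by simp [scaleInit, forEdges]))
      hM₁ (by rw [S₁.1 14 (by simp [scaleInit, forEdges]), hfl]) h11₁).mono le_rfl
      fun τ S₂ h => (⟨?_, h.2⟩ : Frame n σ τ ∧ ∃ y, HoldsY y τ ∧ HFinal G c b y ∧
        ∀ v, |y v| ≤ Z)) ?_ fun τ _ h => h
  · exact (Frame.of_same S₁ (by simp [scaleInit, forEdges])).trans h.1 (S₁.1 13 keeps_scaleInit.r13)
  · gcongr

end Machine

namespace Machine

open BipartiteGraph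

variable {n m T C B : ℕ} {G : BipartiteGraph n m} {c : Fin m → ℕ} {b : Fin n → ℕ}

/-! ### Learning from the instances alone -/

theorem maxDem_size_le (hb : ∀ v, b v ≤ B) : (maxDem G b).size ≤ B.size :=
  Nat.size_le_size (maxDem_le hb)

theorem holds_learningInput (S : Fin T → BInstance n m) (t : Fin T) {σ : State}
    (h1 : σ.reg 1 = m) (h12 : σ.reg 12 = ((t * m : ℕ) : ℤ)) (h13 : σ.reg 13 = ((t * n : ℕ) : ℤ))
    (ha : ∀ a < 4, σ.arr a = (learningInput G C B S 0).arr a) :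
    Holds G (S t).1 (S t).2 σ where
  hm := h1
  left e := by rw [ha 0 (by norm_num)]; exact vec_apply (fun e => (G.left e : ℤ)) e
  right e := by rw [ha 1 (by norm_num)]; exact vec_apply (fun e => (G.right e : ℤ)) e
  cost e := by
    rw [ha 2 (by norm_num), h12]
    exact_mod_cast table_apply (fun t e => ((S t).1 e : ℤ)) t e
  dem v := by
    rw [ha 3 (by norm_num), h13]
    exact_mod_cast table_apply (fun t v => ((S t).2 v : ℤ)) t v

theorem exists_hFinal_abs_le {A Z : ℕ} (m1 : 1 ≤ m) {I : BInstance n m} (hc : ∀ e, I.1 e ≤ A)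
    (hb : ∀ v, I.2 v ≤ B) (hZ : A * 3 ^ ((B.size + 1) * phaseBound n) ≤ Z) :
    ∃ y, HFinal G I.1 I.2 y ∧ ∀ v, |y v| ≤ Z := by
  obtain ⟨-, -, -, -, -, y, -, hy⟩ := sampleProgram_spec (G := G) (c := I.1) (b := I.2)
    (U := (3 * m + n + 1) + (2 * B + 2) + (A + 3 * Z)) (A := A) (Z := Z)
    (σ := learningInput G 0 0 (fun _ : Fin 1 => I) 0) (by omega)
    (fun v => by have := hb v; omega) hc (maxDem_size_le hb) hZ (by omega) m1
    (holds_learningInput (C := 0) (B := 0) (fun _ : Fin 1 => I) 0 rfl (by simp [learningInput])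
      (by simp [learningInput]) fun _ _ => rfl)
    (fun v => by
      have : (learningInput G 0 0 (fun _ : Fin 1 => I) 0).arr 4 = table 0 := rfl
      rw [this]; simp [table, vec]) rfl
  exact ⟨y, hy⟩

theorem exists_hFinal (m1 : 1 ≤ m) (I : BInstance n m) : ∃ y, HFinal G I.1 I.2 y := by
  obtain ⟨y, hy, -⟩ := exists_hFinal_abs_le (G := G) m1
    (fun e => Finset.single_le_sum (f := I.1) (fun _ _ => Nat.zero_le _) (Finset.mem_univ e))
    (fun v => Finset.single_le_sum (f := I.2) (fun _ _ => Nat.zero_le _) (Finset.mem_univ v)) le_rfl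
  exact ⟨y, hy⟩

open Classical in
/-- The optimal dual vector that demand scaling finds. -/
noncomputable def hungarianDual (G : BipartiteGraph n m) (I : BInstance n m) : Fin n → ℤ :=
  if h : ∃ y, HFinal G I.1 I.2 y then h.choose else 0

theorem hFinal_hungarianDual (m1 : 1 ≤ m) (I : BInstance n m) :
    HFinal G I.1 I.2 (hungarianDual G I) := by
  have h := exists_hFinal (G := G) m1 I
  rw [hungarianDual, dif_pos h]
  exact h.choose_spec

theorem isDualSelection_hungarianDual (m1 : 1 ≤ m) : G.IsDualSelection (hungarianDual G) := by
  rintro I ⟨M', hM'⟩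
  obtain ⟨-, M, hC, hs, hc⟩ := hFinal_hungarianDual (G := G) m1 I
  exact hC.isOptimalDual (hC.perfect hs hc hM')

/-- Computation of an optimal dual vector for each sample, followed by subgradient descent. -/
def learnProgram : Program :=
  .assign 24 (.const 0) ;;
  .loop ((Expr.reg 24).lt (.reg 2))
    ((.assign 12 (.reg 24 * .reg 1) ;; .assign 13 (.reg 24 * .reg 0)) ;; sampleProgram ;;
      .assign 24 (.reg 24 + .const 1)) ;;
  ogdProgram

/-- The memory after the dual vectors of the samples `0, ..., i - 1` have been found. -/
structure SampleEnv (G : BipartiteGraph n m) (C B : ℕ) (S : Fin T → BInstance n m) (i : ℕ)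
    (σ : State) : Prop where
  r0 : σ.reg 0 = n
  r1 : σ.reg 1 = m
  r2 : σ.reg 2 = T
  r3 : σ.reg 3 = C
  r4 : σ.reg 4 = B
  r14 : σ.reg 14 = 0
  r24 : σ.reg 24 = (i : ℕ)
  inp : ∀ a < 4, σ.arr a = (learningInput G C B S 0).arr a
  done : ∀ t : Fin T, (t : ℕ) < i → ∀ v : Fin n,
    σ.arr 4 ((t * n + v : ℕ) : ℤ) = hungarianDual G (S t) v
  todo : ∀ x : ℕ, i * n ≤ x → σ.arr 4 (x : ℤ) = 0

theorem sampleProgram_keeps : Keeps sampleProgram := by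
  have h1 := keeps_scaleInit
  have h2 := keeps_scaleLoop
  constructor <;> simp [sampleProgram, h1.r1, h1.r12, h1.r13, h1.a0, h1.a1, h1.a2, h1.a3,
    h2.r1, h2.r12, h2.r13, h2.a0, h2.a1, h2.a2, h2.a3]

theorem sampleProgram_modReg {r : ℕ} (hr : r = 0 ∨ r = 2 ∨ r = 3 ∨ r = 4 ∨ r = 14 ∨ r = 24) :
    ¬ sampleProgram.modReg r := by
  rcases hr with rfl | rfl | rfl | rfl | rfl | rfl <;>
    simp [sampleProgram, scaleInit, scaleLoop, phase, step, initSweep, excessSweep, adjSweep,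
      rootSweep, searchLoop, foundSweep, augmentLoop, slackSweep, dualSweep, copySweep, forEdges,
      pushCode, forwardArc, backwardArc, doubleSweep]

theorem sampleBody_spec {U A Z : ℕ} {S : Fin T → BInstance n m} (hm : 3 * m + n + 1 ≤ U)
    (hbU : 2 * B + 2 ≤ U) (hc : ∀ t e, (S t).1 e ≤ A) (hb : ∀ t v, (S t).2 v ≤ B)
    (hZ : A * 3 ^ ((B.size + 1) * phaseBound n) ≤ Z) (hU : A + 3 * Z ≤ U) (m1 : 1 ≤ m)
    (hTn : T * n ≤ U) (hTm : T * m ≤ U) (hT : T ≤ U) (i : Fin T) {σ : State}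
    (H : SampleEnv G C B S i σ) :
    HT U ((.assign 12 (.reg 24 * .reg 1) ;; .assign 13 (.reg 24 * .reg 0)) ;; sampleProgram ;;
      .assign 24 (.reg 24 + .const 1)) σ
      (2 + (((m * 7 + 5 + 2 * B.size) + ((B.size + 1) * ((phaseBound n + 3) * (m * 160)) + 1)) + 1))
      (SampleEnv G C B S (i + 1)) := by
  have sm : Small U ((i * m : ℕ) : ℤ) := Small.of_nonneg (by positivity) (by
    exact_mod_cast (Nat.mul_le_mul_right m i.2.le).trans hTm)
  have sn : Small U ((i * n : ℕ) : ℤ) := Small.of_nonneg (by positivity) (by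
    exact_mod_cast (Nat.mul_le_mul_right n i.2.le).trans hTn)
  have si : Small U ((i : ℕ) + 1 : ℤ) := Small.of_nonneg (by positivity) (by
    have := i.2; omega)
  refine (HT.of_wp (.seq (.assign 12 (.reg 24 * .reg 1)) (.assign 13 (.reg 24 * .reg 0)))
    (Q := fun τ => τ = (σ.setReg 12 ((i * m : ℕ) : ℤ)).setReg 13 ((i * n : ℕ) : ℤ)) ?_).seq
    fun τ₁ _ e₁ => ?_
  · have e1 : ((i : ℕ) : ℤ) * m = ((i * m : ℕ) : ℤ) := by push_cast; rfl
    have e2 : ((i : ℕ) : ℤ) * n = ((i * n : ℕ) : ℤ) := by push_cast; rfl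
    simp only [Program.wp, Expr.eval_mul, Expr.eval_reg, State.reg_setReg, H.r24, H.r1, H.r0,
      Nat.reduceEqDiff, if_false, e1, e2]
    exact ⟨sm, sn, trivial⟩
  · have r₁ : ∀ r, r ≠ 12 → r ≠ 13 → τ₁.reg r = σ.reg r := fun r h h' => by simp [e₁, h, h']
    have r12 : τ₁.reg 12 = ((i * m : ℕ) : ℤ) := by simp [e₁]
    have r13 : τ₁.reg 13 = ((i * n : ℕ) : ℤ) := by simp [e₁]
    have a₁ : ∀ a, τ₁.arr a = σ.arr a := fun a => by simp [e₁]
    have H₁ : Holds G (S i).1 (S i).2 τ₁ := holds_learningInput (C := C) (B := B) S i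
      (by rw [r₁ 1 (by norm_num) (by norm_num), H.r1]) r12 r13 fun a ha => by rw [a₁, H.inp a ha]
    refine (sampleProgram_spec hm (fun v => by have := hb i v; omega) (hc i)
      (maxDem_size_le (hb i)) hZ hU m1 H₁ (fun v => ?_)
      (by rw [r₁ 14 (by norm_num) (by norm_num), H.r14])).seq fun τ₂ S₂ ⟨hF, y, hy, hfin, _⟩ => ?_
    · rw [a₁, r13]
      exact_mod_cast H.todo (i * n + v) (Nat.le_add_right _ _)
    · have hyeq : y = hungarianDual G (S i) := hfin.unique (hFinal_hungarianDual m1 (S i))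
      have r₂ : ∀ r, (r = 0 ∨ r = 2 ∨ r = 3 ∨ r = 4 ∨ r = 14 ∨ r = 24) → τ₂.reg r = σ.reg r :=
        fun r hr => by
          rw [S₂.1 r (sampleProgram_modReg hr), r₁ r (by omega) (by omega)]
      have k := sampleProgram_keeps
      have hout : ∀ x : ℕ, (x < i * n ∨ i * n + n ≤ x) → τ₂.arr 4 (x : ℤ) = σ.arr 4 x :=
        fun x hx => by
          rw [hF x (by rw [r13]; omega), a₁]
      refine HT.of_wp (.assign _ _) ?_
      simp only [Program.wp, Expr.eval_add, Expr.eval_reg, Expr.eval_const,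
        r₂ 24 (by norm_num), H.r24]
      refine ⟨si, ⟨?_, ?_, ?_, ?_, ?_, ?_, ?_, ?_, ?_, ?_⟩⟩
      · simp [r₂ 0 (by norm_num), H.r0]
      · simp [S₂.1 1 k.r1, r₁ 1 (by norm_num) (by norm_num), H.r1]
      · simp [r₂ 2 (by norm_num), H.r2]
      · simp [r₂ 3 (by norm_num), H.r3]
      · simp [r₂ 4 (by norm_num), H.r4]
      · simp [r₂ 14 (by norm_num), H.r14]
      · simp
      · intro a ha
        rw [State.arr_setReg, S₂.2 a (by interval_cases a <;> simp [k.a0, k.a1, k.a2, k.a3]), a₁,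
          H.inp a ha]
      · intro t ht v
        rw [State.arr_setReg]
        rcases Nat.lt_succ_iff_lt_or_eq.1 ht with h | h
        · have h1 := Nat.mul_le_mul_right n (Nat.succ_le_of_lt h)
          rw [Nat.succ_mul] at h1
          rw [hout _ (Or.inl (by have := v.2; omega)), H.done t h v]
        · obtain rfl : t = i := Fin.ext h
          rw [← hyeq, ← hy v, S₂.1 13 k.r13, r13]
          push_cast
          rfl
      · intro x hx
        rw [add_mul, one_mul] at hx
        rw [State.arr_setReg, hout x (Or.inr hx), H.todo x (by omega)]

/-- The rows of array 4 are zero until their dual vector has been computed; afterwards they serve as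
the feedback for subgradient descent. -/
theorem learnProgram_spec {U A Z : ℕ} {S : Fin T → BInstance n m} (hm : 3 * m + n + 1 ≤ U)
    (hbU : 2 * B + 2 ≤ U) (hc : ∀ t e, (S t).1 e ≤ A) (hb : ∀ t v, (S t).2 v ≤ B)
    (hZ : A * 3 ^ ((B.size + 1) * phaseBound n) ≤ Z) (hU : A + 3 * Z ≤ U) (m1 : 1 ≤ m)
    (hTn : T * n ≤ U) (hTm : T * m ≤ U) (hT : T ≤ U) {Y : ℕ}
    (hO : OgdBound n T C B (ogdScale B T) Y U (fun t => (seqOf S t).2)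
      (fun t => hungarianDual G (seqOf S t)))
    (hU' : ogdDen B T ≤ U) (hU'' : C * ogdScale B T + ogdScale B T ≤ U) :
    HT U learnProgram (learningInput G C B S 0)
      (1 + ((T * ((2 + (((m * 7 + 5 + 2 * B.size) +
        ((B.size + 1) * ((phaseBound n + 3) * (m * 160)) + 1)) + 1)) + 1) + 1) +
        (T * 2 + 7 + n * (T * 8 + 8))))
      fun τ => OutputsVector τ (ogdAverage C B (hungarianDual G) S) := by
  refine (HT.of_wp (.assign 24 (.const 0)) (Q := fun τ => τ =
    (learningInput G C B S 0).setReg 24 0) ?_).seq fun τ₁ _ e₁ =>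
    (HT.loop (fun k τ => ∃ i, i + k = T ∧ SampleEnv G C B S i τ) ?_ T τ₁ ?_).seq fun τ₂ _ h₂ => ?_
  · simp [Program.wp, small_iff]
  · rintro k τ ⟨i, hik, H⟩ he
    have hi : i < T := by
      simp only [Expr.eval_lt, Expr.eval_reg, H.r24, H.r2] at he
      by_contra hc
      exact he (if_neg (by omega))
    refine (sampleBody_spec hm hbU hc hb hZ hU m1 hTn hTm hT ⟨i, hi⟩ H).mono le_rfl
      fun τ' _ H' => ⟨k - 1, by omega, i + 1, by omega, H'⟩
  · have h4 : (learningInput G C B S 0).arr 4 = table 0 := rfl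
    refine ⟨0, by omega, e₁ ▸ ⟨rfl, rfl, rfl, rfl, rfl, rfl, rfl, fun _ _ => rfl,
      fun t ht => absurd ht (Nat.not_lt_zero _), fun x _ => ?_⟩⟩
    rw [State.arr_setReg, h4]
    simp [table, vec]
  · obtain ⟨⟨k, -, i, hik, H⟩, he⟩ := h₂
    obtain rfl : i = T := by
      simp only [Expr.eval_lt, Expr.eval_reg, H.r24, H.r2] at he
      by_contra hc
      rw [if_pos (by omega)] at he
      exact one_ne_zero he
    refine (ogdProgram_spec H.r0 H.r2 H.r3 H.r4 (fun t ht v => ?_) (fun t ht v => ?_) hO hU'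
      hU'').mono le_rfl fun τ _ h => outputsVector_ogdAverage h.1 h.2
    · rw [H.inp 3 (by norm_num), seqOf_of_lt S ht]
      exact table_apply (fun t v => ((S t).2 v : ℤ)) ⟨t, ht⟩ v
    · rw [seqOf_of_lt S ht]
      exact H.done ⟨t, ht⟩ ht v

theorem size_three_pow_le (E : ℕ) : (3 ^ E).size ≤ 2 * E + 1 := by
  rw [Nat.size_le, pow_succ, pow_mul]
  have : 3 ^ E ≤ (2 ^ 2) ^ E := Nat.pow_le_pow_left (by norm_num) E
  have : 0 < (2 ^ 2) ^ E := by positivity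
  omega

theorem abs_hungarianDual_le {A Z : ℕ} (m1 : 1 ≤ m) {I : BInstance n m} (hc : ∀ e, I.1 e ≤ A)
    (hb : ∀ v, I.2 v ≤ B) (hZ : A * 3 ^ ((B.size + 1) * phaseBound n) ≤ Z) (v : Fin n) :
    |hungarianDual G I v| ≤ Z := by
  obtain ⟨y, hy, hyZ⟩ := exists_hFinal_abs_le (G := G) m1 hc hb hZ
  rw [(hFinal_hungarianDual m1 I).unique hy]
  exact hyZ v

theorem four_mul_pow_le {W : ℕ} (hW : 4 ≤ W) (k : ℕ) : 4 * W ^ k ≤ W ^ (k + 1) := by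
  rw [pow_succ, mul_comm (W ^ k)]
  exact Nat.mul_le_mul_right _ hW

theorem phaseBound_lt (n : ℕ) : phaseBound n < (n + 1) ^ 2 := by
  unfold phaseBound
  nlinarith

/-- The numbers that occur when learning from the instances alone have polynomial bit length. -/
theorem size_learnMax_le (hn : 3 ≤ n) (m1 : 1 ≤ m) :
    (ogdMax n m T C B (2 * (C * 3 ^ ((B.size + 1) * phaseBound n)) + 1)).size + 1 ≤
      6 * (n + m + T + C.size + B.size) ^ 3 := by
  set Z := C * 3 ^ ((B.size + 1) * phaseBound n) with hZ
  set W := n + m + T + C.size + B.size with hW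
  have hW4 : 4 ≤ W := by omega
  have hE : (B.size + 1) * phaseBound n ≤ W ^ 3 := by
    calc _ ≤ W * W ^ 2 := Nat.mul_le_mul (by omega)
          ((phaseBound_lt n).le.trans (Nat.pow_le_pow_left (by omega) 2))
      _ = W ^ 3 := by ring
  have q1 : 4 * W ≤ W ^ 2 := by simpa using four_mul_pow_le hW4 1
  have q2 : 4 * W ^ 2 ≤ W ^ 3 := four_mul_pow_le hW4 2
  have e1 := size_ogdMax_le (n := n) (m := m) (T := T) (C := C) (B := B) (Y := 2 * Z + 1)
  have e2 := size_succ_le (2 * Z)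
  have e3 := size_mul_le 2 Z
  have e4 := size_mul_le C (3 ^ ((B.size + 1) * phaseBound n))
  have e5 := size_three_pow_le ((B.size + 1) * phaseBound n)
  have e6 : Nat.size 2 = 2 := by decide
  rw [← hZ] at e4
  omega

theorem learnSteps_le (hn : 3 ≤ n) (m1 : 1 ≤ m) :
    1 + ((T * ((2 + (((m * 7 + 5 + 2 * B.size) +
        ((B.size + 1) * ((phaseBound n + 3) * (m * 160)) + 1)) + 1)) + 1) + 1) +
        (T * 2 + 7 + n * (T * 8 + 8))) ≤ 360 * (n + m + T + C.size + B.size) ^ 5 := by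
  set W := n + m + T + C.size + B.size with hW
  have hW4 : 4 ≤ W := by omega
  have q1 : 4 * W ≤ W ^ 2 := by simpa using four_mul_pow_le hW4 1
  have q2 : 4 * W ^ 2 ≤ W ^ 3 := four_mul_pow_le hW4 2
  have q3 : 4 * W ^ 3 ≤ W ^ 4 := four_mul_pow_le hW4 3
  have q4 : 4 * W ^ 4 ≤ W ^ 5 := four_mul_pow_le hW4 4
  have e1 : phaseBound n + 3 ≤ 2 * W ^ 2 := by
    have h1 := phaseBound_lt n
    have h2 : (n + 1) ^ 2 ≤ W ^ 2 := Nat.pow_le_pow_left (by omega) 2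
    omega
  have e2 : (B.size + 1) * ((phaseBound n + 3) * (m * 160)) ≤ 320 * W ^ 4 := by
    calc _ ≤ W * (2 * W ^ 2 * (W * 160)) :=
          Nat.mul_le_mul (by omega) (Nat.mul_le_mul e1 (Nat.mul_le_mul_right _ (by omega)))
      _ = _ := by ring
  generalize (B.size + 1) * ((phaseBound n + 3) * (m * 160)) = s at *
  have e3 : (2 + (((m * 7 + 5 + 2 * B.size) + (s + 1)) + 1)) + 1 ≤ 323 * W ^ 4 := by omega
  have e4 := Nat.mul_le_mul (show T ≤ W by omega) e3
  have e5 : n * (T * 8 + 8) ≤ W * (W * 8 + 8) := Nat.mul_le_mul (by omega) (by omega)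
  have e6 : W * (323 * W ^ 4) = 323 * W ^ 5 := by ring
  have e7 : W * (W * 8 + 8) = 8 * W ^ 2 + 8 * W := by ring
  omega

/-- Subgradient descent on the samples, with the dual vectors that demand scaling finds. -/
theorem exists_learning_algorithm :
    ∃ (P : Program) (K : ℝ) (k : ℕ), ∀ (n m : ℕ), 3 ≤ n → 1 ≤ m → ∀ (G : BipartiteGraph n m),
      ∃ xstar : BInstance n m → Fin n → ℤ, G.IsDualSelection xstar ∧
      ∀ C B T : ℕ, ∃ xhat : (Fin T → BInstance n m) → Fin n → ℝ,
        LearnsDuals G xstar C B K T xhat ∧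
        ∀ S : Fin T → BInstance n m, (∀ s, G.IsAdmissible C B (S s)) →
          ∃ (t : ℕ) (σ : State), Runs P (learningInput G C B S 0) t σ ∧
            OutputsVector σ (xhat S) ∧
            (t : ℝ) ≤ K * ((n + m + T + Nat.size C + Nat.size B : ℕ) : ℝ) ^ k := by
  refine ⟨learnProgram, 64 + 2160 * learnProgram.weight, 8, fun n m hn m1 G =>
    ⟨hungarianDual G, isDualSelection_hungarianDual m1, fun C B T => ?_⟩⟩
  refine ⟨ogdAverage C B (hungarianDual G), learnsDuals_mono
    (by have : (0 : ℝ) ≤ 2160 * learnProgram.weight := by positivity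
        linarith) (by norm_num) (learnsDuals_ogdAverage (by omega)), fun S hS => ?_⟩
  set Z := C * 3 ^ ((B.size + 1) * phaseBound n) with hZ
  have hCZ : C ≤ Z := Nat.le_mul_of_pos_right _ (by positivity)
  have hc : ∀ t e, (S t).1 e ≤ C := fun t e => by exact_mod_cast (hS t).1 e
  have hb : ∀ t v, (S t).2 v ≤ B := fun t v => by exact_mod_cast (hS t).2.1 v
  obtain ⟨hO, h1, h2, h3, h4, h5, h6, h7, h8⟩ := ogdBound_ogdMax (m := m) (C := C) (T := T)
    (B := B) (n := n) (Y := 2 * Z + 1) (b := fun t => (seqOf S t).2)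
    (d := fun t => hungarianDual G (seqOf S t))
    (fun t ht v => by rw [seqOf_of_lt S ht]; exact hb _ v)
    (fun t ht v => by
      rw [seqOf_of_lt S ht]
      have := abs_hungarianDual_le (G := G) m1 (hc ⟨t, ht⟩) (hb ⟨t, ht⟩) hZ.ge v
      push_cast
      omega)
  set U := ogdMax n m T C B (2 * Z + 1) with hUdef
  have key : ∀ {a₁ a₂ a₃ a₄ a₅ : ℕ}, a₁ ≤ n + m + 1 → a₂ ≤ (T + 1) * (T + 1) → a₃ ≤ C + 1 →
      a₄ ≤ B + 1 → a₅ ≤ 2 * Z + 2 → 2 * (a₁ * a₂ * a₃ * a₄ * a₅) ≤ U := fun g1 g2 g3 g4 g5 => by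
    rw [hUdef, ogdMax]; gcongr
  have hTT : T + 1 ≤ (T + 1) * (T + 1) := Nat.le_mul_of_pos_left _ (Nat.succ_pos T)
  have g1 : 2 * ((n + m + 1) * 1 * 1 * 1 * 2) ≤ U :=
    key le_rfl (by omega) (by omega) (by omega) (by omega)
  have g2 : 2 * (1 * 1 * 1 * (B + 1) * 1) ≤ U :=
    key (by omega) (by omega) (by omega) le_rfl (by omega)
  have g3 : 2 * (1 * 1 * 1 * 1 * (2 * Z + 2)) ≤ U :=
    key (by omega) (by omega) (by omega) (by omega) le_rfl
  have g4 : 2 * ((n + m) * T * 1 * 1 * 1) ≤ U :=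
    key (by omega) (by omega) (by omega) (by omega) (by omega)
  have g4' : 2 * (T * n + T * m) ≤ U := by
    calc 2 * (T * n + T * m) = 2 * ((n + m) * T * 1 * 1 * 1) := by ring
      _ ≤ U := g4
  obtain ⟨t, τ, hrun, ht, hout⟩ := (learnProgram_spec (G := G) (C := C) (S := S) (U := U) (by omega)
    (by omega) hc hb hZ.ge (by omega) m1 (by omega) (by omega) h5 hO h1 h2).runs
    (bounded_learningInput h3 h4 h5 h6 h7 (fun t e => (hc t e).trans h6)
      (fun t v => (hb t v).trans h7) fun t v => by simp)
  refine ⟨t, τ, hrun, hout, ?_⟩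
  set W := n + m + T + C.size + B.size with hW
  have hW4 : 4 ≤ W := by omega
  have hsize : U.size + 1 ≤ 6 * W ^ 3 := size_learnMax_le hn m1
  have hsteps := learnSteps_le (T := T) (C := C) (B := B) hn m1
  have h11 : t ≤ 2160 * learnProgram.weight * W ^ 8 := by
    calc t ≤ _ := ht
      _ ≤ 360 * W ^ 5 * (learnProgram.weight * (6 * W ^ 3)) := by gcongr
      _ = _ := by ring
  have h12 : (t : ℝ) ≤ 2160 * learnProgram.weight * (W : ℝ) ^ 8 := by exact_mod_cast h11
  refine h12.trans ?_
  gcongr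
  linarith

end Machine

theorem theoremB1 :
    -- (1) minimum-weight perfect b-matching with a predicted dual vector
    (∃ (P : Program) (K : ℝ) (k : ℕ), ∀ (n m : ℕ), 3 ≤ n → 1 ≤ m →
      ∀ (G : BipartiteGraph n m) (c : Fin m → ℕ) (b : Fin n → ℕ) (x : Fin n → ℝ),
      (∃ M, G.IsPerfectBMatching b M) →
      ∃ (t : ℕ) (σ : State) (M : Fin m → ℕ),
        Runs P (matchingInput G c b x) t σ ∧ OutputsMatching σ M ∧
        G.IsMinWeightPerfectBMatching c b M ∧
        ∀ xstar : Fin n → ℤ, G.IsOptimalDual c b (fun v => (xstar v : ℝ)) →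
        ∀ N : ℕ, n ≤ N → (∀ e, c e ≤ N) → (∀ v, b v ≤ N) → (∀ v, |x v| ≤ N) →
          (t : ℝ) ≤ K * (m * n * (1 + bSeminorm b fun v => x v - xstar v)) * Real.log N ^ k) ∧
    -- (2) learning from independent samples in polynomial time
    ((∃ (P : Program) (K : ℝ) (k : ℕ), ∀ (n m : ℕ), 3 ≤ n → 1 ≤ m →
      ∀ G : BipartiteGraph n m, ∃ xstar : BInstance n m → Fin n → ℤ, G.IsDualSelection xstar ∧
      ∀ C B T : ℕ, ∃ xhat : (Fin T → BInstance n m) → Fin n → ℝ,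
        LearnsDuals G xstar C B K T xhat ∧
        ∀ S : Fin T → BInstance n m, (∀ s, G.IsAdmissible C B (S s)) →
          ∃ (t : ℕ) (σ : State), Runs P (learningInput G C B S 0) t σ ∧
            OutputsVector σ (xhat S) ∧
            (t : ℝ) ≤ K * ((n + m + T + Nat.size C + Nat.size B : ℕ) : ℝ) ^ k) ∧
    (∃ (P : Program) (K : ℝ) (k : ℕ), ∀ (n m : ℕ), 3 ≤ n → 1 ≤ m →
      ∀ (G : BipartiteGraph n m) (xstar : BInstance n m → Fin n → ℤ), G.IsDualSelection xstar →
      ∀ C B T : ℕ, ∃ xhat : (Fin T → BInstance n m) → Fin n → ℝ,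
        LearnsDuals G xstar C B K T xhat ∧
        ∀ S : Fin T → BInstance n m, (∀ s, G.IsAdmissible C B (S s)) →
          ∃ (t : ℕ) (σ : State), Runs P (learningInput G C B S fun s => xstar (S s)) t σ ∧
            OutputsVector σ (xhat S) ∧
            ∀ Y : ℕ, (∀ s v, |xstar (S s) v| ≤ Y) →
              (t : ℝ) ≤ K * ((n + m + T + Nat.size C + Nat.size B + Nat.size Y : ℕ) : ℝ) ^ k)) ∧
    -- (3) regret of online gradient descent
    (∀ (C B : ℝ) (T : ℕ), 0 ≤ C → 0 ≤ B → ∃ α : ℝ, 0 < α ∧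
      ∀ (n m : ℕ), 3 ≤ n → 1 ≤ m →
      ∀ (G : BipartiteGraph n m) (xstar : BInstance n m → Fin n → ℤ), G.IsDualSelection xstar →
      ∀ I : ℕ → BInstance n m, (∀ t < T, G.IsAdmissible C B (I t)) →
      ∀ x : ℕ → EuclideanSpace ℝ (Fin n),
        IsOGDRun {z | ∀ v, |z v| ≤ C} α T (fun t z => dualLoss xstar (I t) z) x →
      ∀ u : EuclideanSpace ℝ (Fin n), (∀ v, |u v| ≤ C) →
        ∑ t ∈ Finset.range T, (dualLoss xstar (I t) (x t) - dualLoss xstar (I t) u) ≤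
          C * B * n * √(2 * T)) :=
  ⟨exists_matching_algorithm, ⟨exists_learning_algorithm, exists_learning_algorithm_with_feedback⟩,
    exists_ogd_step_size⟩
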